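/- Let $\mathcal H_1$ be the Hilbert space of one bosonic mode with orthonormal basis of number states $|n\rangle$ ($n\ge 0$) and annihilation operator $a$, $a|n\rangle=\sqrt n\,|n-1\rangle$, and let $\mathcal H_2=\mathcal H_1\otimes\mathcal H_1$ be the space of two modes $0,1$, with annihilation operators $a_0,a_1$. Let $\Phi_j\subset\mathcal H_j\subset\Phi_j'$ ($j=1,2$) be the rigged Hilbert spaces in which $\Phi_j$ consists of all $\varphi$ with $\langle\varphi|(1+N)^r|\varphi\rangle<\infty$ for every $r\in\mathbb N$ ($N$ the total number operator), topologized by these norms; elements of $\Phi_j'$ are called generalized vectors, and $|F\rangle\in\Phi_j'$ acts by $\varphi\mapsto\langle F|\varphi\rangle$. An operator $U$ which is unitary on $\mathcal H_j$ and whose inverse maps $\Phi_j$ into itself acts on $\Phi_j'$ by $\langle UF|\varphi\rangle=\langle F|U^{-1}\varphi\rangle$. In the holomorphic representation $|n\rangle=\bar u^n/\sqrt{n!}$, so an entire function $g(\bar u)=\sum_n b_n\bar u^n/\sqrt{n!}$ represents $\sum_n b_n|n\rangle$. For $\alpha\in\mathbb C$ let $D(\alpha)=e^{iH_{\rm laser}(\alpha)}$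 with $H_{\rm laser}(\alpha)=i(\bar\alpha a-\alpha a^\dagger)$, and let $e^{iH_{\rm hbs}}$, $H_{\rm hbs}=i\frac{\pi}{4}(a_0^\dagger a_1-a_0a_1^\dagger)$, be the half-beam splitter. These are unitary operators, given on number states by norm convergent exponential series. (1) For every $\alpha\in\mathbb C$ the series $S_\alpha=\sum_n (D(\alpha)|n\rangle)\otimes|n\rangle$ converges weakly in $\Phi_2'$. The family $\pi^{-1/2}S_\alpha$, $\alpha=x_-+ip_+\in\mathbb C$ (the generalized Bell basis), is a complete orthonormal system in the generalized sense: (1a) (Completeness.) If $\langle\pi^{-1/2}S_\alpha|\varphi\rangle=0$ for all $\alpha$, then $\varphi=0$; and $\pi^{-1}\int |S_\alpha\rangle\langle S_\alpha|\,dx_-dp_+=I$, that is, $\pi^{-1}\int\overline{\langle S_\alpha|\varphi\rangle}\,\langle S_\alpha|\psi\rangle\,dx_-dp_+=\langle\varphi|\psi\rangle$ for all $\varphi,\psi\in\Phi_2$, with an integrable integrand. (1b) (Delta-normalized orthogonality.) $\pi^{-1}\langle S_{\alpha'}|S_\alpha\rangle=\delta(x_-'-x_-)\,\delta(p_+'-p_+)$.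 (2) The expressions $$|x\rangle=\pi^{-1/4}e^{-x^2/2}e^{-\bar u^2/2}e^{\sqrt2x\bar u},\qquad |p\rangle=\pi^{-1/4}e^{-p^2/2}e^{\bar u^2/2}e^{i\sqrt2p\bar u}\qquad(x,p\in\mathbb R)$$ define generalized vectors in $\Phi_1'$, which are generalized eigenvectors of $(a+a^\dagger)/\sqrt2$ with eigenvalue $x$ and of $(a-a^\dagger)/(\sqrt2\,i)$ with eigenvalue $p$, respectively. They satisfy $\langle x'|x\rangle=\delta(x'-x)$ and $\langle p'|p\rangle=\delta(p'-p)$. (3) For $\alpha=x_-+ip_+$, $$e^{iH_{\rm hbs}}\sum_{n=0}^\infty (D(\alpha)|n\rangle)\otimes|n\rangle=\pi^{1/2}\,|x_-\rangle\otimes|p_+\rangle .$$ Here, for a family $(F_e)$ of generalized vectors indexed by $e\in E$ ($E=\mathbb R$ or $\mathbb C$ with Lebesgue measure), $\langle F_{e'}|F_e\rangle=\delta(e'-e)$ means: for every Schwartz function $f$ on $E$ the smeared vector $\psi=\int f(e)|F_e\rangle\,de$ (a weak integral, absolutely convergent against every $\varphi\in\Phi$) belongs to $\Phi$, and $\langle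 F_{e'}|\psi\rangle=f(e')$ for all $e'\in E$. -/

import Mathlib

open scoped ComplexConjugate

noncomputable section

namespace CVTeleport

/-- An index set of a number basis: `total i` is the total number of quanta in the number state
`|i⟩`.  One mode is indexed by `ℕ`, two modes by `ℕ × ℕ`. -/
class Occupation (ι : Type) where
  total : ι → ℕ

instance : Occupation ℕ := ⟨fun n => n⟩

instance : Occupation (ℕ × ℕ) := ⟨fun n => n.1 + n.2⟩

variable {ι : Type} [Occupation ι]

/-- The weight `(1 + N)^r` of the number state `|i⟩`, where `N` is the number operator. -/
def weight (r : ℕ) (i : ι) : ℝ := (1 + (Occupation.total i : ℝ)) ^ r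

/-- The Hilbert space of square summable amplitudes in the number basis. -/
abbrev Hilb (ι : Type) : Type := lp (fun _ : ι => ℂ) 2

lemma weight_nonneg (r : ℕ) (i : ι) : 0 ≤ weight r i := by
  unfold weight; positivity

variable (ι) in
/-- Sequences `c` with `⟨c|(1+N)^r|c⟩ = ∑ (1 + N(i))^r |c i|² < ∞` for every `r`. -/
def rapidSubmodule : Submodule ℂ (ι → ℂ) where
  carrier := {c | ∀ r : ℕ, Summable fun i => weight r i * ‖c i‖ ^ 2}
  zero_mem' := by intro r; simp
  add_mem' := by
    intro c d hc hd r
    refine Summable.of_nonneg_of_le (fun i => mul_nonneg (weight_nonneg r i) (sq_nonneg _)) ?_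
      (((hc r).mul_left 2).add ((hd r).mul_left 2))
    intro i
    have h1 : ‖c i + d i‖ ^ 2 ≤ 2 * ‖c i‖ ^ 2 + 2 * ‖d i‖ ^ 2 := by
      have := norm_add_le (c i) (d i)
      nlinarith [sq_nonneg (‖c i‖ - ‖d i‖), norm_nonneg (c i + d i)]
    have := mul_le_mul_of_nonneg_left h1 (weight_nonneg r i)
    simp only [Pi.add_apply]
    linarith
  smul_mem' := by
    intro z c hc r
    refine ((hc r).mul_left (‖z‖ ^ 2)).congr ?_
    intro i
    simp only [Pi.smul_apply, smul_eq_mul, norm_mul]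
    ring

variable (ι) in
/-- The space `Φ` of the rigged Hilbert space `Φ ⊂ Hilb ι ⊂ Φ'`. -/
def TestSpace : Type := rapidSubmodule ι

instance : AddCommGroup (TestSpace ι) := inferInstanceAs (AddCommGroup (rapidSubmodule ι))

instance : Module ℂ (TestSpace ι) := inferInstanceAs (Module ℂ (rapidSubmodule ι))

/-- The amplitude `⟨i|φ⟩`. -/
def TestSpace.amp (φ : TestSpace ι) (i : ι) : ℂ := φ.1 i

/-- `φ ↦ (1+N)^{r/2} φ`, as a map into the Hilbert space, so that `‖weighted r φ‖` is the norm
`⟨φ|(1+N)^r|φ⟩^{1/2}`. -/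
def weighted (r : ℕ) : TestSpace ι →ₗ[ℂ] Hilb ι where
  toFun φ := ⟨fun i => (Real.sqrt (weight r i) : ℂ) * φ.amp i, by
    refine memℓp_gen ?_
    refine (φ.2 r).congr ?_
    intro i
    simp only [ENNReal.toReal_ofNat, Real.rpow_ofNat, norm_mul, mul_pow, Complex.norm_real,
      Real.norm_eq_abs, sq_abs, Real.sq_sqrt (weight_nonneg r i), TestSpace.amp]⟩
  map_add' φ ψ := by
    ext i
    exact mul_add _ _ _
  map_smul' z φ := by
    ext i
    exact mul_left_comm _ _ _

/-- The topology of `Φ`, generated by the norms `⟨φ|(1+N)^r|φ⟩^{1/2}`, `r = 0, 1, 2, …`. -/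
instance : TopologicalSpace (TestSpace ι) :=
  ⨅ r : ℕ, TopologicalSpace.induced (weighted r) inferInstance

/-- The inclusion `Φ ⊂ Hilb ι` (for `r = 0` all weights are `1`). -/
def incl : TestSpace ι →ₗ[ℂ] Hilb ι := weighted 0

/-- Generalized vectors: the topological dual `Φ'`.  A vector `|F⟩` acts on `φ` as `⟨F|φ⟩`. -/
abbrev GenVec (ι : Type) [Occupation ι] : Type := TestSpace ι →L[ℂ] ℂ

/-- The number state `|i⟩`. -/
def numberState [DecidableEq ι] (i : ι) : TestSpace ι :=
  ⟨Pi.single i 1, fun r => summable_of_ne_finset_zero (s := {i}) (fun j hj => by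
    have : j ≠ i := by simpa using hj
    simp [this])⟩

/-- The number state as an element of the Hilbert space. -/
def ket [DecidableEq ι] (i : ι) : Hilb ι := incl (numberState i)

/-! ### Creation and annihilation operators -/

variable (ι) in
/-- A mode: `occ i` is the number of its quanta in `|i⟩`; `raise` and `lower` add and remove
one of them. -/
structure Mode where
  occ : ι → ℕ
  raise : ι → ι
  lower : ι → ι
  lower_raise : ∀ i, lower (raise i) = i
  occ_raise : ∀ i, occ (raise i) = occ i + 1
  raise_lower : ∀ i, occ i ≠ 0 → raise (lower i) = i
  total_raise : ∀ i, Occupation.total (raise i) = Occupation.total i + 1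
  occ_le : ∀ i, occ i ≤ Occupation.total i

/-- The only mode of the one-mode space. -/
def mode : Mode ℕ where
  occ n := n
  raise n := n + 1
  lower n := n - 1
  lower_raise n := by simp
  occ_raise n := rfl
  raise_lower n hn := by omega
  total_raise n := rfl
  occ_le n := le_rfl

/-- Mode `0` of the two-mode space. -/
def mode0 : Mode (ℕ × ℕ) where
  occ n := n.1
  raise n := (n.1 + 1, n.2)
  lower n := (n.1 - 1, n.2)
  lower_raise n := by simp
  occ_raise n := rfl
  raise_lower n hn := by ext <;> simp; omega
  total_raise n := by simp only [Occupation.total]; omega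
  occ_le n := by simp only [Occupation.total]; omega

/-- Mode `1` of the two-mode space. -/
def mode1 : Mode (ℕ × ℕ) where
  occ n := n.2
  raise n := (n.1, n.2 + 1)
  lower n := (n.1, n.2 - 1)
  lower_raise n := by simp
  occ_raise n := rfl
  raise_lower n hn := by ext <;> simp; omega
  total_raise n := by simp only [Occupation.total]; omega
  occ_le n := by simp only [Occupation.total]; omega

lemma Mode.raise_injective (M : Mode ι) : Function.Injective M.raise :=
  Function.LeftInverse.injective M.lower_raise

/-- The annihilation operator: `a |n⟩ = √n |n-1⟩`, i.e. `⟨n|a φ⟩ = √(n+1) ⟨n+1|φ⟩`. -/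
def annihilation (M : Mode ι) : TestSpace ι →ₗ[ℂ] TestSpace ι where
  toFun φ := ⟨fun i => (Real.sqrt (M.occ i + 1) : ℂ) * φ.amp (M.raise i), fun r => by
    refine Summable.of_nonneg_of_le (fun i => mul_nonneg (weight_nonneg r i) (sq_nonneg _)) ?_
      ((φ.2 (r + 1)).comp_injective M.raise_injective)
    intro i
    have h1 : (M.occ i : ℝ) ≤ Occupation.total i := by exact_mod_cast M.occ_le i
    have h2 : (0 : ℝ) ≤ M.occ i := Nat.cast_nonneg _
    simp only [Function.comp, weight, TestSpace.amp, norm_mul, mul_pow, Complex.norm_real,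
      Real.norm_eq_abs, sq_abs, M.total_raise i, Nat.cast_add, Nat.cast_one]
    rw [Real.sq_sqrt (by positivity), ← mul_assoc]
    refine mul_le_mul_of_nonneg_right ?_ (sq_nonneg _)
    rw [pow_succ]
    exact mul_le_mul (pow_le_pow_left₀ (by linarith) (by linarith) _) (by linarith) (by linarith)
        (pow_nonneg (by linarith) _)⟩
  map_add' φ ψ := Subtype.ext (funext fun _ => mul_add _ _ _)
  map_smul' z φ := Subtype.ext (funext fun _ => mul_left_comm _ _ _)

/-- The creation operator: `a† |n⟩ = √(n+1) |n+1⟩`, i.e. `⟨n|a† φ⟩ = √n ⟨n-1|φ⟩`. -/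
def creation (M : Mode ι) : TestSpace ι →ₗ[ℂ] TestSpace ι where
  toFun φ := ⟨fun i => (Real.sqrt (M.occ i) : ℂ) * φ.amp (M.lower i), fun r => by
    refine (M.raise_injective.summable_iff ?_).1 ?_
    · intro i hi
      have : M.occ i = 0 := by
        by_contra h
        exact hi ⟨M.lower i, M.raise_lower i h⟩
      simp [this]
    · refine Summable.of_nonneg_of_le
        (fun i => mul_nonneg (weight_nonneg r _) (sq_nonneg _)) ?_
        ((φ.2 (r + 1)).mul_left (2 ^ r))
      intro i
      have h1 : (M.occ i : ℝ) ≤ Occupation.total i := by exact_mod_cast M.occ_le i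
      have h2 : (0 : ℝ) ≤ M.occ i := Nat.cast_nonneg _
      simp only [Function.comp, weight, TestSpace.amp, norm_mul, mul_pow, Complex.norm_real,
        Real.norm_eq_abs, sq_abs, M.total_raise i, M.occ_raise i, M.lower_raise i, Nat.cast_add,
        Nat.cast_one]
      rw [Real.sq_sqrt (by positivity), ← mul_assoc, ← mul_assoc]
      refine mul_le_mul_of_nonneg_right ?_ (sq_nonneg _)
      rw [pow_succ, ← mul_assoc, ← mul_pow]
      exact mul_le_mul (pow_le_pow_left₀ (by linarith) (by linarith) _) (by linarith) (by linarith)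
        (pow_nonneg (by linarith) _)⟩
  map_add' φ ψ := Subtype.ext (funext fun _ => mul_add _ _ _)
  map_smul' z φ := Subtype.ext (funext fun _ => mul_left_comm _ _ _)

/-! ### Unitary operators generated by Hamiltonians -/

/-- `U = e^{iH}`: the unitary operator `U` is given on every number state by the norm convergent
exponential series `∑ (iH)^k/k!`.  As the number states span a dense subspace, this
determines `U`. -/
def IsExpI [DecidableEq ι] (H : TestSpace ι →ₗ[ℂ] TestSpace ι) (U : Hilb ι ≃ₗᵢ[ℂ] Hilb ι) : Prop :=
  ∀ i : ι, HasSum (fun k : ℕ => (Complex.I ^ k / (k.factorial : ℂ)) • incl ((H ^ k) (numberState i)))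
    (U (ket i))

open Classical in
/-- The unitary operator `e^{iH}` (the identity, should there be none). -/
def expI [DecidableEq ι] (H : TestSpace ι →ₗ[ℂ] TestSpace ι) : Hilb ι ≃ₗᵢ[ℂ] Hilb ι :=
  if h : ∃ U : Hilb ι ≃ₗᵢ[ℂ] Hilb ι, IsExpI H U then h.choose else LinearIsometryEquiv.refl ℂ _

/-- `H_laser(α) = i(ᾱ a - α a†)`. -/
def laserHamiltonian (α : ℂ) : TestSpace ℕ →ₗ[ℂ] TestSpace ℕ :=
  Complex.I • (conj α • annihilation mode - α • creation mode)

/-- The displacement operator `D(α) = e^{i H_laser(α)}`. -/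
def displacement (α : ℂ) : Hilb ℕ ≃ₗᵢ[ℂ] Hilb ℕ := expI (laserHamiltonian α)

/-- `H_hbs = i(π/4)(a₀† a₁ - a₀ a₁†)`. -/
def hbsHamiltonian : TestSpace (ℕ × ℕ) →ₗ[ℂ] TestSpace (ℕ × ℕ) :=
  (Complex.I * (Real.pi / 4 : ℝ)) •
    (creation mode0 ∘ₗ annihilation mode1 - annihilation mode0 ∘ₗ creation mode1)

/-- The half-beam splitter `e^{i H_hbs}`. -/
def halfBeamSplitter : Hilb (ℕ × ℕ) ≃ₗᵢ[ℂ] Hilb (ℕ × ℕ) := expI hbsHamiltonian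

/-- The position operator `x = (a + a†)/√2`. -/
def position : TestSpace ℕ →ₗ[ℂ] TestSpace ℕ :=
  ((Real.sqrt 2 : ℂ)⁻¹) • (annihilation mode + creation mode)

/-- The momentum operator `p = (a - a†)/(√2 i)`. -/
def momentum : TestSpace ℕ →ₗ[ℂ] TestSpace ℕ :=
  ((Real.sqrt 2 : ℂ) * Complex.I)⁻¹ • (annihilation mode - creation mode)

/-! ### Tensor products -/

lemma summable_tensor {u v : ℕ → ℝ} (hu : Summable u) (hv : Summable v) (hu0 : ∀ n, 0 ≤ u n)
    (hv0 : ∀ n, 0 ≤ v n) : Summable fun n : ℕ × ℕ => u n.1 * v n.2 :=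
  hu.mul_of_nonneg hv hu0 hv0

/-- `ψ ⊗ χ` in the two-mode Hilbert space. -/
def tensor (ψ χ : Hilb ℕ) : Hilb (ℕ × ℕ) :=
  ⟨fun n => ψ n.1 * χ n.2, by
    refine memℓp_gen ?_
    have h1 := (memℓp_gen_iff (by norm_num)).1 (lp.memℓp ψ)
    have h2 := (memℓp_gen_iff (by norm_num)).1 (lp.memℓp χ)
    refine (summable_tensor h1 h2 (fun _ => by positivity) (fun _ => by positivity)).congr ?_
    intro n
    simp only [ENNReal.toReal_ofNat, Real.rpow_ofNat, norm_mul, mul_pow]⟩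

/-- `φ ⊗ χ` in the two-mode test space. -/
def tensorTest (φ χ : TestSpace ℕ) : TestSpace (ℕ × ℕ) :=
  ⟨fun n => φ.amp n.1 * χ.amp n.2, fun r => by
    refine Summable.of_nonneg_of_le (fun i => mul_nonneg (weight_nonneg r _) (sq_nonneg _)) ?_
      (summable_tensor (φ.2 r) (χ.2 r) (fun _ => mul_nonneg (weight_nonneg r _) (sq_nonneg _))
        (fun _ => mul_nonneg (weight_nonneg r _) (sq_nonneg _)))
    intro n
    simp only [weight, Occupation.total, TestSpace.amp, norm_mul, mul_pow, Nat.cast_add]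
    have h : (1 + ((n.1 : ℝ) + n.2)) ^ r ≤ (1 + (n.1 : ℝ)) ^ r * (1 + (n.2 : ℝ)) ^ r := by
      rw [← mul_pow]
      gcongr
      nlinarith [mul_nonneg (Nat.cast_nonneg (α := ℝ) n.1) (Nat.cast_nonneg (α := ℝ) n.2)]
    have := mul_le_mul_of_nonneg_right h
      (mul_nonneg (sq_nonneg ‖φ.1 n.1‖) (sq_nonneg ‖χ.1 n.2‖))
    linarith⟩

/-- `T = F ⊗ G` for generalized vectors.  Finite sums of products are dense in the two-mode test
space, so `T` is determined. -/
def IsTensor (F G : GenVec ℕ) (T : GenVec (ℕ × ℕ)) : Prop :=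
  ∀ φ χ : TestSpace ℕ, T (tensorTest φ χ) = F φ * G χ

/-! ### Generalized vectors -/

/-- `F = ∑ v_k` as a generalized vector: the series of Hilbert space vectors converges
in `Φ'` (weakly), `⟨F|φ⟩ = ∑ ⟨v_k|φ⟩`. -/
def IsGenSum (v : ℕ → Hilb ι) (F : GenVec ι) : Prop :=
  ∀ φ : TestSpace ι, HasSum (fun k => inner ℂ (v k) (incl φ)) (F φ)

/-- `F` is the generalized vector whose holomorphic representation is the entire function `g` of
the variable `ū`: since `|n⟩ = ūⁿ/√n!`, the expansion `g(ū) = ∑ b_n ūⁿ/√n!` means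
`F = ∑ b_n |n⟩`. -/
def IsRepresentedBy (F : GenVec ℕ) (g : ℂ → ℂ) : Prop :=
  ∃ b : ℕ → ℂ, (∀ w : ℂ, HasSum (fun n : ℕ => b n * (w ^ n / (Real.sqrt (n.factorial : ℝ) : ℂ))) (g w)) ∧
    ∀ φ : TestSpace ℕ, HasSum (fun n : ℕ => conj (b n) * φ.amp n) (F φ)

/-- The function `π^{-1/4} e^{-x²/2} e^{-ū²/2} e^{√2 x ū}`. -/
def positionFun (x : ℝ) (w : ℂ) : ℂ :=
  ((Real.pi ^ (-(1 / 4 : ℝ)) : ℝ) : ℂ) * Complex.exp (-((x : ℂ) ^ 2) / 2) *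
    Complex.exp (-(w ^ 2) / 2) * Complex.exp ((Real.sqrt 2 : ℂ) * x * w)

/-- The function `π^{-1/4} e^{-p²/2} e^{ū²/2} e^{i √2 p ū}`. -/
def momentumFun (p : ℝ) (w : ℂ) : ℂ :=
  ((Real.pi ^ (-(1 / 4 : ℝ)) : ℝ) : ℂ) * Complex.exp (-((p : ℂ) ^ 2) / 2) *
    Complex.exp (w ^ 2 / 2) * Complex.exp (Complex.I * (Real.sqrt 2 : ℂ) * p * w)

/-- `F` is a generalized eigenvector of `A` with real eigenvalue `l`. -/
def IsGenEigenvector (A : TestSpace ι →ₗ[ℂ] TestSpace ι) (l : ℝ) (F : GenVec ι) : Prop :=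
  F ≠ 0 ∧ ∀ φ : TestSpace ι, F (A φ) = (l : ℂ) * F φ

/-- `G = U F`, where the unitary operator `U` acts on generalized vectors by
`⟨U F|φ⟩ = ⟨F|U⁻¹ φ⟩`; in particular `U⁻¹` maps `Φ` into `Φ`. -/
def IsImage (U : Hilb ι ≃ₗᵢ[ℂ] Hilb ι) (F G : GenVec ι) : Prop :=
  ∀ φ : TestSpace ι, ∃ ψ : TestSpace ι, incl ψ = U.symm (incl φ) ∧ G φ = F ψ

/-- Completeness of a family of generalized vectors: `φ` vanishes if all `⟨F_e|φ⟩` do, and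
`∫ |F_e⟩⟨F_e| de = I`. -/
def IsGenComplete {E : Type} [MeasureTheory.MeasureSpace E] (F : E → GenVec ι) : Prop :=
  (∀ φ : TestSpace ι, (∀ e, F e φ = 0) → φ = 0) ∧
  ∀ φ ψ : TestSpace ι,
    MeasureTheory.Integrable (fun e => conj (F e φ) * F e ψ) ∧
      ∫ e, conj (F e φ) * F e ψ = inner ℂ (incl φ) (incl ψ)

/-- Delta-normalized orthogonality `⟨F_{e'}|F_e⟩ = δ(e' - e)`: for every Schwartz function `f`, the
smeared vector `ψ = ∫ f(e) |F_e⟩ de` (a weak integral) belongs to `Φ`, and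
`⟨F_{e'}|ψ⟩ = f(e')` for all `e'`. -/
def IsDeltaOrthonormal {E : Type} [NormedAddCommGroup E] [NormedSpace ℝ E]
    [MeasureTheory.MeasureSpace E] (F : E → GenVec ι) : Prop :=
  ∀ f : SchwartzMap E ℂ, ∃ ψ : TestSpace ι,
    (∀ φ : TestSpace ι, MeasureTheory.Integrable (fun e => conj (f e) * F e φ) ∧
      inner ℂ (incl ψ) (incl φ) = ∫ e, conj (f e) * F e φ) ∧
    ∀ e', F e' ψ = f e'

end CVTeleport

end

open scoped ComplexConjugate

noncomputable section

namespace CVTeleport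

/-! ### Hermite functions -/

/-! The sum $S_\alpha$ is never computed as a series. Let `T z` be the two-mode generalized vector
with amplitudes `I ^ n * h_m(re z) * h_n(im z)`, that is $|x\rangle\otimes|p\rangle$ for $z=x+ip$,
and let `V` be the half-beam splitter restricted to the test space. One sets
$S_\alpha=\sqrt\pi\,T_\alpha\circ V$, the preimage of $\sqrt\pi\,|x_-\rangle\otimes|p_+\rangle$
under the beam splitter, so that (3) is built in.

What remains is that the amplitudes of this vector are the matrix elements of $D(\alpha)$
(`displacement_apply_eq`). The product `T` is an eigenvector of $a_0+a_0^\dagger$ and of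
$a_1-a_1^\dagger$, and the beam splitter rotates the modes by 45 degrees; hence $T\circ V$ takes the
value $\alpha$ on $a_0-a_1^\dagger$ and $\bar\alpha$ on $a_0^\dagger-a_1$. On number states these
are the recursions for $\langle m|D(\alpha)|n\rangle$ that follow from $[a,K]=\alpha$ and
$[a^\dagger,K]=\bar\alpha$ with $D(\alpha)=e^K$. They determine all matrix elements from the vacuum
element $e^{-|\alpha|^2/2}$.

Completeness and delta-normalization are proved once, for any family with amplitudes $c_i h_i(e)$,
where $|c_i|=1$ and the $h_i$ form an `IsHermiteSystem`. Pairing with such a family expands a test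
vector in the orthonormal functions $h_i$. A continuous square integrable function orthogonal to all
$h_i$ vanishes, because Gaussian plane waves are absolutely convergent sums of the $h_i$ and the
Fourier transform is injective. Smearing with a Schwartz function lands in $\Phi$ because the
harmonic oscillator acts on Schwartz space and multiplies the coefficients by $1+N$. This applies to
$|x\rangle$, $|p\rangle$ and `T`. Both properties pass from `T` to $\pi^{-1/2}S$, since the beam
splitter is unitary and maps $\Phi$ onto $\Phi$.

The unitary operators exist because number states are analytic vectors of both Hamiltonians
(`exists_isExpI`). -/

/-- The normalized Hermite functions `h_n`, the wave functions of the number states. -/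
def hermiteFun : ℕ → ℝ → ℝ
  | 0, x => Real.pi ^ (-(1 / 4 : ℝ)) * Real.exp (-x ^ 2 / 2)
  | 1, x => √2 * x * (Real.pi ^ (-(1 / 4 : ℝ)) * Real.exp (-x ^ 2 / 2))
  | n + 2, x => (√2 * x * hermiteFun (n + 1) x - √(n + 1) * hermiteFun n x) / √(n + 2)

/-- At `n = 0` the truncated index `n - 1 = 0` does no harm, since its coefficient `√n` vanishes.
The same convention is used for all lowering relations below. -/
lemma sqrt_succ_mul_hermiteFun_succ (n : ℕ) (x : ℝ) :
    √(n + 1) * hermiteFun (n + 1) x = √2 * x * hermiteFun n x - √n * hermiteFun (n - 1) x := by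
  cases n with
  | zero => simp [hermiteFun]
  | succ n =>
    have : √((n : ℝ) + 2) ≠ 0 := by positivity
    simp only [hermiteFun, Nat.cast_add, Nat.cast_one, Nat.add_sub_cancel]
    rw [add_assoc, one_add_one_eq_two]
    field_simp

lemma hasDerivAt_gaussian (x : ℝ) :
    HasDerivAt (fun x : ℝ => Real.exp (-x ^ 2 / 2)) (-x * Real.exp (-x ^ 2 / 2)) x := by
  have := (((hasDerivAt_id' x).fun_pow 2).fun_neg.div_const 2).exp
  refine this.congr_deriv ?_
  simp; ring_nf

lemma hasDerivAt_hermiteFun_aux (n : ℕ) (x : ℝ) :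
    HasDerivAt (hermiteFun n) (√2 * √n * hermiteFun (n - 1) x - x * hermiteFun n x) x := by
  induction n using Nat.twoStepInduction with
  | zero =>
    have := (hasDerivAt_gaussian x).const_mul (Real.pi ^ (-(1 / 4 : ℝ)))
    refine HasDerivAt.congr_deriv this ?_
    simp [hermiteFun]; ring
  | one =>
    have := ((hasDerivAt_id x).const_mul √2).mul
      ((hasDerivAt_gaussian x).const_mul (Real.pi ^ (-(1 / 4 : ℝ))))
    refine HasDerivAt.congr_deriv this ?_
    simp [hermiteFun]; ring
  | more n h0 h1 =>
    have h2 := ((((hasDerivAt_id x).const_mul √2).mul h1).sub (h0.const_mul √(n + 1))).div_const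
      √(n + 2)
    refine HasDerivAt.congr_deriv h2 (Eq.symm ?_)
    have r0 := sqrt_succ_mul_hermiteFun_succ n x
    have r1 := sqrt_succ_mul_hermiteFun_succ (n + 1) x
    rw [Nat.add_sub_cancel, Nat.cast_add, Nat.cast_one, add_assoc, one_add_one_eq_two] at r1
    have s2 : √(2 : ℝ) * √2 = 2 := Real.mul_self_sqrt (by norm_num)
    have s1 : √((n : ℝ) + 1) * √(n + 1) = n + 1 := Real.mul_self_sqrt (by positivity)
    have s3 : √((n : ℝ) + 2) * √(n + 2) = n + 2 := Real.mul_self_sqrt (by positivity)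
    have hne : √((n : ℝ) + 2) ≠ 0 := by positivity
    push_cast
    simp only [id]
    rw [eq_div_iff hne]
    field_simp
    linear_combination (√2 * hermiteFun (n + 1) x) * (s3 - s1)
      + √2 * √(n + 1) * r0 - x * r1

lemma mul_hermiteFun (n : ℕ) (x : ℝ) :
    x * hermiteFun n x = (√(n + 1) * hermiteFun (n + 1) x + √n * hermiteFun (n - 1) x) / √2 := by
  have s2 : √(2 : ℝ) * √2 = 2 := Real.mul_self_sqrt (by norm_num)
  rw [sqrt_succ_mul_hermiteFun_succ, eq_div_iff (by positivity)]
  ring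

lemma hasDerivAt_hermiteFun (n : ℕ) (x : ℝ) :
    HasDerivAt (hermiteFun n)
      ((√n * hermiteFun (n - 1) x - √(n + 1) * hermiteFun (n + 1) x) / √2) x := by
  convert hasDerivAt_hermiteFun_aux n x using 1
  rw [mul_hermiteFun]
  have s2 : √(2 : ℝ) * √2 = 2 := Real.mul_self_sqrt (by norm_num)
  field_simp
  linear_combination (-√n * hermiteFun (n - 1) x) * s2

lemma continuous_hermiteFun (n : ℕ) : Continuous (hermiteFun n) :=
  continuous_iff_continuousAt.2 fun x => (hasDerivAt_hermiteFun n x).continuousAt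

lemma exists_hermiteFun_eq (n : ℕ) :
    ∃ p : Polynomial ℝ, ∀ x, hermiteFun n x = p.eval x * Real.exp (-x ^ 2 / 2) := by
  induction n using Nat.twoStepInduction with
  | zero => exact ⟨.C (Real.pi ^ (-(1 / 4 : ℝ))), fun x => by simp [hermiteFun]⟩
  | one =>
    refine ⟨.C (√2 * Real.pi ^ (-(1 / 4 : ℝ))) * .X, fun x => ?_⟩
    simp only [hermiteFun, Polynomial.eval_mul, Polynomial.eval_C, Polynomial.eval_X]; ring
  | more n h0 h1 =>
    obtain ⟨p, hp⟩ := h0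
    obtain ⟨q, hq⟩ := h1
    refine ⟨(.C √2 * .X * q - .C √(n + 1) * p) * .C (√(n + 2))⁻¹, fun x => ?_⟩
    simp only [hermiteFun, hp, hq, Polynomial.eval_mul, Polynomial.eval_sub, Polynomial.eval_C,
      Polynomial.eval_X]
    ring

lemma integrable_polynomial_mul_gaussian (p : Polynomial ℝ) :
    MeasureTheory.Integrable fun x : ℝ => p.eval x * Real.exp (-x ^ 2) := by
  induction p using Polynomial.induction_on' with
  | add p q hp hq => simpa only [Polynomial.eval_add, add_mul] using hp.fun_add hq
  | monomial n a =>
    have := (integrable_rpow_mul_exp_neg_mul_sq (b := 1) one_pos (s := n)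
      (by have : (0 : ℝ) ≤ n := n.cast_nonneg; linarith)).const_mul a
    refine this.congr (.of_forall fun x => ?_)
    simp [mul_assoc]

lemma integrable_hermiteFun_mul (m n : ℕ) :
    MeasureTheory.Integrable fun x => hermiteFun m x * hermiteFun n x := by
  obtain ⟨p, hp⟩ := exists_hermiteFun_eq m
  obtain ⟨q, hq⟩ := exists_hermiteFun_eq n
  refine (integrable_polynomial_mul_gaussian (p * q)).congr (.of_forall fun x => ?_)
  simp only [Polynomial.eval_mul, hp, hq]
  rw [show -x ^ 2 = -x ^ 2 / 2 + -x ^ 2 / 2 by ring, Real.exp_add]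
  ring_nf

/-- The derivative of `h_m * h_n` has integral zero. Writing one factor's derivative by lowering and
the other's by raising, the terms with `x` cancel and the adjointness of the two ladder operators
remains. -/
lemma integral_hermiteFun_ladder (m n : ℕ) :
    √m * ∫ x, hermiteFun (m - 1) x * hermiteFun n x =
      √(n + 1) * ∫ x, hermiteFun m x * hermiteFun (n + 1) x := by
  have hd := MeasureTheory.integral_eq_zero_of_hasDerivAt_of_integrable
    (f := fun x => hermiteFun m x * hermiteFun n x)
    (fun x => (hasDerivAt_hermiteFun m x).mul (hasDerivAt_hermiteFun n x)) ?_
    (integrable_hermiteFun_mul m n)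
  · have e : ∀ x, (√m * hermiteFun (m - 1) x - √(m + 1) * hermiteFun (m + 1) x) / √2 *
        hermiteFun n x + hermiteFun m x *
        ((√n * hermiteFun (n - 1) x - √(n + 1) * hermiteFun (n + 1) x) / √2) =
        √2 * (√m * (hermiteFun (m - 1) x * hermiteFun n x) -
          √(n + 1) * (hermiteFun m x * hermiteFun (n + 1) x)) := by
      intro x
      have h1 := sqrt_succ_mul_hermiteFun_succ m x
      have h2 := sqrt_succ_mul_hermiteFun_succ n x
      have s2 : √(2 : ℝ) * √2 = 2 := Real.mul_self_sqrt (by norm_num)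
      field_simp
      rw [show √(2 : ℝ) ^ 2 = 2 by rw [sq, s2]]
      linear_combination (-hermiteFun n x) * h1 + hermiteFun m x * h2
    simp only [e] at hd
    rw [MeasureTheory.integral_const_mul, MeasureTheory.integral_sub
      ((integrable_hermiteFun_mul _ _).const_mul _) ((integrable_hermiteFun_mul _ _).const_mul _),
      MeasureTheory.integral_const_mul, MeasureTheory.integral_const_mul] at hd
    have : √(2 : ℝ) ≠ 0 := by positivity
    simpa [this, sub_eq_zero] using hd
  · have h := ((((integrable_hermiteFun_mul (m - 1) n).const_mul √m).sub
      ((integrable_hermiteFun_mul (m + 1) n).const_mul √(m + 1))).add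
      (((integrable_hermiteFun_mul m (n - 1)).const_mul √n).sub
      ((integrable_hermiteFun_mul m (n + 1)).const_mul √(n + 1)))).div_const √2
    refine h.congr (.of_forall fun x => ?_)
    simp only [Pi.add_apply, Pi.sub_apply]
    ring

lemma integral_hermiteFun_zero : ∫ x, hermiteFun 0 x * hermiteFun 0 x = 1 := by
  have e : ∀ x, hermiteFun 0 x * hermiteFun 0 x = (√Real.pi)⁻¹ * Real.exp (-1 * x ^ 2) := by
    intro x
    simp only [hermiteFun]
    rw [mul_mul_mul_comm, ← Real.exp_add, ← Real.rpow_add Real.pi_pos, Real.sqrt_eq_rpow,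
      ← Real.rpow_neg Real.pi_pos.le]
    congr 2
    · norm_num
    · ring_nf
  simp only [e]
  rw [MeasureTheory.integral_const_mul, integral_gaussian, div_one]
  exact inv_mul_cancel₀ (by positivity)

/-- The ladder relation lowers both indices until one of them is `0`; there `√0 = 0` kills
everything except the norm of the vacuum. -/
lemma integral_hermiteFun_mul (m n : ℕ) :
    ∫ x, hermiteFun m x * hermiteFun n x = if m = n then 1 else 0 := by
  induction n generalizing m with
  | zero =>
    cases m with
    | zero => simp [integral_hermiteFun_zero]
    | succ m =>
      have h := integral_hermiteFun_ladder 0 m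
      have : √((m : ℝ) + 1) ≠ 0 := by positivity
      simp only [CharP.cast_eq_zero, Real.sqrt_zero, zero_mul, zero_eq_mul, this, false_or] at h
      simp only [mul_comm (hermiteFun (m + 1) _), h]
      simp
  | succ n ih =>
    have h := integral_hermiteFun_ladder m n
    have h0 : √((n : ℝ) + 1) ≠ 0 := by positivity
    rw [ih, eq_comm, ← eq_inv_mul_iff_mul_eq₀ h0] at h
    rw [h]
    cases m with
    | zero => simp
    | succ m =>
      by_cases hmn : m = n
      · subst hmn; simp; field_simp
      · simp [hmn]

/-- Since `h²` and its derivative are integrable, `h(x)²` is the integral of `2 h h'` up to `x`,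
hence at most `∫ (h² + h'²) = 1 + (2n + 1)/2`. What matters is uniformity in `x` with polynomial
growth in `n`: this puts the quadrature eigenvectors into the dual of the test space. -/
lemma hermiteFun_sq_le (n : ℕ) (x : ℝ) : hermiteFun n x ^ 2 ≤ n + 2 := by
  set d : ℝ → ℝ := fun x => (√n * hermiteFun (n - 1) x - √(n + 1) * hermiteFun (n + 1) x) / √2
    with hd_def
  have hd : ∀ y, HasDerivAt (hermiteFun n) (d y) y := hasDerivAt_hermiteFun n
  have i1 := integrable_hermiteFun_mul n n
  have i2 : MeasureTheory.Integrable fun y => d y * d y := by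
    have := ((((integrable_hermiteFun_mul (n - 1) (n - 1)).const_mul (√n * √n)).sub
      ((integrable_hermiteFun_mul (n - 1) (n + 1)).const_mul (2 * √n * √(n + 1)))).add
      ((integrable_hermiteFun_mul (n + 1) (n + 1)).const_mul (√(n + 1) * √(n + 1)))).div_const 2
    refine this.congr (.of_forall fun y => ?_)
    have s2 : √(2 : ℝ) * √2 = 2 := Real.mul_self_sqrt (by norm_num)
    simp only [hd_def, Pi.add_apply, Pi.sub_apply, div_mul_div_comm, s2]
    ring
  have v2 : ∫ y, d y * d y = (2 * n + 1) / 2 := by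
    have e : ∀ y, d y * d y = (n * (hermiteFun (n - 1) y * hermiteFun (n - 1) y) -
        (2 * √n * √(n + 1)) * (hermiteFun (n - 1) y * hermiteFun (n + 1) y) +
        (n + 1) * (hermiteFun (n + 1) y * hermiteFun (n + 1) y)) / 2 := by
      intro y
      have s2 : √(2 : ℝ) * √2 = 2 := Real.mul_self_sqrt (by norm_num)
      have s1 : √((n : ℝ) + 1) * √(n + 1) = n + 1 := Real.mul_self_sqrt (by positivity)
      have s0 : √(n : ℝ) * √n = n := Real.mul_self_sqrt (by positivity)
      simp only [hd_def, div_mul_div_comm, s2]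
      linear_combination (hermiteFun (n - 1) y * hermiteFun (n - 1) y) / 2 * s0 +
        (hermiteFun (n + 1) y * hermiteFun (n + 1) y) / 2 * s1
    simp only [e]
    rw [MeasureTheory.integral_div, MeasureTheory.integral_add, MeasureTheory.integral_sub]
    · simp only [MeasureTheory.integral_const_mul, integral_hermiteFun_mul]
      rw [if_neg (show n - 1 ≠ n + 1 by omega)]
      simp only [if_true]; ring
    · exact (integrable_hermiteFun_mul _ _).const_mul _
    · exact (integrable_hermiteFun_mul _ _).const_mul _
    · exact ((integrable_hermiteFun_mul _ _).const_mul _).sub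
        ((integrable_hermiteFun_mul _ _).const_mul _)
    · exact (integrable_hermiteFun_mul _ _).const_mul _
  have hdc : Continuous d := by
    have := continuous_hermiteFun
    fun_prop
  have hder : ∀ y, HasDerivAt (fun y => hermiteFun n y * hermiteFun n y)
      (d y * hermiteFun n y + hermiteFun n y * d y) y := fun y => (hd y).mul (hd y)
  have hle : ∀ y, ‖d y * hermiteFun n y + hermiteFun n y * d y‖ ≤
      hermiteFun n y * hermiteFun n y + d y * d y := by
    intro y
    rw [Real.norm_eq_abs, abs_le]
    constructor <;> nlinarith [sq_nonneg (d y - hermiteFun n y), sq_nonneg (d y + hermiteFun n y)]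
  have i3 : MeasureTheory.Integrable fun y => d y * hermiteFun n y + hermiteFun n y * d y :=
    (i1.add i2).mono' (by have := continuous_hermiteFun n; fun_prop) (.of_forall hle)
  have hlim := MeasureTheory.tendsto_zero_of_hasDerivAt_of_integrableOn_Iic (a := x)
    (fun y _ => hder y) i3.integrableOn i1.integrableOn
  have h1 := MeasureTheory.integral_Iic_of_hasDerivAt_of_tendsto' (a := x) (fun y _ => hder y)
    i3.integrableOn hlim
  rw [sub_zero] at h1
  rw [sq, ← h1]
  calc _ ≤ ∫ y in Set.Iic x, (hermiteFun n y * hermiteFun n y + d y * d y) :=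
        MeasureTheory.integral_mono i3.integrableOn (i1.add i2).integrableOn
          fun y => (le_abs_self _).trans (hle y)
    _ ≤ ∫ y, (hermiteFun n y * hermiteFun n y + d y * d y) :=
        MeasureTheory.setIntegral_le_integral (i1.add i2) (.of_forall fun y =>
          add_nonneg (mul_self_nonneg _) (mul_self_nonneg _))
    _ = 1 + (2 * n + 1) / 2 := by
        rw [MeasureTheory.integral_add i1 i2, v2, integral_hermiteFun_mul]; simp
    _ ≤ n + 2 := by linarith

lemma abs_hermiteFun_le (n : ℕ) (x : ℝ) : |hermiteFun n x| ≤ n + 2 := by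
  have h := hermiteFun_sq_le n x
  have : (0 : ℝ) ≤ n := n.cast_nonneg
  rw [← sq_abs] at h
  nlinarith [abs_nonneg (hermiteFun n x)]

/-! ### The generating function -/

lemma hasDerivAt_positionFun (x : ℝ) (w : ℂ) :
    HasDerivAt (positionFun x) ((√2 * x - w) * positionFun x w) w := by
  have h1 : HasDerivAt (fun w : ℂ => Complex.exp (-(w ^ 2) / 2))
      (Complex.exp (-(w ^ 2) / 2) * (-w)) w := by
    refine (((hasDerivAt_id' w).fun_pow 2).fun_neg.div_const 2).cexp.congr_deriv ?_
    simp; ring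
  have h2 : HasDerivAt (fun w : ℂ => Complex.exp ((√2 : ℂ) * x * w))
      (Complex.exp ((√2 : ℂ) * x * w) * ((√2 : ℂ) * x)) w := by
    simpa using ((hasDerivAt_id w).const_mul ((√2 : ℂ) * x)).cexp
  refine HasDerivAt.congr_deriv ((h1.const_mul (((Real.pi ^ (-(1 / 4 : ℝ)) : ℝ) : ℂ) *
    Complex.exp (-((x : ℂ) ^ 2) / 2))).mul h2) ?_
  simp only [positionFun]; ring

lemma differentiable_positionFun (x : ℝ) : Differentiable ℂ (positionFun x) :=
  fun w => (hasDerivAt_positionFun x w).differentiableAt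

/-- The equation `g' = (√2 x - w) g` is differentiated `n` times; as the factor is affine in `w`,
Leibniz' rule has only one correction term. At `w = 0` this is the Hermite recursion, up to the
factors `√(n!)`. -/
lemma iteratedDeriv_positionFun_succ (x : ℝ) (n : ℕ) (w : ℂ) :
    iteratedDeriv (n + 1) (positionFun x) w = (√2 * x - w) * iteratedDeriv n (positionFun x) w -
      n * iteratedDeriv (n - 1) (positionFun x) w := by
  have hc : ContDiff ℂ ⊤ (positionFun x) := (differentiable_positionFun x).contDiff
  have hd : ∀ k w, HasDerivAt (iteratedDeriv k (positionFun x))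
      (iteratedDeriv (k + 1) (positionFun x) w) w := by
    intro k w
    rw [iteratedDeriv_succ]
    exact (hc.differentiable_iteratedDeriv k (by exact_mod_cast WithTop.coe_lt_top _) w).hasDerivAt
  induction n generalizing w with
  | zero => simp [(hasDerivAt_positionFun x w).deriv]
  | succ n ih =>
    have h1 := (((hasDerivAt_id w).const_sub (√2 * x : ℂ)).mul (hd n w)).sub
      ((hd (n - 1) w).const_mul (n : ℂ))
    conv_lhs => rw [iteratedDeriv_succ, funext ih]
    refine (HasDerivAt.deriv h1).trans ?_
    cases n with
    | zero => simp; ring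
    | succ n => simp only [Nat.add_sub_cancel, id]; push_cast; ring

lemma iteratedDeriv_positionFun_zero (x : ℝ) (n : ℕ) :
    iteratedDeriv n (positionFun x) 0 = √(n.factorial : ℝ) * hermiteFun n x := by
  have h0 : iteratedDeriv 0 (positionFun x) 0 = hermiteFun 0 x := by
    simp [positionFun, hermiteFun]
  have hs : ∀ n : ℕ, √((n + 1).factorial : ℝ) = √(n + 1) * √(n.factorial : ℝ) := by
    intro n
    rw [Nat.factorial_succ, Nat.cast_mul, Real.sqrt_mul (by positivity)]; simp
  induction n using Nat.twoStepInduction with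
  | zero => simpa using h0
  | one =>
    rw [iteratedDeriv_positionFun_succ, h0]
    simp [hermiteFun]
  | more n i0 i1 =>
    have r := sqrt_succ_mul_hermiteFun_succ (n + 1) x
    have s1 : √((n : ℝ) + 1) * √(n + 1) = n + 1 := Real.mul_self_sqrt (by positivity)
    rw [iteratedDeriv_positionFun_succ, i1]
    simp only [Nat.add_sub_cancel] at r ⊢
    rw [i0]
    norm_cast
    rw [hs (n + 1)]
    push_cast at r ⊢
    norm_cast at r ⊢
    push_cast at r s1 ⊢
    rw [hs n]
    linear_combination (-√(n + 1) * √(n.factorial : ℝ)) * r + √(n.factorial : ℝ) * hermiteFun n x * s1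

lemma hasSum_positionFun (x : ℝ) (w : ℂ) :
    HasSum (fun n : ℕ => (hermiteFun n x : ℂ) * (w ^ n / (√(n.factorial : ℝ) : ℂ)))
      (positionFun x w) := by
  have h := Complex.hasSum_taylorSeries_of_entire (differentiable_positionFun x) 0 w
  refine h.congr_fun ?_ 
  intro n
  rw [iteratedDeriv_positionFun_zero]
  have s : (√(n.factorial : ℝ) : ℂ) * (√(n.factorial : ℝ) : ℂ) = n.factorial := by
    rw [← Complex.ofReal_mul, Real.mul_self_sqrt (by positivity)]; simp
  have h1 : (√(n.factorial : ℝ) : ℂ) ≠ 0 := by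
    have : √(n.factorial : ℝ) ≠ 0 := by positivity
    exact_mod_cast this
  rw [← s]
  simp only [smul_eq_mul, sub_zero]
  field_simp

/-- This rotation of the variable is the origin of the phases `I ^ n` in the momentum amplitudes. -/
lemma momentumFun_eq (p : ℝ) (w : ℂ) : momentumFun p w = positionFun p (Complex.I * w) := by
  simp only [momentumFun, positionFun, mul_pow, Complex.I_sq]
  ring_nf

section

variable {ι : Type} [Occupation ι]

/-! ### Generalized vectors with polynomially bounded amplitudes -/

/-- Some power of `(1 + N)⁻¹` has finite trace. -/
class Occupation.TraceClass (ι : Type) [Occupation ι] : Prop where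
  exists_summable : ∃ s : ℕ, Summable fun i : ι => (weight s i)⁻¹

lemma summable_weight_two_inv : Summable fun n : ℕ => (weight 2 n)⁻¹ := by
  have := (summable_nat_add_iff 1).2 (Real.summable_one_div_nat_pow.2 one_lt_two)
  refine this.congr fun n => ?_
  simp [weight, Occupation.total, add_comm]

instance : Occupation.TraceClass ℕ := ⟨2, summable_weight_two_inv⟩

instance : Occupation.TraceClass (ℕ × ℕ) := by
  refine ⟨4, .of_nonneg_of_le (fun i => inv_nonneg.2 (weight_nonneg _ _)) ?_
    (summable_tensor summable_weight_two_inv summable_weight_two_inv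
      (fun _ => inv_nonneg.2 (weight_nonneg _ _)) (fun _ => inv_nonneg.2 (weight_nonneg _ _)))⟩
  intro i
  simp only [weight, Occupation.total, Nat.cast_add]
  rw [← mul_inv]
  have h1 : (0 : ℝ) ≤ i.1 := Nat.cast_nonneg _
  have h2 : (0 : ℝ) ≤ i.2 := Nat.cast_nonneg _
  refine inv_anti₀ (by positivity) ?_
  rw [show (4 : ℕ) = 2 + 2 from rfl, pow_add]
  gcongr <;> linarith

lemma one_le_weight (r : ℕ) (i : ι) : 1 ≤ weight r i :=
  one_le_pow₀ (by have : (0 : ℝ) ≤ (Occupation.total i : ℝ) := Nat.cast_nonneg _; linarith)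

lemma weight_pos (r : ℕ) (i : ι) : 0 < weight r i := one_pos.trans_le (one_le_weight r i)

lemma weight_add (r s : ℕ) (i : ι) : weight (r + s) i = weight r i * weight s i := pow_add _ _ _

/-- Square summability with all weights gives absolute summability with all weights, at the price of
a further weight with summable inverse. -/
lemma summable_weight_mul_norm_amp [Occupation.TraceClass ι] (k : ℕ) (φ : TestSpace ι) :
    Summable fun i => weight k i * ‖φ.amp i‖ := by
  obtain ⟨s, hs⟩ := Occupation.TraceClass.exists_summable (ι := ι)
  refine .of_nonneg_of_le (fun i => mul_nonneg (weight_nonneg _ _) (norm_nonneg _)) ?_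
    ((φ.2 (k + k + s)).add hs)
  intro i
  have hp := weight_pos s i
  rw [weight_add, weight_add]
  change _ ≤ weight k i * weight k i * weight s i * ‖φ.amp i‖ ^ 2 + _
  -- Expanded, this is `2 w_k |φ| ≤ w_k² w_s |φ|² + 1 / w_s`, and both terms on the right are
  -- summable.
  have h : 0 ≤ (weight s i)⁻¹ * (weight k i * weight s i * ‖φ.amp i‖ - 1) ^ 2 := by positivity
  have e : (weight s i)⁻¹ * (weight k i * weight s i * ‖φ.amp i‖ - 1) ^ 2 =
      weight k i * weight k i * weight s i * ‖φ.amp i‖ ^ 2 - 2 * (weight k i * ‖φ.amp i‖) +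
        (weight s i)⁻¹ := by field_simp; ring
  have : 0 ≤ weight k i * ‖φ.amp i‖ := mul_nonneg (weight_nonneg _ _) (norm_nonneg _)
  linarith

lemma summable_norm_amp [Occupation.TraceClass ι] (φ : TestSpace ι) :
    Summable fun i => ‖φ.amp i‖ := by
  simpa [weight] using summable_weight_mul_norm_amp 0 φ

/-- `F = ∑ b_i |i⟩`. -/
def HasAmplitudes (F : GenVec ι) (b : ι → ℂ) : Prop :=
  ∀ φ : TestSpace ι, HasSum (fun i => conj (b i) * φ.amp i) (F φ)

lemma continuous_weighted (r : ℕ) : Continuous (weighted (ι := ι) r) :=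
  continuous_iff_le_induced.2 (iInf_le _ r)

/-- Divided by the square root of a high enough weight, `b` becomes a Hilbert space vector `v`. The
functional is then the inner product of `v` with the weighted test vector, which is continuous for
that one norm. -/
lemma exists_hasAmplitudes [Occupation.TraceClass ι] {b : ι → ℂ} {C : ℝ} {k : ℕ}
    (hb : ∀ i, ‖b i‖ ≤ C * weight k i) : ∃ F : GenVec ι, HasAmplitudes F b := by
  obtain ⟨s, hs⟩ := Occupation.TraceClass.exists_summable (ι := ι)
  have hsq : ∀ i : ι, √(weight (k + k + s) i) ^ 2 = weight (k + k + s) i := fun i =>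
    Real.sq_sqrt (weight_nonneg _ i)
  let v : Hilb ι := ⟨fun i => b i / (√(weight (k + k + s) i) : ℂ), by
    refine memℓp_gen (.of_nonneg_of_le (fun i => by positivity) (fun i => ?_) (hs.mul_left (C ^ 2)))
    have hp := weight_pos s i
    have hq := weight_pos k i
    have h0 := hb i
    simp only [ENNReal.toReal_ofNat, Real.rpow_ofNat, norm_div, Complex.norm_real, div_pow,
      Real.norm_eq_abs, sq_abs, hsq]
    simp only [weight_add]
    rw [div_le_iff₀ (by positivity)]
    calc ‖b i‖ ^ 2 ≤ (C * weight k i) ^ 2 := by gcongr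
      _ = _ := by field_simp⟩
  refine ⟨(innerSL ℂ v).comp ⟨weighted (k + k + s), continuous_weighted _⟩, fun φ => ?_⟩
  refine (lp.hasSum_inner v (weighted (k + k + s) φ)).congr_fun fun i => ?_
  have h0 : (√(weight (k + k + s) i) : ℂ) ≠ 0 := by
    have := weight_pos (k + k + s) i
    exact_mod_cast (Real.sqrt_pos.2 this).ne'
  change conj (b i) * φ.amp i = (√(weight (k + k + s) i) * φ.amp i) *
    conj (b i / (√(weight (k + k + s) i) : ℂ))
  rw [map_div₀, Complex.conj_ofReal]
  field_simp

lemma HasAmplitudes.hasSum_annihilation {F : GenVec ι} {b : ι → ℂ} (h : HasAmplitudes F b) (M : Mode ι)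
    (φ : TestSpace ι) :
    HasSum (fun i => conj (√(M.occ i) * b (M.lower i)) * φ.amp i) (F (annihilation M φ)) := by
  refine (M.raise_injective.hasSum_iff fun i hi => ?_).1 ((h (annihilation M φ)).congr_fun
    fun i => ?_)
  · have : M.occ i = 0 := by
      by_contra h
      exact hi ⟨M.lower i, M.raise_lower i h⟩
    simp [this]
  · simp only [Function.comp, M.occ_raise, M.lower_raise, map_mul, Complex.conj_ofReal]
    change _ = conj (b i) * (√(M.occ i + 1) * φ.amp (M.raise i))
    push_cast; ring

lemma HasAmplitudes.hasSum_creation {F : GenVec ι} {b : ι → ℂ} (h : HasAmplitudes F b) (M : Mode ι)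
    (φ : TestSpace ι) :
    HasSum (fun i => conj (√(M.occ i + 1) * b (M.raise i)) * φ.amp i) (F (creation M φ)) := by
  have h1 := (M.raise_injective.hasSum_iff fun i hi => ?_).2 (h (creation M φ))
  · refine h1.congr_fun fun i => ?_
    simp only [Function.comp, map_mul, Complex.conj_ofReal]
    change _ = conj (b (M.raise i)) * (√(M.occ (M.raise i)) * φ.amp (M.lower (M.raise i)))
    rw [M.lower_raise, M.occ_raise]
    push_cast; ring
  · have : M.occ i = 0 := by
      by_contra h
      exact hi ⟨M.lower i, M.raise_lower i h⟩
    change conj (b i) * (√(M.occ i) * φ.amp (M.lower i)) = 0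
    simp [this]

lemma HasAmplitudes.apply_numberState [DecidableEq ι] {F : GenVec ι} {b : ι → ℂ}
    (h : HasAmplitudes F b) (i : ι) : F (numberState i) = conj (b i) := by
  refine (h _).unique ?_
  have : ∀ j ≠ i, conj (b j) * (numberState i).amp j = 0 := by
    intro j hj
    simp [numberState, TestSpace.amp, hj]
  convert hasSum_single i this using 1
  simp [numberState, TestSpace.amp]

lemma incl_apply (φ : TestSpace ι) (i : ι) : incl φ i = φ.amp i := by
  change (√(weight 0 i) : ℂ) * φ.amp i = _
  simp [weight]

lemma hasSum_inner_incl (φ ψ : TestSpace ι) :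
    HasSum (fun i => conj (φ.amp i) * ψ.amp i) (inner ℂ (incl φ) (incl ψ)) := by
  refine (lp.hasSum_inner (incl φ) (incl ψ)).congr_fun fun i => ?_
  rw [incl_apply, incl_apply, mul_comm]; rfl

lemma incl_injective : Function.Injective (incl (ι := ι)) := fun φ ψ h =>
  Subtype.ext (funext fun i => by
    change φ.amp i = ψ.amp i
    rw [← incl_apply, h, incl_apply])

end

section

variable {ι : Type} [Occupation ι]

/-! ### Systems of Hermite functions -/

section HermiteSystem

open MeasureTheory

/-- Integrability of the sum is included because completeness and smearing assert it of their
integrands. -/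
lemma integrable_of_summable_integral_norm {α κ : Type*} [MeasurableSpace α] {μ : Measure α}
    [Countable κ] {G : κ → α → ℂ} {g : α → ℂ} (hG : ∀ i, Integrable (G i) μ)
    (hs : Summable fun i => ∫ a, ‖G i a‖ ∂μ) (hg : AEStronglyMeasurable g μ)
    (h : ∀ a, HasSum (fun i => G i a) (g a)) :
    Integrable g μ ∧ HasSum (fun i => ∫ a, G i a ∂μ) (∫ a, g a ∂μ) := by
  have e : g = fun a => ∑' i, G i a := funext fun a => (h a).tsum_eq.symm
  refine ⟨⟨hg, ?_⟩, by rw [e]; exact hasSum_integral_of_summable_integral_norm hG hs⟩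
  calc ∫⁻ a, ‖g a‖ₑ ∂μ ≤ ∫⁻ a, ∑' i, ‖G i a‖ₑ ∂μ := by
        refine lintegral_mono fun a => ?_
        simp only [e]
        exact enorm_tsum_le_tsum_enorm
    _ = ∑' i, ∫⁻ a, ‖G i a‖ₑ ∂μ := lintegral_tsum fun i => (hG i).1.enorm
    _ = ∑' i, ENNReal.ofReal (∫ a, ‖G i a‖ ∂μ) :=
        tsum_congr fun i => (ofReal_integral_norm_eq_lintegral_enorm (hG i)).symm
    _ < ⊤ := hs.tsum_ofReal_lt_top

variable {E : Type} [NormedAddCommGroup E] [InnerProductSpace ℝ E] [FiniteDimensional ℝ E]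
  [MeasurableSpace E] [BorelSpace E]

open Classical in
/-- A family of real functions on `E` with the properties of the Hermite functions which are used
in the proof of their completeness: they are uniformly polynomially bounded, orthonormal,
eigenfunctions of an operator on Schwartz space, and their span contains, in the limit,
all products of a Gaussian and a plane wave. -/
structure IsHermiteSystem (h : ι → E → ℝ) : Prop where
  continuous : ∀ i, Continuous (h i)
  bounded : ∃ (C : ℝ) (k : ℕ), ∀ i e, |h i e| ≤ C * weight k i
  integrable_mul : ∀ i j, Integrable fun e => h i e * h j e
  integral_mul : ∀ i j, ∫ e, h i e * h j e = if i = j then 1 else 0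
  exists_oscillator : ∃ L : SchwartzMap E ℂ → SchwartzMap E ℂ, ∀ f i,
    ∫ e, (h i e : ℂ) * L f e = (1 + (Occupation.total i : ℂ)) * ∫ e, (h i e : ℂ) * f e
  exists_hasSum_planeWave : ∀ w : E, ∃ a : ι → ℂ, (Summable fun i => ‖a i‖) ∧ ∀ e,
    HasSum (fun i => a i * h i e) (Complex.exp (-(‖e‖ ^ 2 : ℝ) / 2) *
      Complex.exp ((-2 * Real.pi * inner ℝ e w : ℝ) * Complex.I))

namespace IsHermiteSystem

variable {h : ι → E → ℝ}

lemma integrable_sq (hs : IsHermiteSystem h) (i : ι) : Integrable fun e => h i e ^ 2 := by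
  simpa only [sq] using hs.integrable_mul i i

lemma integral_sq (hs : IsHermiteSystem h) (i : ι) : ∫ e, h i e ^ 2 = 1 := by
  simpa only [sq, if_true] using hs.integral_mul i i

omit [Occupation ι] [NormedAddCommGroup E] [InnerProductSpace ℝ E] [FiniteDimensional ℝ E]
  [MeasurableSpace E] [BorelSpace E] in
lemma norm_mul_le {g : E → ℂ} (i : ι) (e : E) :
    ‖g e * (h i e : ℂ)‖ ≤ ‖g e‖ ^ 2 + h i e ^ 2 := by
  rw [norm_mul, Complex.norm_real, Real.norm_eq_abs, ← sq_abs (h i e)]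
  nlinarith [sq_nonneg (‖g e‖ - |h i e|), sq_nonneg (‖g e‖), sq_nonneg |h i e|]

lemma integrable_mul_of_sq (hs : IsHermiteSystem h) {g : E → ℂ} (hg : Continuous g)
    (hg2 : Integrable fun e => ‖g e‖ ^ 2) (i : ι) : Integrable fun e => g e * (h i e : ℂ) :=
  (hg2.add (hs.integrable_sq i)).mono'
    (hg.mul (Complex.continuous_ofReal.comp (hs.continuous i))).aestronglyMeasurable
    (.of_forall fun e => norm_mul_le i e)

/-- The bound does not depend on `i`, so absolutely summable coefficients suffice for termwise
integration. -/
lemma integral_norm_mul_le (hs : IsHermiteSystem h) {g : E → ℂ} (hg : Continuous g)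
    (hg2 : Integrable fun e => ‖g e‖ ^ 2) (i : ι) :
    ∫ e, ‖g e * (h i e : ℂ)‖ ≤ (∫ e, ‖g e‖ ^ 2) + 1 := by
  rw [← hs.integral_sq i, ← integral_add hg2 (hs.integrable_sq i)]
  exact integral_mono (hs.integrable_mul_of_sq hg hg2 i).norm (hg2.add (hs.integrable_sq i))
    fun e => norm_mul_le i e

/-- Termwise integration of `g · ∑ a_i h_i`. -/
lemma integrable_mul_hasSum [Countable ι] (hs : IsHermiteSystem h) {g : E → ℂ} (hg : Continuous g)
    (hg2 : Integrable fun e => ‖g e‖ ^ 2) {a : ι → ℂ} (ha : Summable fun i => ‖a i‖) {s : E → ℂ}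
    (hsc : Continuous s) (hsum : ∀ e, HasSum (fun i => a i * h i e) (s e)) :
    Integrable (fun e => g e * s e) ∧
      HasSum (fun i => a i * ∫ e, g e * (h i e : ℂ)) (∫ e, g e * s e) := by
  have H := integrable_of_summable_integral_norm (μ := volume)
    (G := fun i e => a i * (g e * (h i e : ℂ))) (g := fun e => g e * s e)
    (fun i => (hs.integrable_mul_of_sq hg hg2 i).const_mul _) ?_
    (hg.mul hsc).aestronglyMeasurable ?_
  · refine ⟨H.1, H.2.congr_fun fun i => ?_⟩
    rw [integral_const_mul]
  · refine .of_nonneg_of_le (fun i => integral_nonneg fun e => norm_nonneg _) (fun i => ?_)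
      (ha.mul_right ((∫ e, ‖g e‖ ^ 2) + 1))
    simp only [norm_mul (a i)]
    rw [integral_const_mul]
    exact mul_le_mul_of_nonneg_left (hs.integral_norm_mul_le hg hg2 i) (norm_nonneg _)
  · intro e
    exact ((hsum e).mul_left (g e)).congr_fun fun i => by ring

/-- A continuous square integrable function orthogonal to all the `h_i` vanishes. -/
lemma eq_zero_of_integral_eq_zero [Countable ι] (hs : IsHermiteSystem h) {g : E → ℂ}
    (hg : Continuous g) (hg2 : Integrable fun e => ‖g e‖ ^ 2)
    (h0 : ∀ i, ∫ e, g e * (h i e : ℂ) = 0) : g = 0 := by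
  set G : E → ℂ := fun e => g e * Complex.exp (-(‖e‖ ^ 2 : ℝ) / 2) with hG_def
  have hGc : Continuous G := by fun_prop
  have key : ∀ w : E, Integrable (fun e => g e * (Complex.exp (-(‖e‖ ^ 2 : ℝ) / 2) *
      Complex.exp ((-2 * Real.pi * inner ℝ e w : ℝ) * Complex.I))) ∧
      ∫ e, g e * (Complex.exp (-(‖e‖ ^ 2 : ℝ) / 2) *
        Complex.exp ((-2 * Real.pi * inner ℝ e w : ℝ) * Complex.I)) = 0 := by
    intro w
    obtain ⟨a, ha, hsum⟩ := hs.exists_hasSum_planeWave w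
    have := hs.integrable_mul_hasSum hg hg2 ha (by fun_prop) hsum
    refine ⟨this.1, this.2.unique ?_⟩
    simp only [h0, mul_zero]
    exact hasSum_zero
  have hGi : Integrable G := by simpa [hG_def] using (key 0).1
  -- The Fourier integral of `G` at `w` is the integral of `g` against a Gaussian plane wave, a sum
  -- of the `h_i`. As the transform is zero it is integrable, so the inversion formula recovers the
  -- continuous function `G` at every point.
  have hF : FourierTransform.fourier G = 0 := by
    ext w
    rw [Real.fourier_eq']
    refine Eq.trans (integral_congr_ae (.of_forall fun e => ?_)) (key w).2
    simp only [hG_def, smul_eq_mul]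
    ring
  have hinv := hGc.fourierInv_fourier_eq hGi (by rw [hF]; exact integrable_zero _ _ _)
  rw [hF] at hinv
  ext e
  have h1 : G e = 0 := by
    rw [← hinv, Real.fourierInv_eq]; simp
  simpa [hG_def] using h1

variable [Occupation.TraceClass ι] {c : ι → ℂ} {F : E → GenVec ι}

lemma summable_norm_conj_mul_amp (hc : ∀ i, ‖c i‖ = 1) (φ : TestSpace ι) :
    Summable fun i => ‖conj (c i) * φ.amp i‖ := by
  simpa [hc] using summable_norm_amp φ

omit [NormedAddCommGroup E] [InnerProductSpace ℝ E] [FiniteDimensional ℝ E] [MeasurableSpace E]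
  [BorelSpace E] [Occupation.TraceClass ι] in
lemma hasSum_apply (hF : ∀ e, HasAmplitudes (F e) fun i => c i * h i e) (φ : TestSpace ι) (e : E) :
    HasSum (fun i => conj (c i) * φ.amp i * h i e) (F e φ) :=
  (hF e φ).congr_fun fun i => by simp only [map_mul, Complex.conj_ofReal]; ring

lemma continuous_apply (hs : IsHermiteSystem h) (hc : ∀ i, ‖c i‖ = 1)
    (hF : ∀ e, HasAmplitudes (F e) fun i => c i * h i e) (φ : TestSpace ι) :
    Continuous fun e => F e φ := by
  obtain ⟨C, k, hb⟩ := hs.bounded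
  simp only [← fun e => (hasSum_apply hF φ e).tsum_eq]
  refine continuous_tsum (u := fun i => C * (weight k i * ‖φ.amp i‖))
    (fun i => continuous_const.mul (Complex.continuous_ofReal.comp (hs.continuous i)))
    ((summable_weight_mul_norm_amp k φ).mul_left C) fun i e => ?_
  rw [norm_mul, norm_mul, RCLike.norm_conj, hc, one_mul, Complex.norm_real, Real.norm_eq_abs,
    mul_comm, ← mul_assoc]
  exact mul_le_mul_of_nonneg_right (hb i e) (norm_nonneg _)

/-- The product `F e φ * F e φ`, without conjugation, is expanded as a double series; its norm is
the function in question. -/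
lemma integrable_norm_sq_apply [Countable ι] (hs : IsHermiteSystem h) (hc : ∀ i, ‖c i‖ = 1)
    (hF : ∀ e, HasAmplitudes (F e) fun i => c i * h i e) (φ : TestSpace ι) :
    Integrable fun e => ‖F e φ‖ ^ 2 := by
  set a : ι → ℂ := fun i => conj (c i) * φ.amp i with ha_def
  have ha : Summable fun i => ‖a i‖ := summable_norm_conj_mul_amp hc φ
  obtain ⟨C, k, hb⟩ := hs.bounded
  have hcont := hs.continuous_apply hc hF φ
  have H := integrable_of_summable_integral_norm (μ := volume) (κ := ι × ι)
    (G := fun i e => a i.1 * h i.1 e * (a i.2 * h i.2 e)) (g := fun e => F e φ * F e φ)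
    (fun i => ?_) ?_ (hcont.mul hcont).aestronglyMeasurable ?_
  · refine H.1.norm.congr (.of_forall fun e => ?_)
    simp [sq]
  · refine ((hs.integrable_mul i.1 i.2).ofReal.const_mul (a i.1 * a i.2)).congr
      (.of_forall fun e => ?_)
    simp only [RCLike.ofReal_eq_complex_ofReal, Complex.ofReal_mul]
    ring
  · refine .of_nonneg_of_le (fun i => integral_nonneg fun e => norm_nonneg _) (fun i => ?_)
      (ha.mul_norm ha |>.mul_right 2)
    have e1 : ∀ e, ‖a i.1 * h i.1 e * (a i.2 * h i.2 e)‖ ≤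
        ‖a i.1 * a i.2‖ * (h i.1 e ^ 2 + h i.2 e ^ 2) := by
      intro e
      rw [mul_mul_mul_comm, norm_mul]
      refine mul_le_mul_of_nonneg_left ?_ (norm_nonneg _)
      rw [← Complex.ofReal_mul, Complex.norm_real, Real.norm_eq_abs, abs_le]
      constructor <;> nlinarith [sq_nonneg (h i.1 e - h i.2 e), sq_nonneg (h i.1 e + h i.2 e),
        sq_nonneg (h i.1 e), sq_nonneg (h i.2 e)]
    calc _ ≤ ∫ e, ‖a i.1 * a i.2‖ * (h i.1 e ^ 2 + h i.2 e ^ 2) :=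
          integral_mono_of_nonneg (.of_forall fun e => norm_nonneg _)
            (((hs.integrable_sq i.1).add (hs.integrable_sq i.2)).const_mul _) (.of_forall e1)
      _ = ‖a i.1 * a i.2‖ * 2 := by
          rw [integral_const_mul, integral_add (hs.integrable_sq _) (hs.integrable_sq _),
            hs.integral_sq, hs.integral_sq, one_add_one_eq_two]
  · intro e
    have hn : Summable fun i => ‖a i * h i e‖ := by
      refine .of_nonneg_of_le (fun i => norm_nonneg _) (fun i => ?_)
        ((summable_weight_mul_norm_amp k φ).mul_left C)
      rw [ha_def, norm_mul, norm_mul, RCLike.norm_conj, hc, one_mul, Complex.norm_real,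
        Real.norm_eq_abs, mul_comm, ← mul_assoc]
      exact mul_le_mul_of_nonneg_right (hb i e) (norm_nonneg _)
    have h1 : HasSum (fun i => a i * h i e) (F e φ) := hasSum_apply hF φ e
    have h2 : Summable fun i : ι × ι => a i.1 * h i.1 e * (a i.2 * h i.2 e) :=
      summable_mul_of_summable_norm (f := fun i => a i * (h i e : ℂ))
        (g := fun i => a i * (h i e : ℂ)) hn hn
    exact HasSum.mul (f := fun i => a i * (h i e : ℂ)) (g := fun i => a i * (h i e : ℂ)) h1 h1 h2

lemma integral_apply_mul [Countable ι] (hs : IsHermiteSystem h) (hc : ∀ i, ‖c i‖ = 1)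
    (hF : ∀ e, HasAmplitudes (F e) fun i => c i * h i e) (φ : TestSpace ι) (j : ι) :
    ∫ e, F e φ * (h j e : ℂ) = conj (c j) * φ.amp j := by
  classical
  have H := hs.integrable_mul_hasSum (g := fun e => (h j e : ℂ))
    (Complex.continuous_ofReal.comp (hs.continuous j))
    (by simpa using hs.integrable_sq j) (summable_norm_conj_mul_amp hc φ)
    (hs.continuous_apply hc hF φ) (hasSum_apply hF φ)
  rw [show ∫ e, F e φ * (h j e : ℂ) = ∫ e, (h j e : ℂ) * F e φ from
    integral_congr_ae (.of_forall fun e => mul_comm _ _)]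
  refine H.2.unique ?_
  have e1 : ∀ i, ∫ e, (h j e : ℂ) * (h i e : ℂ) = if j = i then 1 else 0 := by
    intro i
    have := congrArg (fun x : ℝ => (x : ℂ)) (hs.integral_mul j i)
    simp only [← integral_complex_ofReal, Complex.ofReal_mul] at this
    rw [this]; split_ifs <;> simp
  simp only [e1]
  convert hasSum_single j fun i hi => ?_ using 1
  · simp
  · simp [hi.symm]

lemma isGenComplete [Countable ι] (hs : IsHermiteSystem h) (hc : ∀ i, ‖c i‖ = 1)
    (hF : ∀ e, HasAmplitudes (F e) fun i => c i * h i e) : IsGenComplete F := by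
  have main : ∀ φ ψ : TestSpace ι,
      Integrable (fun e => conj (F e φ) * F e ψ) ∧
        ∫ e, conj (F e φ) * F e ψ = inner ℂ (incl φ) (incl ψ) := by
    intro φ ψ
    have H := hs.integrable_mul_hasSum (g := fun e => conj (F e φ))
      (Complex.continuous_conj.comp (hs.continuous_apply hc hF φ))
      (by simpa using hs.integrable_norm_sq_apply hc hF φ) (summable_norm_conj_mul_amp hc ψ)
      (hs.continuous_apply hc hF ψ) (hasSum_apply hF ψ)
    refine ⟨H.1, H.2.unique ((hasSum_inner_incl φ ψ).congr_fun fun i => ?_)⟩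
    have e1 : ∫ e, conj (F e φ) * (h i e : ℂ) = c i * conj (φ.amp i) := by
      have := congrArg conj (hs.integral_apply_mul hc hF φ i)
      rw [← integral_conj] at this
      simpa using this
    have e2 : conj (c i) * c i = 1 := by
      rw [mul_comm, Complex.mul_conj, Complex.normSq_eq_norm_sq, hc]; simp
    rw [e1]
    linear_combination (ψ.amp i * conj (φ.amp i)) * e2
  refine ⟨fun φ h0 => ?_, main⟩
  have := (main φ φ).2
  simp only [h0, mul_zero, integral_zero] at this
  exact incl_injective (by rw [inner_self_eq_zero.1 this.symm, map_zero])

/-- The smeared vector must have amplitudes `c_i ∫ h_i f`. Their rapid decay comes from applying the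
oscillator to `f` repeatedly. Then `F e ψ` and `f` have the same Hermite coefficients, and as both
are continuous and square integrable, they agree at every point and not just almost everywhere. -/
lemma isDeltaOrthonormal [Countable ι] (hs : IsHermiteSystem h) (hc : ∀ i, ‖c i‖ = 1)
    (hF : ∀ e, HasAmplitudes (F e) fun i => c i * h i e) : IsDeltaOrthonormal F := by
  intro f
  obtain ⟨L, hL⟩ := hs.exists_oscillator
  have hsq : ∀ f : SchwartzMap E ℂ, Integrable fun e => ‖f e‖ ^ 2 := fun f =>
    (memLp_two_iff_integrable_sq_norm f.continuous.aestronglyMeasurable).1 (f.memLp 2)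
  have hcomm : ∀ (f : SchwartzMap E ℂ) (i : ι), ∫ e, (h i e : ℂ) * f e = ∫ e, f e * (h i e : ℂ) :=
    fun f i => integral_congr_ae (.of_forall fun e => mul_comm _ _)
  have hpow : ∀ (k : ℕ) (i : ι), ∫ e, (h i e : ℂ) * L^[k] f e =
      (weight k i : ℂ) * ∫ e, (h i e : ℂ) * f e := by
    intro k i
    induction k with
    | zero => simp [weight]
    | succ k ih =>
      rw [Function.iterate_succ_apply', hL, ih]
      simp only [weight, pow_succ]
      push_cast; ring
  have hbd : ∀ k : ℕ, ∃ M : ℝ, ∀ i, weight k i * ‖∫ e, (h i e : ℂ) * f e‖ ≤ M := by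
    intro k
    refine ⟨(∫ e, ‖L^[k] f e‖ ^ 2) + 1, fun i => ?_⟩
    have h1 := congrArg norm (hpow k i)
    rw [norm_mul, Complex.norm_real, Real.norm_of_nonneg (weight_nonneg k i)] at h1
    rw [← h1, hcomm]
    exact (norm_integral_le_integral_norm _).trans
      (hs.integral_norm_mul_le (L^[k] f).continuous (hsq _) i)
  obtain ⟨s, hsum⟩ := Occupation.TraceClass.exists_summable (ι := ι)
  let ψ : TestSpace ι := ⟨fun i => c i * ∫ e, (h i e : ℂ) * f e, fun r => by
    -- With `N` the norm of the coefficient, `w_r N² w_s ≤ (w_r w_s N)² ≤ M²` since weights are at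
    -- least `1`; the additional `s` provides the summable factor `1 / w_s`.
    obtain ⟨M, hM⟩ := hbd (r + s)
    refine .of_nonneg_of_le (fun i => mul_nonneg (weight_nonneg r i) (sq_nonneg _)) (fun i => ?_)
      (hsum.mul_left (M ^ 2))
    have h1 := hM i
    have hp := weight_pos s i
    have hq := one_le_weight r i
    set N := ‖∫ e, (h i e : ℂ) * f e‖ with hN
    have hN0 : 0 ≤ N := norm_nonneg _
    rw [norm_mul, hc, one_mul, ← hN, ← div_eq_mul_inv, le_div_iff₀ hp]
    rw [weight_add] at h1
    have h2 : 0 ≤ weight r i * weight s i * N := by positivity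
    have h3 : (weight r i * weight s i * N) ^ 2 ≤ M ^ 2 := by gcongr
    refine le_trans ?_ h3
    have h4 : weight r i * N ^ 2 * weight s i * 1 ≤
        weight r i * N ^ 2 * weight s i * (weight r i * weight s i) := by
      have := one_le_weight s i
      gcongr
      nlinarith
    nlinarith⟩
  have hψ : ∀ i, ψ.amp i = c i * ∫ e, (h i e : ℂ) * f e := fun i => rfl
  have hcc : ∀ i, conj (c i) * c i = 1 := fun i => by
    rw [mul_comm, Complex.mul_conj, Complex.normSq_eq_norm_sq, hc]; simp
  refine ⟨ψ, fun φ => ?_, fun e' => ?_⟩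
  · have H := hs.integrable_mul_hasSum (g := fun e => conj (f e))
      (Complex.continuous_conj.comp f.continuous) (by simpa using hsq f)
      (summable_norm_conj_mul_amp hc φ) (hs.continuous_apply hc hF φ) (hasSum_apply hF φ)
    refine ⟨H.1, (hasSum_inner_incl ψ φ).unique (H.2.congr_fun fun i => ?_)⟩
    have e1 : ∫ e, conj (f e) * (h i e : ℂ) = conj (∫ e, (h i e : ℂ) * f e) := by
      rw [← integral_conj]
      simp only [map_mul, Complex.conj_ofReal, mul_comm]
    rw [e1, hψ, map_mul]; ring
  · have hFc := hs.continuous_apply hc hF ψ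
    have h2 : Integrable fun e => ‖F e ψ - f e‖ ^ 2 := by
      refine (memLp_two_iff_integrable_sq_norm (hFc.sub f.continuous).aestronglyMeasurable).1 ?_
      exact ((memLp_two_iff_integrable_sq_norm hFc.aestronglyMeasurable).2
        (hs.integrable_norm_sq_apply hc hF ψ)).sub (f.memLp 2)
    have h0 := hs.eq_zero_of_integral_eq_zero (hFc.sub f.continuous) h2 fun i => by
      have i1 := hs.integrable_mul_of_sq hFc (hs.integrable_norm_sq_apply hc hF ψ) i
      have i2 := hs.integrable_mul_of_sq f.continuous (hsq f) i
      simp only [Pi.sub_apply, sub_mul]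
      rw [integral_sub i1 i2, hs.integral_apply_mul hc hF, hψ, ← mul_assoc, hcc, one_mul, hcomm,
        sub_self]
    exact sub_eq_zero.1 (congrFun h0 e')

end IsHermiteSystem

end HermiteSystem

end

section

/-! ### Hermite functions paired with Schwartz functions: integration by parts and the oscillator
equation -/

section Oscillator

open MeasureTheory LineDeriv

variable {E : Type} [NormedAddCommGroup E] [InnerProductSpace ℝ E] [FiniteDimensional ℝ E]
  [MeasurableSpace E] [BorelSpace E]

lemma integrable_bounded_mul_schwartz {u : E → ℂ} (hu : Continuous u) (hb : ∃ C, ∀ x, ‖u x‖ ≤ C)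
    (f : SchwartzMap E ℂ) : Integrable fun x => u x * f x := by
  obtain ⟨C, hC⟩ := hb
  exact f.integrable.bdd_mul hu.aestronglyMeasurable (.of_forall hC)

lemma integral_mul_lineDerivOp {u u' : E → ℂ} {v : E} {D : E → E →L[ℝ] ℂ}
    (hD : ∀ x, HasFDerivAt u (D x) x) (hv : ∀ x, D x v = u' x) (hu' : Continuous u')
    (hb : ∃ C, ∀ x, ‖u x‖ ≤ C) (hb' : ∃ C, ∀ x, ‖u' x‖ ≤ C) (f : SchwartzMap E ℂ) :
    ∫ x, u x * ∂_{v} f x = -∫ x, u' x * f x := by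
  have hu : Continuous u := continuous_iff_continuousAt.2 fun x => (hD x).continuousAt
  have e : ∀ x, fderiv ℝ u x v = u' x := fun x => by rw [(hD x).fderiv, hv]
  have := integral_mul_fderiv_eq_neg_fderiv_mul_of_integrable (μ := volume) (f := u)
    (g := fun x => f x) (v := v)
    (by simpa only [e] using integrable_bounded_mul_schwartz hu' hb' f)
    (integrable_bounded_mul_schwartz hu hb (∂_{v} f))
    (integrable_bounded_mul_schwartz hu hb f)
    (fun x _ => (hD x).differentiableAt) (fun x _ => f.differentiableAt)
  simp only [e] at this
  exact this

/-- The derivative of the Hermite function. -/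
def hermiteDeriv (n : ℕ) (x : ℝ) : ℝ :=
  (√n * hermiteFun (n - 1) x - √(n + 1) * hermiteFun (n + 1) x) / √2

lemma continuous_hermiteDeriv (n : ℕ) : Continuous (hermiteDeriv n) := by
  have := continuous_hermiteFun
  unfold hermiteDeriv
  fun_prop

lemma hermiteDeriv_eq_lower (n : ℕ) (x : ℝ) :
    hermiteDeriv n x = √2 * √n * hermiteFun (n - 1) x - x * hermiteFun n x :=
  (hasDerivAt_hermiteFun n x).unique (hasDerivAt_hermiteFun_aux n x)

lemma hermiteDeriv_eq_raise (n : ℕ) (x : ℝ) :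
    hermiteDeriv n x = x * hermiteFun n x - √2 * √(n + 1) * hermiteFun (n + 1) x := by
  have s2 : √(2 : ℝ) * √2 = 2 := Real.mul_self_sqrt (by norm_num)
  rw [hermiteDeriv, mul_hermiteFun, div_eq_iff (by positivity)]
  field_simp
  linear_combination (√(n + 1) * hermiteFun (n + 1) x) * s2

/-- The left side is the derivative of `hermiteDeriv n`, so this is the oscillator equation `h'' =
(x² - (2n + 1)) h`. The ladder form also shows that the right side is bounded in `x`, which the
second integration by parts needs. -/
lemma hermiteDeriv_ladder (n : ℕ) (x : ℝ) :
    (√n * hermiteDeriv (n - 1) x - √(n + 1) * hermiteDeriv (n + 1) x) / √2 =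
      (x ^ 2 - (2 * n + 1)) * hermiteFun n x := by
  have s2 : √(2 : ℝ) * √2 = 2 := Real.mul_self_sqrt (by norm_num)
  have h2 : √(2 : ℝ) ≠ 0 := by positivity
  have s1 : √((n : ℝ) + 1) * √(n + 1) = n + 1 := Real.mul_self_sqrt (by positivity)
  have hx := mul_hermiteFun n x
  rw [eq_div_iff h2] at hx
  have hl : √n * hermiteDeriv (n - 1) x =
      √n * x * hermiteFun (n - 1) x - √2 * n * hermiteFun n x := by
    cases n with
    | zero => simp
    | succ n =>
      simp only [hermiteDeriv_eq_raise, Nat.add_sub_cancel]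
      push_cast at s1 ⊢
      have s1 : √((n : ℝ) + 1) * √(n + 1) = n + 1 := Real.mul_self_sqrt (by positivity)
      linear_combination (-√2 * hermiteFun (n + 1) x) * s1
  rw [div_eq_iff h2, hl, hermiteDeriv_eq_lower]
  push_cast [Nat.add_sub_cancel]
  linear_combination (-x) * hx - (√2 * hermiteFun n x) * s1

lemma hasDerivAt_hermiteDeriv (n : ℕ) (x : ℝ) :
    HasDerivAt (hermiteDeriv n) ((x ^ 2 - (2 * n + 1)) * hermiteFun n x) x := by
  rw [← hermiteDeriv_ladder]
  exact (((hasDerivAt_hermiteFun (n - 1) x).const_mul √n).sub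
    ((hasDerivAt_hermiteFun (n + 1) x).const_mul √(n + 1))).div_const √2

lemma exists_abs_ladder_le {f g : ℝ → ℝ} (hf : ∃ C, ∀ x, |f x| ≤ C) (hg : ∃ C, ∀ x, |g x| ≤ C)
    (a b c : ℝ) : ∃ C, ∀ x, |(a * f x - b * g x) / c| ≤ C := by
  obtain ⟨C, hC⟩ := hf
  obtain ⟨D, hD⟩ := hg
  refine ⟨(|a| * C + |b| * D) / |c|, fun x => ?_⟩
  rw [abs_div]
  gcongr
  refine (abs_sub _ _).trans ?_
  rw [abs_mul, abs_mul]
  have := hC x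
  have := hD x
  gcongr

lemma exists_abs_hermiteFun_le (n : ℕ) : ∃ C, ∀ x, |hermiteFun n x| ≤ C :=
  ⟨n + 2, abs_hermiteFun_le n⟩

lemma exists_abs_hermiteDeriv_le (n : ℕ) : ∃ C, ∀ x, |hermiteDeriv n x| ≤ C :=
  exists_abs_ladder_le (exists_abs_hermiteFun_le _) (exists_abs_hermiteFun_le _) _ _ _

lemma exists_abs_hermiteDeriv_deriv_le (n : ℕ) :
    ∃ C, ∀ x : ℝ, |(x ^ 2 - (2 * n + 1)) * hermiteFun n x| ≤ C := by
  simp only [← hermiteDeriv_ladder]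
  exact exists_abs_ladder_le (exists_abs_hermiteDeriv_le _) (exists_abs_hermiteDeriv_le _) _ _ _

lemma continuous_hermiteDeriv_deriv (n : ℕ) :
    Continuous fun x : ℝ => (x ^ 2 - (2 * n + 1)) * hermiteFun n x := by
  have := continuous_hermiteFun n
  fun_prop

/-- The operator of multiplication by `‖x‖²` on Schwartz space. -/
def mulNormSq (f : SchwartzMap E ℂ) : SchwartzMap E ℂ :=
  SchwartzMap.smulLeftCLM ℂ (fun x : E => ((‖x‖ ^ 2 : ℝ) : ℂ)) f

omit [FiniteDimensional ℝ E] [MeasurableSpace E] [BorelSpace E] in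
lemma mulNormSq_apply (f : SchwartzMap E ℂ) (x : E) : mulNormSq f x = (‖x‖ ^ 2 : ℝ) * f x := by
  rw [mulNormSq, SchwartzMap.smulLeftCLM_apply_apply (by fun_prop), smul_eq_mul]

/-! ### One mode -/

lemma integral_hermiteFun_mul_deriv_deriv (n : ℕ) (f : SchwartzMap ℝ ℂ) :
    ∫ x, (hermiteFun n x : ℂ) * ∂_{(1 : ℝ)} (∂_{(1 : ℝ)} f) x =
      ∫ x, (((x ^ 2 - (2 * n + 1)) * hermiteFun n x : ℝ) : ℂ) * f x := by
  have hn : ∀ {g : ℝ → ℝ}, (∃ C, ∀ x, |g x| ≤ C) → ∃ C, ∀ x, ‖(g x : ℂ)‖ ≤ C := by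
    simp
  rw [integral_mul_lineDerivOp (u' := fun x => (hermiteDeriv n x : ℂ))
      (fun x => (hasDerivAt_hermiteFun n x).ofReal_comp.hasFDerivAt) (by simp [hermiteDeriv])
      (Complex.continuous_ofReal.comp (continuous_hermiteDeriv n))
      (hn (exists_abs_hermiteFun_le n)) (hn (exists_abs_hermiteDeriv_le n)),
    integral_mul_lineDerivOp
      (u' := fun x => (((x ^ 2 - (2 * n + 1)) * hermiteFun n x : ℝ) : ℂ))
      (fun x => (hasDerivAt_hermiteDeriv n x).ofReal_comp.hasFDerivAt) (by simp)
      (Complex.continuous_ofReal.comp (continuous_hermiteDeriv_deriv n))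
      (hn (exists_abs_hermiteDeriv_le n)) (hn (exists_abs_hermiteDeriv_deriv_le n)), neg_neg]

/-- For a term `y` one has `y ≤ 2 ^ n * y ^ 2 + 1 / 2 ^ n`, where `2 ^ n * y ^ 2` is a term of the
exponential series at `2 * r ^ 2`. -/
lemma summable_pow_div_sqrt_factorial (r : ℝ) :
    Summable fun n : ℕ => |r| ^ n / √(n.factorial : ℝ) := by
  refine .of_nonneg_of_le (fun n => by positivity) (fun n => ?_)
    ((Real.summable_pow_div_factorial (2 * r ^ 2)).add
      (summable_geometric_of_lt_one (r := (1 / 2 : ℝ)) (by norm_num) (by norm_num)))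
  have hf : √(n.factorial : ℝ) ^ 2 = n.factorial := Real.sq_sqrt (by positivity)
  set y := |r| ^ n / √(n.factorial : ℝ) with hy
  have h1 : (2 * r ^ 2) ^ n / n.factorial = 2 ^ n * y ^ 2 := by
    rw [hy, div_pow, hf, ← sq_abs r]; ring
  rw [h1, one_div, inv_pow]
  have hp : (0 : ℝ) < 2 ^ n := by positivity
  have h2 : 0 ≤ ((2 : ℝ) ^ n)⁻¹ * ((2 ^ n * y - 1) ^ 2 + 2 ^ n * y) := by positivity
  have h3 : ((2 : ℝ) ^ n)⁻¹ * ((2 ^ n * y - 1) ^ 2 + 2 ^ n * y) =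
      2 ^ n * y ^ 2 - y + ((2 : ℝ) ^ n)⁻¹ := by field_simp; ring
  linarith

lemma exists_hasSum_hermiteFun (w : ℝ) : ∃ a : ℕ → ℂ, (Summable fun n => ‖a n‖) ∧ ∀ x : ℝ,
    HasSum (fun n => a n * hermiteFun n x) (Complex.exp (-(x ^ 2 : ℝ) / 2) *
      Complex.exp ((-2 * Real.pi * (x * w) : ℝ) * Complex.I)) := by
  -- At the imaginary argument `I * t` the generating function is a Gaussian times `exp (I √2 t x)`,
  -- and this `t` produces the frequency `-2π x w`. The constant `K` removes `π ^ (-1/4)` and the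
  -- factor `exp (t² / 2)`.
  set t : ℝ := -√2 * Real.pi * w with ht
  set K : ℂ := ((Real.pi ^ (1 / 4 : ℝ) : ℝ) : ℂ) * Complex.exp (-(t : ℂ) ^ 2 / 2) with hK
  refine ⟨fun n => K * ((Complex.I * t) ^ n / (√(n.factorial : ℝ) : ℂ)), ?_, fun x => ?_⟩
  · refine ((summable_pow_div_sqrt_factorial t).mul_left ‖K‖).congr fun n => ?_
    simp [abs_of_nonneg (Real.sqrt_nonneg _)]
  · have h := (hasSum_positionFun x (Complex.I * t)).mul_left K
    have e : K * positionFun x (Complex.I * t) = Complex.exp (-(x ^ 2 : ℝ) / 2) *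
        Complex.exp ((-2 * Real.pi * (x * w) : ℝ) * Complex.I) := by
      have hpi : ((Real.pi ^ (1 / 4 : ℝ) : ℝ) : ℂ) * ((Real.pi ^ (-(1 / 4 : ℝ)) : ℝ) : ℂ) = 1 := by
        rw [← Complex.ofReal_mul, ← Real.rpow_add Real.pi_pos]; simp
      have s2 : (√(2 : ℝ) : ℂ) * √2 = 2 := by
        rw [← Complex.ofReal_mul, Real.mul_self_sqrt (by norm_num)]; simp
      have e1 : Complex.exp (-(t : ℂ) ^ 2 / 2) * Complex.exp (-((Complex.I * t) ^ 2) / 2) = 1 := by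
        rw [← Complex.exp_add, mul_pow, Complex.I_sq]
        convert Complex.exp_zero using 2
        ring
      have e2 : Complex.exp ((√2 : ℂ) * x * (Complex.I * t)) =
          Complex.exp ((-2 * Real.pi * (x * w) : ℝ) * Complex.I) := by
        congr 1
        rw [ht]; push_cast
        linear_combination (-(x : ℂ) * Complex.I * Real.pi * w) * s2
      rw [positionFun, hK, e2]
      push_cast
      linear_combination (Complex.exp (-(x : ℂ) ^ 2 / 2) *
        Complex.exp (-2 * Real.pi * (x * w) * Complex.I)) *
        (Complex.exp (-(t : ℂ) ^ 2 / 2) * Complex.exp (-((Complex.I * t) ^ 2) / 2)) * hpi +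
        (Complex.exp (-(x : ℂ) ^ 2 / 2) *
        Complex.exp (-2 * Real.pi * (x * w) * Complex.I)) * e1
    rw [← e]
    exact h.congr_fun fun n => by ring

lemma isHermiteSystem_hermiteFun : IsHermiteSystem hermiteFun where
  continuous := continuous_hermiteFun
  bounded := by
    refine ⟨2, 1, fun n x => (abs_hermiteFun_le n x).trans ?_⟩
    simp only [weight, Occupation.total, pow_one]
    have : (0 : ℝ) ≤ n := n.cast_nonneg
    linarith
  integrable_mul := integrable_hermiteFun_mul
  integral_mul i j := by rw [integral_hermiteFun_mul]; congr
  exists_oscillator := by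
    -- The operator `(x² - ∂²)/2` has eigenvalue `n + 1/2` on `h_n`; the added `f`, halved, raises
    -- it to `n + 1`.
    refine ⟨fun f => (1 / 2 : ℂ) • (mulNormSq f - ∂_{(1 : ℝ)} (∂_{(1 : ℝ)} f) + f), fun f n => ?_⟩
    have hc : Continuous fun x => (hermiteFun n x : ℂ) :=
      Complex.continuous_ofReal.comp (continuous_hermiteFun n)
    have hb : ∃ C, ∀ x, ‖(hermiteFun n x : ℂ)‖ ≤ C := by
      simpa using exists_abs_hermiteFun_le n
    have I := fun g => integrable_bounded_mul_schwartz hc hb g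
    have I₂ : ∀ f g : SchwartzMap ℝ ℂ, Integrable fun x =>
      (hermiteFun n x : ℂ) * f x - (hermiteFun n x : ℂ) * g x := fun f g => (I f).sub (I g)
    have key : ∫ x, (((x ^ 2 - (2 * n + 1)) * hermiteFun n x : ℝ) : ℂ) * f x =
        (∫ x, (hermiteFun n x : ℂ) * mulNormSq f x) -
          (2 * n + 1) * ∫ x, (hermiteFun n x : ℂ) * f x := by
      rw [← integral_const_mul, ← integral_sub (I _) ((I _).const_mul _)]
      refine integral_congr_ae (.of_forall fun x => ?_)
      simp only [mulNormSq_apply, Real.norm_eq_abs, sq_abs]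
      push_cast; ring
    have e : ∀ x, (hermiteFun n x : ℂ) *
        ((1 / 2 : ℂ) • (mulNormSq f - ∂_{(1 : ℝ)} (∂_{(1 : ℝ)} f) + f)) x =
        (1 / 2 : ℂ) * ((hermiteFun n x : ℂ) * mulNormSq f x -
          (hermiteFun n x : ℂ) * ∂_{(1 : ℝ)} (∂_{(1 : ℝ)} f) x + (hermiteFun n x : ℂ) * f x) := by
      intro x
      simp only [smul_apply, add_apply, sub_apply, smul_eq_mul]
      ring
    simp only [e]
    rw [integral_const_mul, integral_add (I₂ _ _) (I _), integral_sub (I _) (I _),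
      integral_hermiteFun_mul_deriv_deriv, key]
    simp only [Occupation.total]
    ring
  exists_hasSum_planeWave w := by
    simpa [mul_comm w] using exists_hasSum_hermiteFun w

/-! ### Two modes -/

/-- The wave functions of the two-mode number states, in the coordinates `z = x + i p`. -/
def hermiteFun₂ (i : ℕ × ℕ) (z : ℂ) : ℝ := hermiteFun i.1 z.re * hermiteFun i.2 z.im

lemma integrable_re_mul_im {f g : ℝ → ℝ} (hf : Integrable f) (hg : Integrable g) :
    Integrable fun z : ℂ => f z.re * g z.im :=
  (Complex.volume_preserving_equiv_real_prod.integrable_comp_emb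
    Complex.measurableEquivRealProd.measurableEmbedding).2 (hf.mul_prod hg)

lemma integral_re_mul_im (f g : ℝ → ℝ) :
    ∫ z : ℂ, f z.re * g z.im = (∫ x, f x) * ∫ y, g y := by
  rw [← integral_prod_mul]
  exact Complex.volume_preserving_equiv_real_prod.integral_comp
    Complex.measurableEquivRealProd.measurableEmbedding fun q : ℝ × ℝ => f q.1 * g q.2

lemma hasFDerivAt_re_mul_im {f g : ℝ → ℝ} {f' g' : ℝ} {z : ℂ} (hf : HasDerivAt f f' z.re)
    (hg : HasDerivAt g g' z.im) :
    HasFDerivAt (fun z : ℂ => ((f z.re * g z.im : ℝ) : ℂ))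
      (Complex.ofRealCLM.comp (f z.re • g' • Complex.imCLM + g z.im • f' • Complex.reCLM)) z :=
  Complex.ofRealCLM.hasFDerivAt.comp z
    ((hf.comp_hasFDerivAt z Complex.reCLM.hasFDerivAt).mul
      (hg.comp_hasFDerivAt z Complex.imCLM.hasFDerivAt))

lemma exists_norm_re_mul_im_le {f g : ℝ → ℝ} (hf : ∃ C, ∀ x, |f x| ≤ C) (hg : ∃ C, ∀ x, |g x| ≤ C) :
    ∃ C, ∀ z : ℂ, ‖((f z.re * g z.im : ℝ) : ℂ)‖ ≤ C := by
  obtain ⟨C, hC⟩ := hf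
  obtain ⟨D, hD⟩ := hg
  refine ⟨C * D, fun z => ?_⟩
  rw [Complex.norm_real, Real.norm_eq_abs, abs_mul]
  exact mul_le_mul (hC _) (hD _) (abs_nonneg _) ((abs_nonneg _).trans (hC z.re))

lemma continuous_re_mul_im {f g : ℝ → ℝ} (hf : Continuous f) (hg : Continuous g) :
    Continuous fun z : ℂ => ((f z.re * g z.im : ℝ) : ℂ) := by fun_prop

lemma integral_re_mul_im_lineDeriv_one {u u' u'' g : ℝ → ℝ} (h1 : ∀ x, HasDerivAt u (u' x) x)
    (h2 : ∀ x, HasDerivAt u' (u'' x) x) {g' : ℝ → ℝ} (h3 : ∀ x, HasDerivAt g (g' x) x)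
    (hc : Continuous u'') (b0 : ∃ C, ∀ x, |u x| ≤ C) (b1 : ∃ C, ∀ x, |u' x| ≤ C)
    (b2 : ∃ C, ∀ x, |u'' x| ≤ C) (bg : ∃ C, ∀ x, |g x| ≤ C) (f : SchwartzMap ℂ ℂ) :
    ∫ z : ℂ, ((u z.re * g z.im : ℝ) : ℂ) * ∂_{(1 : ℂ)} (∂_{(1 : ℂ)} f) z =
      ∫ z : ℂ, ((u'' z.re * g z.im : ℝ) : ℂ) * f z := by
  have cg : Continuous g := continuous_iff_continuousAt.2 fun x => (h3 x).continuousAt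
  have cu : Continuous u' := continuous_iff_continuousAt.2 fun x => (h2 x).continuousAt
  rw [integral_mul_lineDerivOp (u' := fun z : ℂ => ((u' z.re * g z.im : ℝ) : ℂ))
      (fun z => hasFDerivAt_re_mul_im (h1 z.re) (h3 z.im)) (fun z => by simp [mul_comm])
      (continuous_re_mul_im cu cg) (exists_norm_re_mul_im_le b0 bg) (exists_norm_re_mul_im_le b1 bg),
    integral_mul_lineDerivOp (u' := fun z : ℂ => ((u'' z.re * g z.im : ℝ) : ℂ))
      (fun z => hasFDerivAt_re_mul_im (h2 z.re) (h3 z.im)) (fun z => by simp [mul_comm])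
      (continuous_re_mul_im hc cg) (exists_norm_re_mul_im_le b1 bg) (exists_norm_re_mul_im_le b2 bg),
    neg_neg]

lemma integral_re_mul_im_lineDeriv_I {u u' u'' g : ℝ → ℝ} (h1 : ∀ x, HasDerivAt u (u' x) x)
    (h2 : ∀ x, HasDerivAt u' (u'' x) x) {g' : ℝ → ℝ} (h3 : ∀ x, HasDerivAt g (g' x) x)
    (hc : Continuous u'') (b0 : ∃ C, ∀ x, |u x| ≤ C) (b1 : ∃ C, ∀ x, |u' x| ≤ C)
    (b2 : ∃ C, ∀ x, |u'' x| ≤ C) (bg : ∃ C, ∀ x, |g x| ≤ C) (f : SchwartzMap ℂ ℂ) :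
    ∫ z : ℂ, ((g z.re * u z.im : ℝ) : ℂ) * ∂_{Complex.I} (∂_{Complex.I} f) z =
      ∫ z : ℂ, ((g z.re * u'' z.im : ℝ) : ℂ) * f z := by
  have cg : Continuous g := continuous_iff_continuousAt.2 fun x => (h3 x).continuousAt
  have cu : Continuous u' := continuous_iff_continuousAt.2 fun x => (h2 x).continuousAt
  rw [integral_mul_lineDerivOp (u' := fun z : ℂ => ((g z.re * u' z.im : ℝ) : ℂ))
      (fun z => hasFDerivAt_re_mul_im (h3 z.re) (h1 z.im)) (fun z => by simp)
      (continuous_re_mul_im cg cu) (exists_norm_re_mul_im_le bg b0) (exists_norm_re_mul_im_le bg b1),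
    integral_mul_lineDerivOp (u' := fun z : ℂ => ((g z.re * u'' z.im : ℝ) : ℂ))
      (fun z => hasFDerivAt_re_mul_im (h3 z.re) (h2 z.im)) (fun z => by simp)
      (continuous_re_mul_im cg hc) (exists_norm_re_mul_im_le bg b1) (exists_norm_re_mul_im_le bg b2),
    neg_neg]

lemma abs_hermiteFun₂_le (i : ℕ × ℕ) (z : ℂ) : |hermiteFun₂ i z| ≤ 4 * weight 2 i := by
  have h1 := abs_hermiteFun_le i.1 z.re
  have h2 := abs_hermiteFun_le i.2 z.im
  have n1 : (0 : ℝ) ≤ i.1 := Nat.cast_nonneg _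
  have n2 : (0 : ℝ) ≤ i.2 := Nat.cast_nonneg _
  rw [hermiteFun₂, abs_mul]
  calc _ ≤ ((i.1 : ℝ) + 2) * (i.2 + 2) := mul_le_mul h1 h2 (abs_nonneg _) (by linarith)
    _ ≤ 4 * weight 2 i := by
      simp only [weight, Occupation.total, Nat.cast_add]
      nlinarith

lemma isHermiteSystem_hermiteFun₂ : IsHermiteSystem hermiteFun₂ where
  continuous i := by
    have := continuous_hermiteFun
    unfold hermiteFun₂
    fun_prop
  bounded := ⟨4, 2, abs_hermiteFun₂_le⟩
  integrable_mul i j := by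
    refine (integrable_re_mul_im (integrable_hermiteFun_mul i.1 j.1)
      (integrable_hermiteFun_mul i.2 j.2)).congr (.of_forall fun z => ?_)
    simp only [hermiteFun₂]; ring
  integral_mul i j := by
    have e : ∀ z : ℂ, hermiteFun₂ i z * hermiteFun₂ j z =
        (hermiteFun i.1 z.re * hermiteFun j.1 z.re) *
          (hermiteFun i.2 z.im * hermiteFun j.2 z.im) := by
      intro z; simp only [hermiteFun₂]; ring
    simp only [e]
    rw [integral_re_mul_im (fun x => hermiteFun i.1 x * hermiteFun j.1 x)
      (fun y => hermiteFun i.2 y * hermiteFun j.2 y), integral_hermiteFun_mul,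
      integral_hermiteFun_mul]
    simp only [Prod.ext_iff]
    split_ifs <;> simp_all
  exists_oscillator := by
    -- Here the two zero-point energies `1/2` already add up to the `1` in `1 + N`, so no further
    -- term is needed.
    refine ⟨fun f => (1 / 2 : ℂ) • (mulNormSq f - ∂_{(1 : ℂ)} (∂_{(1 : ℂ)} f) -
      ∂_{Complex.I} (∂_{Complex.I} f)), fun f i => ?_⟩
    have hc : Continuous fun z => (hermiteFun₂ i z : ℂ) :=
      continuous_re_mul_im (continuous_hermiteFun _) (continuous_hermiteFun _)
    have hb : ∃ C, ∀ z, ‖(hermiteFun₂ i z : ℂ)‖ ≤ C :=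
      exists_norm_re_mul_im_le (exists_abs_hermiteFun_le _) (exists_abs_hermiteFun_le _)
    have I := fun g => integrable_bounded_mul_schwartz hc hb g
    have I₂ : ∀ f g : SchwartzMap ℂ ℂ, Integrable fun z =>
      (hermiteFun₂ i z : ℂ) * f z - (hermiteFun₂ i z : ℂ) * g z := fun f g => (I f).sub (I g)
    have k1 := integral_re_mul_im_lineDeriv_one (hasDerivAt_hermiteFun i.1)
      (hasDerivAt_hermiteDeriv i.1) (hasDerivAt_hermiteFun i.2) (continuous_hermiteDeriv_deriv _)
      (exists_abs_hermiteFun_le _) (exists_abs_hermiteDeriv_le _)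
      (exists_abs_hermiteDeriv_deriv_le _) (exists_abs_hermiteFun_le _) f
    have k2 := integral_re_mul_im_lineDeriv_I (hasDerivAt_hermiteFun i.2)
      (hasDerivAt_hermiteDeriv i.2) (hasDerivAt_hermiteFun i.1) (continuous_hermiteDeriv_deriv _)
      (exists_abs_hermiteFun_le _) (exists_abs_hermiteDeriv_le _)
      (exists_abs_hermiteDeriv_deriv_le _) (exists_abs_hermiteFun_le _) f
    have key : (∫ z : ℂ, (((z.re ^ 2 - (2 * i.1 + 1)) * hermiteFun i.1 z.re *
          hermiteFun i.2 z.im : ℝ) : ℂ) * f z) +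
        ∫ z : ℂ, ((hermiteFun i.1 z.re * ((z.im ^ 2 - (2 * i.2 + 1)) *
          hermiteFun i.2 z.im) : ℝ) : ℂ) * f z =
        (∫ z, (hermiteFun₂ i z : ℂ) * mulNormSq f z) -
          (2 * i.1 + 1 + (2 * i.2 + 1)) * ∫ z, (hermiteFun₂ i z : ℂ) * f z := by
      rw [← integral_const_mul, ← integral_sub (I _) ((I _).const_mul _), ← integral_add]
      · refine integral_congr_ae (.of_forall fun z => ?_)
        simp only [mulNormSq_apply, Complex.sq_norm, Complex.normSq_apply, hermiteFun₂]
        push_cast; ring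
      · exact integrable_bounded_mul_schwartz (continuous_re_mul_im
          (continuous_hermiteDeriv_deriv i.1) (continuous_hermiteFun _)) (exists_norm_re_mul_im_le
          (exists_abs_hermiteDeriv_deriv_le _) (exists_abs_hermiteFun_le _)) f
      · exact integrable_bounded_mul_schwartz (continuous_re_mul_im
          (continuous_hermiteFun _) (continuous_hermiteDeriv_deriv i.2)) (exists_norm_re_mul_im_le
          (exists_abs_hermiteFun_le _) (exists_abs_hermiteDeriv_deriv_le _)) f
    have e : ∀ z, (hermiteFun₂ i z : ℂ) * ((1 / 2 : ℂ) • (mulNormSq f -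
        ∂_{(1 : ℂ)} (∂_{(1 : ℂ)} f) - ∂_{Complex.I} (∂_{Complex.I} f))) z =
        (1 / 2 : ℂ) * ((hermiteFun₂ i z : ℂ) * mulNormSq f z -
          (hermiteFun₂ i z : ℂ) * ∂_{(1 : ℂ)} (∂_{(1 : ℂ)} f) z -
          (hermiteFun₂ i z : ℂ) * ∂_{Complex.I} (∂_{Complex.I} f) z) := by
      intro z
      simp only [smul_apply, sub_apply, smul_eq_mul]
      ring
    simp only [e]
    rw [integral_const_mul, integral_sub (I₂ _ _) (I _), integral_sub (I _) (I _)]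
    change 1 / 2 * (_ - (∫ z : ℂ, ((hermiteFun i.1 z.re * hermiteFun i.2 z.im : ℝ) : ℂ) * _) -
      ∫ z : ℂ, ((hermiteFun i.1 z.re * hermiteFun i.2 z.im : ℝ) : ℂ) * _) = _
    rw [k1, k2, sub_sub, key]
    simp only [Occupation.total]
    push_cast
    ring
  exists_hasSum_planeWave w := by
    obtain ⟨a, ha, h1⟩ := exists_hasSum_hermiteFun w.re
    obtain ⟨b, hb, h2⟩ := exists_hasSum_hermiteFun w.im
    refine ⟨fun i => a i.1 * b i.2, ha.mul_norm hb, fun z => ?_⟩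
    have n1 : Summable fun n => ‖a n * hermiteFun n z.re‖ := (h1 z.re).summable.norm
    have n2 : Summable fun n => ‖b n * hermiteFun n z.im‖ := (h2 z.im).summable.norm
    have s12 : Summable fun i : ℕ × ℕ =>
        a i.1 * (hermiteFun i.1 z.re : ℂ) * (b i.2 * (hermiteFun i.2 z.im : ℂ)) :=
      summable_mul_of_summable_norm (f := fun n => a n * (hermiteFun n z.re : ℂ))
        (g := fun n => b n * (hermiteFun n z.im : ℂ)) n1 n2
    have h := HasSum.mul (f := fun n => a n * (hermiteFun n z.re : ℂ))
      (g := fun n => b n * (hermiteFun n z.im : ℂ)) (h1 z.re) (h2 z.im) s12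
    have e : Complex.exp (-(‖z‖ ^ 2 : ℝ) / 2) *
        Complex.exp ((-2 * Real.pi * inner ℝ z w : ℝ) * Complex.I) =
        Complex.exp (-(z.re ^ 2 : ℝ) / 2) *
          Complex.exp ((-2 * Real.pi * (z.re * w.re) : ℝ) * Complex.I) *
        (Complex.exp (-(z.im ^ 2 : ℝ) / 2) *
          Complex.exp ((-2 * Real.pi * (z.im * w.im) : ℝ) * Complex.I)) := by
      rw [← Complex.exp_add, ← Complex.exp_add, ← Complex.exp_add, ← Complex.exp_add]
      congr 1
      simp only [Complex.sq_norm, Complex.normSq_apply, Complex.inner]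
      simp
      ring
    rw [e]
    refine h.congr_fun fun i => ?_
    simp only [hermiteFun₂]
    push_cast; ring

end Oscillator

end

section

variable {ι : Type} [Occupation ι]

/-! ### Existence of exponentials -/

lemma hasSum_sum_antidiagonal {f : ℕ × ℕ → ℂ} {a : ℂ} (h : HasSum f a) :
    HasSum (fun n => ∑ q ∈ Finset.HasAntidiagonal.antidiagonal n, f q) a :=
  (Finset.HasAntidiagonal.sigmaAntidiagonalEquivProd.hasSum_iff.2 h).sigma fun n =>
    Finset.hasSum (Finset.HasAntidiagonal.antidiagonal n) f

lemma sum_antidiagonal_pow_div_factorial (x y : ℂ) (n : ℕ) :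
    ∑ q ∈ Finset.HasAntidiagonal.antidiagonal n, x ^ q.1 / (q.1.factorial : ℂ) * (y ^ q.2 / (q.2.factorial : ℂ)) =
      (x + y) ^ n / (n.factorial : ℂ) := by
  rw [Commute.add_pow' (Commute.all x y), Finset.sum_div]
  refine Finset.sum_congr rfl fun q hq => ?_
  rw [← Finset.HasAntidiagonal.mem_antidiagonal.1 hq, nsmul_eq_mul, Nat.choose_symm_add, Nat.add_choose,
    Nat.cast_div (Nat.factorial_mul_factorial_dvd_factorial_add _ _)
      (by exact_mod_cast Nat.mul_ne_zero (Nat.factorial_ne_zero _) (Nat.factorial_ne_zero _))]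
  have h1 : (q.1.factorial : ℂ) ≠ 0 := by exact_mod_cast Nat.factorial_ne_zero _
  have h2 : (q.2.factorial : ℂ) ≠ 0 := by exact_mod_cast Nat.factorial_ne_zero _
  have h3 : ((q.1 + q.2).factorial : ℂ) ≠ 0 := by exact_mod_cast Nat.factorial_ne_zero _
  push_cast
  field_simp

/-- `H` is a symmetric operator. -/
def IsSymmetricOp (H : TestSpace ι →ₗ[ℂ] TestSpace ι) : Prop :=
  ∀ φ ψ, inner ℂ (incl (H φ)) (incl ψ) = inner ℂ (incl φ) (incl (H ψ))

/-- All number states are analytic vectors of `H`. -/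
def HasAnalyticNumberStates [DecidableEq ι] (H : TestSpace ι →ₗ[ℂ] TestSpace ι) : Prop :=
  ∀ i, Summable fun k : ℕ => ‖incl ((H ^ k) (numberState i))‖ / (k.factorial : ℝ)

lemma IsSymmetricOp.pow_add {H : TestSpace ι →ₗ[ℂ] TestSpace ι} (hH : IsSymmetricOp H) (k l : ℕ)
    (φ ψ : TestSpace ι) : inner ℂ (incl ((H ^ k) φ)) (incl ((H ^ l) ψ)) =
      inner ℂ (incl φ) (incl ((H ^ (k + l)) ψ)) := by
  induction k generalizing l with
  | zero => simp
  | succ k ih =>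
    rw [pow_succ', Module.End.mul_apply, hH, ← Module.End.mul_apply, ← pow_succ', ih,
      show k + (l + 1) = k + 1 + l by omega]

lemma neg_pow_apply (H : TestSpace ι →ₗ[ℂ] TestSpace ι) (k : ℕ) (φ : TestSpace ι) :
    ((-H) ^ k) φ = (-1 : ℂ) ^ k • (H ^ k) φ := by
  induction k with
  | zero => simp
  | succ k ih =>
    rw [pow_succ', Module.End.mul_apply, ih, pow_succ' H, Module.End.mul_apply,
      LinearMap.neg_apply, map_smul, pow_succ, mul_smul, neg_one_smul, smul_neg]

lemma IsSymmetricOp.neg {H : TestSpace ι →ₗ[ℂ] TestSpace ι} (hH : IsSymmetricOp H) :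
    IsSymmetricOp (-H) := fun φ ψ => by
  simp only [LinearMap.neg_apply, map_neg, inner_neg_left, inner_neg_right, hH φ ψ]

variable [DecidableEq ι]

lemma ket_eq (i : ι) : ket i = lp.single 2 i (1 : ℂ) := by
  ext j
  rw [ket, incl_apply]
  by_cases h : j = i
  · subst h; simp [numberState, TestSpace.amp]
  · simp [numberState, TestSpace.amp, h]

lemma inner_ket (i : ι) (ψ : Hilb ι) : inner ℂ (ket i) ψ = ψ i := by
  rw [ket_eq, lp.inner_single_left]; simp

lemma norm_ket (i : ι) : ‖ket i‖ = 1 := by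
  rw [ket_eq, lp.norm_single (by norm_num)]; simp

lemma hilb_ext {S T : Hilb ι →L[ℂ] Hilb ι} (h : ∀ i, S (ket i) = T (ket i)) : S = T := by
  ext1 f
  have hf := lp.hasSum_single (p := 2) (by norm_num) f
  refine (hf.mapL S).unique ((hf.mapL T).congr_fun fun i => ?_)
  have : lp.single 2 i (f i) = f i • ket i := by
    rw [ket_eq, ← lp.single_smul]; simp
  rw [this, map_smul, map_smul, h]

lemma HasAnalyticNumberStates.neg {H : TestSpace ι →ₗ[ℂ] TestSpace ι}
    (hH : HasAnalyticNumberStates H) : HasAnalyticNumberStates (-H) := fun i => by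
  simpa [neg_pow_apply, norm_smul] using hH i

/-- `e^{iH}|i⟩`. -/
def expVec (H : TestSpace ι →ₗ[ℂ] TestSpace ι) (i : ι) : Hilb ι :=
  ∑' k : ℕ, (Complex.I ^ k / (k.factorial : ℂ)) • incl ((H ^ k) (numberState i))

lemma HasAnalyticNumberStates.norm_summable {H : TestSpace ι →ₗ[ℂ] TestSpace ι}
    (hH : HasAnalyticNumberStates H) (i : ι) : Summable fun k : ℕ =>
      ‖(Complex.I ^ k / (k.factorial : ℂ)) • incl ((H ^ k) (numberState i))‖ := by
  refine (hH i).congr fun k => ?_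
  simp [norm_smul]
  ring

lemma HasAnalyticNumberStates.hasSum_expVec {H : TestSpace ι →ₗ[ℂ] TestSpace ι}
    (hH : HasAnalyticNumberStates H) (i : ι) : HasSum (fun k : ℕ =>
      (Complex.I ^ k / (k.factorial : ℂ)) • incl ((H ^ k) (numberState i))) (expVec H i) :=
  (hH.norm_summable i).of_norm.hasSum

/-- By symmetry all powers of `H` move to the right, and the Cauchy product collects the
coefficients `(-I + I) ^ n / n!`, which vanish except for `n = 0`. -/
lemma inner_expVec {H : TestSpace ι →ₗ[ℂ] TestSpace ι} (hs : IsSymmetricOp H)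
    (hH : HasAnalyticNumberStates H) (i j : ι) :
    inner ℂ (expVec H i) (expVec H j) = inner ℂ (ket i) (ket j) := by
  set x : ι → ℕ → Hilb ι := fun i k =>
    (Complex.I ^ k / (k.factorial : ℂ)) • incl ((H ^ k) (numberState i)) with hx
  have hsum : Summable fun q : ℕ × ℕ => inner ℂ (x i q.1) (x j q.2) := by
    refine .of_norm_bounded ((hH.norm_summable i).mul_of_nonneg (hH.norm_summable j)
      (fun _ => norm_nonneg _) (fun _ => norm_nonneg _)) fun q => norm_inner_le_norm _ _
  have h1 : HasSum (fun q : ℕ × ℕ => inner ℂ (x i q.1) (x j q.2))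
      (inner ℂ (expVec H i) (expVec H j)) := by
    have h2 := hsum.hasSum.prod_fiberwise fun k =>
      (hH.hasSum_expVec j).mapL (innerSL ℂ (x i k))
    have h3 : HasSum (fun k => inner ℂ (x i k) (expVec H j))
        (inner ℂ (expVec H i) (expVec H j)) := by
      have := ((hH.hasSum_expVec i).mapL (innerSL ℂ (expVec H j))).star
      simpa only [innerSL_apply_apply, RCLike.star_def, inner_conj_symm] using this
    rw [h3.unique h2]
    exact hsum.hasSum
  refine (hasSum_sum_antidiagonal h1).unique ?_
  have e : ∀ n, ∑ q ∈ Finset.HasAntidiagonal.antidiagonal n, inner ℂ (x i q.1) (x j q.2) =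
      (0 : ℂ) ^ n / (n.factorial : ℂ) *
        inner ℂ (ket i) (incl ((H ^ n) (numberState j))) := by
    intro n
    rw [← neg_add_cancel Complex.I, ← sum_antidiagonal_pow_div_factorial, Finset.sum_mul]
    refine Finset.sum_congr rfl fun q hq => ?_
    rw [hx, inner_smul_left, inner_smul_right, hs.pow_add, Finset.HasAntidiagonal.mem_antidiagonal.1 hq]
    simp [ket]
    ring
  simp only [e]
  convert hasSum_single 0 fun n hn => ?_ using 1
  · simp [ket]
  · simp [hn]

lemma inner_expVec_ket {H : TestSpace ι →ₗ[ℂ] TestSpace ι} (hs : IsSymmetricOp H)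
    (hH : HasAnalyticNumberStates H) (i j : ι) :
    inner ℂ (expVec H i) (ket j) = inner ℂ (ket i) (expVec (-H) j) := by
  have h1 := ((hH.hasSum_expVec i).mapL (innerSL ℂ (ket j))).star
  have h2 := (hH.neg.hasSum_expVec j).mapL (innerSL ℂ (ket i))
  simp only [innerSL_apply_apply, RCLike.star_def, inner_conj_symm] at h1 h2
  refine h1.unique (h2.congr_fun fun k => ?_)
  have h3 := hs.pow_add k 0 (numberState i) (numberState j)
  simp only [add_zero, pow_zero, Module.End.one_apply] at h3
  rw [inner_smul_left, inner_smul_right, neg_pow_apply, map_smul, inner_smul_right]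
  change conj _ * inner ℂ _ (incl _) = _ * (_ * inner ℂ (incl _) _)
  rw [h3, map_div₀, map_pow, Complex.conj_I, neg_pow]
  simp only [map_natCast]
  ring

/-- The linear isometry `e^{iH}`. -/
lemma exists_linearIsometry_expVec {H : TestSpace ι →ₗ[ℂ] TestSpace ι} (hs : IsSymmetricOp H)
    (hH : HasAnalyticNumberStates H) : ∃ T : Hilb ι →ₗᵢ[ℂ] Hilb ι, ∀ i, T (ket i) = expVec H i := by
  have ho : Orthonormal ℂ (expVec H) := by
    rw [orthonormal_iff_ite]
    intro i j
    rw [inner_expVec hs hH, inner_ket, ket_eq]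
    by_cases h : i = j
    · subst h; simp
    · simp [h]
  refine ⟨ho.orthogonalFamily.linearIsometry, fun i => ?_⟩
  rw [ket_eq, ho.orthogonalFamily.linearIsometry_apply_single]
  simp

/-- The isometry `T'` built from `-H` is the adjoint of the isometry `T` built from `H`. Therefore
`⟨T T' e, e⟩ = ‖T' e‖² = 1` for a number state `e`; for unit vectors this forces `T T' e = e`, and
`T` is onto. -/
theorem exists_isExpI {H : TestSpace ι →ₗ[ℂ] TestSpace ι} (hs : IsSymmetricOp H)
    (hH : HasAnalyticNumberStates H) : ∃ U : Hilb ι ≃ₗᵢ[ℂ] Hilb ι, IsExpI H U := by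
  obtain ⟨T, hT⟩ := exists_linearIsometry_expVec hs hH
  obtain ⟨T', hT'⟩ := exists_linearIsometry_expVec hs.neg hH.neg
  have hadj : ∀ i, ContinuousLinearMap.adjoint T.toContinuousLinearMap (ket i) = T' (ket i) := by
    intro i
    ext j
    rw [← inner_ket, ContinuousLinearMap.adjoint_inner_right, ← inner_ket j (T' _), hT']
    change inner ℂ (T (ket j)) (ket i) = _
    rw [hT, inner_expVec_ket hs hH]
  have hid : ∀ i, T (T' (ket i)) = ket i := by
    intro i
    have h1 : inner ℂ (T (T' (ket i))) (ket i) = (1 : ℂ) := by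
      have := ContinuousLinearMap.adjoint_inner_right T.toContinuousLinearMap (T' (ket i)) (ket i)
      rw [hadj, inner_self_eq_norm_sq_to_K, T'.norm_map, norm_ket] at this
      simpa using this.symm
    exact (inner_eq_one_iff_of_norm_eq_one (by simp [norm_ket]) (norm_ket i)).1 h1
  have hcomp : T.toContinuousLinearMap.comp T'.toContinuousLinearMap =
      ContinuousLinearMap.id ℂ (Hilb ι) := hilb_ext hid
  refine ⟨LinearIsometryEquiv.ofSurjective T fun x => ⟨T' x, DFunLike.congr_fun hcomp x⟩,
    fun i => ?_⟩
  change HasSum _ (T (ket i))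
  rw [hT]
  exact hH.hasSum_expVec i

theorem isExpI_expI {H : TestSpace ι →ₗ[ℂ] TestSpace ι} (hs : IsSymmetricOp H)
    (hH : HasAnalyticNumberStates H) : IsExpI H (expI H) := by
  have h := exists_isExpI hs hH
  rw [expI, dif_pos h]
  exact h.choose_spec

end

section

variable {ι : Type} [Occupation ι]

/-! ### Adjointness and number bounds of the ladder operators -/

@[simp] lemma TestSpace.amp_add (φ ψ : TestSpace ι) (i : ι) : (φ + ψ).amp i = φ.amp i + ψ.amp i := rfl

@[simp] lemma TestSpace.amp_sub (φ ψ : TestSpace ι) (i : ι) : (φ - ψ).amp i = φ.amp i - ψ.amp i := rfl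

@[simp] lemma TestSpace.amp_smul (c : ℂ) (φ : TestSpace ι) (i : ι) :
    (c • φ).amp i = c * φ.amp i := rfl

@[simp] lemma TestSpace.amp_zero (i : ι) : (0 : TestSpace ι).amp i = 0 := rfl

lemma TestSpace.ext_amp {φ ψ : TestSpace ι} (h : ∀ i, φ.amp i = ψ.amp i) : φ = ψ :=
  Subtype.ext (funext h)

lemma annihilation_amp (M : Mode ι) (φ : TestSpace ι) (i : ι) :
    (annihilation M φ).amp i = √(M.occ i + 1) * φ.amp (M.raise i) := rfl

lemma creation_amp (M : Mode ι) (φ : TestSpace ι) (i : ι) :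
    (creation M φ).amp i = √(M.occ i) * φ.amp (M.lower i) := rfl

lemma creation_amp_raise (M : Mode ι) (φ : TestSpace ι) (i : ι) :
    (creation M φ).amp (M.raise i) = √(M.occ i + 1) * φ.amp i := by
  rw [creation_amp, M.lower_raise, M.occ_raise]; push_cast; rfl

lemma Mode.occ_eq_zero_of_notMem_range (M : Mode ι) {i : ι} (hi : i ∉ Set.range M.raise) :
    M.occ i = 0 := by
  by_contra h
  exact hi ⟨M.lower i, M.raise_lower i h⟩

lemma creation_amp_of_notMem_range (M : Mode ι) (φ : TestSpace ι) {i : ι}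
    (hi : i ∉ Set.range M.raise) : (creation M φ).amp i = 0 := by
  rw [creation_amp, M.occ_eq_zero_of_notMem_range hi]; simp

lemma inner_annihilation (M : Mode ι) (φ ψ : TestSpace ι) :
    inner ℂ (incl (annihilation M φ)) (incl ψ) = inner ℂ (incl φ) (incl (creation M ψ)) := by
  refine (hasSum_inner_incl _ ψ).unique (((M.raise_injective.hasSum_iff fun i hi => ?_).2
    (hasSum_inner_incl φ (creation M ψ))).congr_fun fun i => ?_)
  · rw [creation_amp_of_notMem_range M ψ hi, mul_zero]
  · simp only [Function.comp, creation_amp_raise, annihilation_amp, map_mul, Complex.conj_ofReal]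
    ring

lemma inner_creation (M : Mode ι) (φ ψ : TestSpace ι) :
    inner ℂ (incl (creation M φ)) (incl ψ) = inner ℂ (incl φ) (incl (annihilation M ψ)) := by
  rw [← inner_conj_symm, ← inner_annihilation, inner_conj_symm]

lemma hasSum_norm_sq (φ : TestSpace ι) :
    HasSum (fun i => ‖φ.amp i‖ ^ 2) (‖incl φ‖ ^ 2) := by
  have := lp.hasSum_norm (p := 2) (by norm_num) (incl φ)
  simpa [incl_apply] using this

/-- `φ` has at most `n` quanta. -/
def SupportedLE (n : ℕ) (φ : TestSpace ι) : Prop := ∀ i, n < Occupation.total i → φ.amp i = 0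

/-- `φ` has exactly `n` quanta. -/
def SupportedEq (n : ℕ) (φ : TestSpace ι) : Prop := ∀ i, Occupation.total i ≠ n → φ.amp i = 0

lemma SupportedLE.mono {m n : ℕ} (h : m ≤ n) {φ : TestSpace ι} (hφ : SupportedLE m φ) :
    SupportedLE n φ := fun i hi => hφ i (h.trans_lt hi)

lemma SupportedEq.supportedLE {n : ℕ} {φ : TestSpace ι} (hφ : SupportedEq n φ) :
    SupportedLE n φ := fun i hi => hφ i hi.ne'

lemma SupportedLE.map_annihilation {n : ℕ} {φ : TestSpace ι} (hφ : SupportedLE n φ) (M : Mode ι) :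
    SupportedLE n (annihilation M φ) := fun i hi => by
  rw [annihilation_amp, hφ _ (by rw [M.total_raise]; omega), mul_zero]

lemma SupportedLE.map_creation {n : ℕ} {φ : TestSpace ι} (hφ : SupportedLE n φ) (M : Mode ι) :
    SupportedLE (n + 1) (creation M φ) := fun i hi => by
  by_cases h : i ∈ Set.range M.raise
  · obtain ⟨j, rfl⟩ := h
    rw [M.total_raise] at hi
    rw [creation_amp_raise, hφ _ (by omega), mul_zero]
  · exact creation_amp_of_notMem_range M φ h

lemma SupportedLE.norm_annihilation_le {n : ℕ} {φ : TestSpace ι} (hφ : SupportedLE n φ)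
    (M : Mode ι) : ‖incl (annihilation M φ)‖ ≤ √(n + 1) * ‖incl φ‖ := by
  refine le_of_sq_le_sq ?_ (by positivity)
  rw [mul_pow, Real.sq_sqrt (by positivity)]
  refine hasSum_le_inj M.raise M.raise_injective (fun i _ => by positivity) (fun i => ?_)
    (hasSum_norm_sq _) ((hasSum_norm_sq φ).mul_left ((n : ℝ) + 1))
  rw [annihilation_amp, norm_mul, mul_pow, Complex.norm_real, Real.norm_eq_abs, sq_abs,
    Real.sq_sqrt (by positivity)]
  by_cases h : n < Occupation.total (M.raise i)
  · simp [hφ _ h]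
  · have h1 := M.occ_le (M.raise i)
    rw [M.occ_raise] at h1
    have h2 : (M.occ i : ℝ) + 1 ≤ n := by exact_mod_cast h1.trans (not_lt.1 h)
    gcongr
    linarith

lemma SupportedLE.norm_creation_le {n : ℕ} {φ : TestSpace ι} (hφ : SupportedLE n φ)
    (M : Mode ι) : ‖incl (creation M φ)‖ ≤ √(n + 1) * ‖incl φ‖ := by
  refine le_of_sq_le_sq ?_ (by positivity)
  rw [mul_pow, Real.sq_sqrt (by positivity)]
  refine hasSum_le (fun i => ?_) ((M.raise_injective.hasSum_iff fun i hi => ?_).2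
    (hasSum_norm_sq (creation M φ))) ((hasSum_norm_sq φ).mul_left ((n : ℝ) + 1))
  · rw [Function.comp, creation_amp_raise, norm_mul, mul_pow, Complex.norm_real, Real.norm_eq_abs,
      sq_abs, Real.sq_sqrt (by positivity)]
    by_cases h : n < Occupation.total i
    · simp [hφ _ h]
    · have h1 := M.occ_le i
      have h2 : (M.occ i : ℝ) ≤ n := by exact_mod_cast h1.trans (not_lt.1 h)
      gcongr
  · rw [creation_amp_of_notMem_range M φ hi]; simp

lemma supportedEq_numberState [DecidableEq ι] (i : ι) :
    SupportedEq (Occupation.total i) (numberState i) := fun j hj => by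
  have : j ≠ i := fun h => hj (by rw [h])
  simp [numberState, TestSpace.amp, this]

/-! ### The displacement operator -/

lemma isSymmetricOp_laserHamiltonian (α : ℂ) : IsSymmetricOp (laserHamiltonian α) := fun φ ψ => by
  simp only [laserHamiltonian, LinearMap.smul_apply, LinearMap.sub_apply, map_smul, map_sub,
    inner_smul_left, inner_smul_right, inner_sub_left, inner_sub_right, inner_annihilation,
    inner_creation, Complex.conj_I, Complex.conj_conj]
  ring

lemma norm_laserHamiltonian_le (α : ℂ) {n : ℕ} {φ : TestSpace ℕ} (hφ : SupportedLE n φ) :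
    ‖incl (laserHamiltonian α φ)‖ ≤ 2 * ‖α‖ * √(n + 1) * ‖incl φ‖ := by
  simp only [laserHamiltonian, LinearMap.smul_apply, LinearMap.sub_apply, map_smul, map_sub,
    norm_smul, Complex.norm_I, one_mul]
  refine (norm_sub_le _ _).trans ?_
  rw [norm_smul, norm_smul, RCLike.norm_conj]
  have h1 := mul_le_mul_of_nonneg_left (hφ.norm_annihilation_le mode) (norm_nonneg α)
  have h2 := mul_le_mul_of_nonneg_left (hφ.norm_creation_le mode) (norm_nonneg α)
  linarith

lemma SupportedLE.map_laserHamiltonian (α : ℂ) {n : ℕ} {φ : TestSpace ℕ} (hφ : SupportedLE n φ) :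
    SupportedLE (n + 1) (laserHamiltonian α φ) := fun i hi => by
  simp only [laserHamiltonian, LinearMap.smul_apply, LinearMap.sub_apply,
    TestSpace.amp_smul, TestSpace.amp_sub]
  rw [(hφ.map_annihilation mode).mono n.le_succ i hi, hφ.map_creation mode i hi]
  simp

/-- Each application adds at most one quantum and, on at most `n + k` quanta, costs a factor
`2‖α‖√(n + k + 1)`; these factors accumulate to the root of a factorial. -/
lemma laserHamiltonian_pow_bound (α : ℂ) (n k : ℕ) :
    SupportedLE (n + k) ((laserHamiltonian α ^ k) (numberState n)) ∧
      ‖incl ((laserHamiltonian α ^ k) (numberState n))‖ ≤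
        (2 * ‖α‖) ^ k * √((n + k).factorial : ℝ) := by
  induction k with
  | zero =>
    refine ⟨(supportedEq_numberState n).supportedLE, ?_⟩
    change ‖ket n‖ ≤ _
    rw [norm_ket, pow_zero, one_mul, Real.one_le_sqrt]
    exact_mod_cast Nat.one_le_iff_ne_zero.2 (Nat.factorial_ne_zero _)
  | succ k ih =>
    rw [pow_succ', Module.End.mul_apply]
    refine ⟨ih.1.map_laserHamiltonian α, (norm_laserHamiltonian_le α ih.1).trans ?_⟩
    rw [← add_assoc, Nat.factorial_succ, Nat.cast_mul, Real.sqrt_mul (by positivity), pow_succ]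
    have := mul_le_mul_of_nonneg_left ih.2
      (show 0 ≤ 2 * ‖α‖ * √((n + k : ℕ) + 1) by positivity)
    refine this.trans (le_of_eq ?_)
    push_cast; ring

lemma hasAnalyticNumberStates_laserHamiltonian (α : ℂ) :
    HasAnalyticNumberStates (laserHamiltonian α) := fun n => by
  refine .of_nonneg_of_le (fun k => by positivity) (fun k => ?_)
    ((summable_pow_div_sqrt_factorial (4 * ‖α‖)).mul_left (2 ^ n * n.factorial : ℝ))
  -- From `(n + k)! ≤ 2 ^ (n + k) n! k!`; the prefactors are squared so that the root can be taken
  -- explicitly, leaving the series of `(4‖α‖) ^ k / √(k!)`.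
  have h1 : ((n + k).factorial : ℝ) ≤ (2 ^ n * n.factorial) ^ 2 * (2 ^ k) ^ 2 * k.factorial := by
    have h2 : (n + k).factorial ≤ 2 ^ (n + k) * n.factorial * k.factorial := by
      rw [← Nat.add_choose_mul_factorial_mul_factorial]
      gcongr
      exact Nat.choose_le_two_pow _ _
    have h3 : 2 ^ (n + k) * n.factorial * k.factorial ≤
        (2 ^ n * n.factorial) ^ 2 * (2 ^ k) ^ 2 * k.factorial := by
      refine Nat.mul_le_mul_right _ ?_
      rw [pow_add]
      have e1 : 1 ≤ 2 ^ n := Nat.one_le_two_pow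
      have e2 : 1 ≤ 2 ^ k := Nat.one_le_two_pow
      have e3 : 1 ≤ n.factorial := Nat.factorial_pos n
      calc 2 ^ n * 2 ^ k * n.factorial = (2 ^ n * n.factorial) * 2 ^ k := by ring
        _ ≤ _ := Nat.mul_le_mul (Nat.le_self_pow two_ne_zero _) (Nat.le_self_pow two_ne_zero _)
    exact_mod_cast h2.trans h3
  have h2 : √((n + k).factorial : ℝ) ≤ 2 ^ n * n.factorial * 2 ^ k * √(k.factorial : ℝ) := by
    rw [Real.sqrt_le_left (by positivity)]
    refine h1.trans (le_of_eq ?_)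
    rw [mul_pow _ (√(k.factorial : ℝ)), Real.sq_sqrt (by positivity)]
    ring
  have hk : (k.factorial : ℝ) = √(k.factorial : ℝ) * √(k.factorial : ℝ) :=
    (Real.mul_self_sqrt (by positivity)).symm
  have hpos : 0 < √(k.factorial : ℝ) := by positivity
  calc _ ≤ (2 * ‖α‖) ^ k * (2 ^ n * n.factorial * 2 ^ k * √(k.factorial : ℝ)) / k.factorial := by
        gcongr
        exact (laserHamiltonian_pow_bound α n k).2.trans (by gcongr)
    _ = _ := by
        rw [abs_of_nonneg (by positivity), show 4 * ‖α‖ = 2 * (2 * ‖α‖) by ring, mul_pow 2 (2 * ‖α‖)]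
        rw [eq_comm, mul_div_assoc', div_eq_div_iff hpos.ne' (by positivity)]
        conv_lhs => rw [hk]
        ring

theorem isExpI_displacement (α : ℂ) : IsExpI (laserHamiltonian α) (displacement α) :=
  isExpI_expI (isSymmetricOp_laserHamiltonian α) (hasAnalyticNumberStates_laserHamiltonian α)

/-! ### The half-beam splitter -/

lemma isSymmetricOp_hbsHamiltonian : IsSymmetricOp hbsHamiltonian := fun φ ψ => by
  simp only [hbsHamiltonian, LinearMap.smul_apply, LinearMap.sub_apply, map_smul, map_sub,
    inner_smul_left, inner_smul_right, inner_sub_left, inner_sub_right, inner_annihilation,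
    inner_creation, Complex.conj_I, LinearMap.comp_apply, map_mul, Complex.conj_ofReal]
  have h : ∀ χ : TestSpace (ℕ × ℕ), creation mode1 (annihilation mode0 χ) =
      annihilation mode0 (creation mode1 χ) := fun χ => TestSpace.ext_amp fun i => by
    simp only [creation_amp, annihilation_amp, mode0, mode1]; ring
  have h' : ∀ χ : TestSpace (ℕ × ℕ), annihilation mode1 (creation mode0 χ) =
      creation mode0 (annihilation mode1 χ) := fun χ => TestSpace.ext_amp fun i => by
    simp only [creation_amp, annihilation_amp, mode0, mode1]; ring
  rw [h, h']
  ring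

lemma SupportedEq.map_hbsHamiltonian {n : ℕ} {φ : TestSpace (ℕ × ℕ)} (hφ : SupportedEq n φ) :
    SupportedEq n (hbsHamiltonian φ) := by
  rintro ⟨i, j⟩ hi
  simp only [hbsHamiltonian, LinearMap.smul_apply, LinearMap.sub_apply,
    LinearMap.comp_apply, TestSpace.amp_smul, TestSpace.amp_sub, creation_amp, annihilation_amp,
    mode0, mode1]
  simp only [Occupation.total] at hi
  have h1 : (√(i : ℝ) : ℂ) * φ.amp (i - 1, j + 1) = 0 := by
    rcases i with _ | i
    · simp
    · rw [hφ _ (by simp only [Occupation.total]; omega), mul_zero]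
  have h2 : (√(j : ℝ) : ℂ) * φ.amp (i + 1, j - 1) = 0 := by
    rcases j with _ | j
    · simp
    · rw [hφ _ (by simp only [Occupation.total]; omega), mul_zero]
  linear_combination (Complex.I * (Real.pi / 4 : ℝ)) * ((√((j : ℝ) + 1) : ℂ) * h1 -
    (√((i : ℝ) + 1) : ℂ) * h2)

lemma SupportedEq.map_hbsHamiltonian_pow {n : ℕ} {φ : TestSpace (ℕ × ℕ)} (hφ : SupportedEq n φ)
    (k : ℕ) : SupportedEq n ((hbsHamiltonian ^ k) φ) := by
  induction k with
  | zero => exact hφ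
  | succ k ih =>
    rw [pow_succ', Module.End.mul_apply]
    exact ih.map_hbsHamiltonian

lemma SupportedLE.norm_hbsHamiltonian_le {n : ℕ} {φ : TestSpace (ℕ × ℕ)} (hφ : SupportedLE n φ) :
    ‖incl (hbsHamiltonian φ)‖ ≤ Real.pi / 4 * (2 * (n + 2)) * ‖incl φ‖ := by
  have h1 := (hφ.map_annihilation mode1).norm_creation_le mode0
  have h2 := hφ.norm_annihilation_le mode1
  have h3 := (hφ.map_creation mode1).norm_annihilation_le mode0
  have h4 := hφ.norm_creation_le mode1
  have s1 : √((n : ℝ) + 1) ≤ √((n : ℝ) + 2) := Real.sqrt_le_sqrt (by linarith)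
  have s2 : √((n : ℝ) + 2) * √(n + 2) = n + 2 := Real.mul_self_sqrt (by positivity)
  have s0 : 0 ≤ √((n : ℝ) + 1) := Real.sqrt_nonneg _
  rw [Nat.cast_add, Nat.cast_one, add_assoc, one_add_one_eq_two] at h3
  have k1 : ‖incl (creation mode0 (annihilation mode1 φ))‖ ≤ (n + 2) * ‖incl φ‖ := by
    calc _ ≤ √((n : ℝ) + 2) * (√((n : ℝ) + 2) * ‖incl φ‖) := h1.trans (by gcongr; exact h2.trans (by gcongr))
      _ = _ := by rw [← mul_assoc, s2]
  have k2 : ‖incl (annihilation mode0 (creation mode1 φ))‖ ≤ (n + 2) * ‖incl φ‖ := by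
    calc _ ≤ √((n : ℝ) + 2) * (√((n : ℝ) + 2) * ‖incl φ‖) := h3.trans (by gcongr; exact h4.trans (by gcongr))
      _ = _ := by rw [← mul_assoc, s2]
  simp only [hbsHamiltonian, LinearMap.smul_apply, LinearMap.sub_apply, map_smul, map_sub,
    norm_smul, norm_mul, Complex.norm_I, one_mul, Complex.norm_real, LinearMap.comp_apply]
  rw [Real.norm_of_nonneg (by positivity), mul_assoc]
  refine mul_le_mul_of_nonneg_left ((norm_sub_le _ _).trans ?_) (by positivity)
  linarith

/-- The number of quanta is conserved, so all powers stay in the sector of `i`, where the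
Hamiltonian is bounded by a constant `C`; the series is dominated by that of `exp C`. -/
lemma hasAnalyticNumberStates_hbsHamiltonian : HasAnalyticNumberStates hbsHamiltonian := fun i => by
  set n := Occupation.total i
  set C := Real.pi / 4 * (2 * ((n : ℝ) + 2)) with hC
  refine .of_nonneg_of_le (fun k => by positivity) (fun k => ?_) (Real.summable_pow_div_factorial C)
  gcongr
  induction k with
  | zero => exact (norm_ket i).le
  | succ k ih =>
    rw [pow_succ', Module.End.mul_apply, pow_succ']
    refine (((supportedEq_numberState i).map_hbsHamiltonian_pow k).supportedLE.norm_hbsHamiltonian_le).trans ?_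
    exact mul_le_mul_of_nonneg_left ih (by positivity)

theorem isExpI_halfBeamSplitter : IsExpI hbsHamiltonian halfBeamSplitter :=
  isExpI_expI isSymmetricOp_hbsHamiltonian hasAnalyticNumberStates_hbsHamiltonian

end

section

variable {ι : Type} [Occupation ι] [DecidableEq ι]

/-! ### Matrix elements of exponentials -/

lemma IsExpI.hasSum_apply {H : TestSpace ι →ₗ[ℂ] TestSpace ι} {U : Hilb ι ≃ₗᵢ[ℂ] Hilb ι}
    (hU : IsExpI H U) (i j : ι) : HasSum (fun k : ℕ =>
      (k.factorial : ℂ)⁻¹ * (((Complex.I • H) ^ k) (numberState j)).amp i) (U (ket j) i) := by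
  have h := (hU j).mapL (innerSL ℂ (ket i))
  simp only [innerSL_apply_apply, inner_smul_right, inner_ket, incl_apply] at h
  refine h.congr_fun fun k => ?_
  rw [smul_pow, LinearMap.smul_apply, TestSpace.amp_smul]
  ring

lemma numberState_amp (i j : ι) : (numberState i).amp j = if j = i then 1 else 0 := by
  simp [numberState, TestSpace.amp, Pi.single_apply]

lemma annihilation_numberState (M : Mode ι) (i : ι) :
    annihilation M (numberState i) = (√(M.occ i) : ℂ) • numberState (M.lower i) := by
  refine TestSpace.ext_amp fun j => ?_
  rw [annihilation_amp, TestSpace.amp_smul, numberState_amp, numberState_amp]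
  by_cases h : M.raise j = i
  · subst h
    rw [if_pos rfl, M.lower_raise, if_pos rfl, M.occ_raise]
    push_cast; rfl
  · rw [if_neg h, mul_zero]
    by_cases h0 : M.occ i = 0
    · simp [h0]
    · rw [if_neg, mul_zero]
      rintro rfl
      exact h (M.raise_lower i h0)

lemma creation_numberState (M : Mode ι) (i : ι) :
    creation M (numberState i) = (√(M.occ i + 1) : ℂ) • numberState (M.raise i) := by
  refine TestSpace.ext_amp fun j => ?_
  rw [TestSpace.amp_smul]
  by_cases h : j ∈ Set.range M.raise
  · obtain ⟨j, rfl⟩ := h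
    rw [creation_amp_raise, numberState_amp, numberState_amp]
    by_cases hj : j = i
    · subst hj; simp
    · rw [if_neg hj, if_neg (fun h => hj (M.raise_injective h)), mul_zero, mul_zero]
  · rw [creation_amp_of_notMem_range M _ h, numberState_amp, if_neg, mul_zero]
    rintro rfl
    exact h ⟨i, rfl⟩

omit [DecidableEq ι] in
lemma annihilation_creation (M : Mode ι) (φ : TestSpace ι) :
    annihilation M (creation M φ) = creation M (annihilation M φ) + φ := by
  refine TestSpace.ext_amp fun i => ?_
  rw [TestSpace.amp_add, annihilation_amp, creation_amp_raise, creation_amp]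
  have s : ∀ n : ℕ, (√((n : ℝ)) : ℂ) * √(n : ℝ) = n := fun n => by
    rw [← Complex.ofReal_mul, Real.mul_self_sqrt (by positivity)]; simp
  have s1 := s (M.occ i + 1)
  push_cast at s1
  rw [← mul_assoc, s1]
  by_cases h0 : M.occ i = 0
  · simp [h0]
  · have h1 : (M.occ (M.lower i) : ℝ) + 1 = M.occ i := by
      have := M.occ_raise (M.lower i)
      rw [M.raise_lower i h0] at this
      exact_mod_cast this.symm
    rw [annihilation_amp, M.raise_lower i h0, h1, ← mul_assoc, s]
    ring

/-! ### Matrix elements of the displacement operator -/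

lemma I_smul_laserHamiltonian (α : ℂ) : Complex.I • laserHamiltonian α =
    α • creation mode - conj α • annihilation mode := by
  rw [laserHamiltonian, smul_smul, Complex.I_mul_I, neg_one_smul, neg_sub]

-- A scalar commutator makes `B` act on powers of `K` as a derivation. At `k = 0` the truncated
-- exponent is harmless because its coefficient is zero.
omit [DecidableEq ι] in
lemma apply_pow_of_commutator {B K : TestSpace ι →ₗ[ℂ] TestSpace ι} {β : ℂ}
    (h : ∀ φ, B (K φ) = K (B φ) + β • φ) (k : ℕ) (φ : TestSpace ι) :
    B ((K ^ k) φ) = (K ^ k) (B φ) + (k * β) • (K ^ (k - 1)) φ := by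
  induction k with
  | zero => simp
  | succ k ih =>
    rw [pow_succ', Module.End.mul_apply, h, ih, map_add, map_smul, Module.End.mul_apply,
      Nat.add_sub_cancel]
    cases k with
    | zero => simp
    | succ k =>
      rw [Nat.add_sub_cancel, ← Module.End.mul_apply K (K ^ k), ← pow_succ', add_assoc, ← add_smul]
      push_cast
      ring_nf

omit [DecidableEq ι] in
/-- The exponential series of `B e^K = e^K (B + β)`, for `[B, K] = β`. -/
lemma hasSum_of_commutator {B K : TestSpace ι →ₗ[ℂ] TestSpace ι} {β : ℂ}
    (h : ∀ φ, B (K φ) = K (B φ) + β • φ) {φ : TestSpace ι} {i : ι} {s t : ℂ}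
    (hs : HasSum (fun k : ℕ => (k.factorial : ℂ)⁻¹ * ((K ^ k) (B φ)).amp i) s)
    (ht : HasSum (fun k : ℕ => (k.factorial : ℂ)⁻¹ * ((K ^ k) φ).amp i) t) :
    HasSum (fun k : ℕ => (k.factorial : ℂ)⁻¹ * (B ((K ^ k) φ)).amp i) (s + β * t) := by
  have h2 : HasSum (fun k : ℕ => (k.factorial : ℂ)⁻¹ * ((k * β) * ((K ^ (k - 1)) φ).amp i))
      (β * t) := by
    rw [← hasSum_nat_add_iff' 1]
    simp only [Finset.range_one, Finset.sum_singleton, Nat.cast_zero, zero_mul, mul_zero, sub_zero,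
      Nat.add_sub_cancel]
    refine (ht.mul_left β).congr_fun fun k => ?_
    rw [Nat.factorial_succ]
    have h1 : (k.factorial : ℂ) ≠ 0 := by exact_mod_cast Nat.factorial_ne_zero _
    have h2 : (k : ℂ) + 1 ≠ 0 := by exact_mod_cast Nat.succ_ne_zero k
    push_cast
    field_simp
  refine (hs.add h2).congr_fun fun k => ?_
  rw [apply_pow_of_commutator h, TestSpace.amp_add, TestSpace.amp_smul]
  ring

lemma annihilation_laser (α : ℂ) (φ : TestSpace ℕ) :
    annihilation mode ((Complex.I • laserHamiltonian α) φ) =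
      (Complex.I • laserHamiltonian α) (annihilation mode φ) + α • φ := by
  simp only [I_smul_laserHamiltonian, LinearMap.sub_apply, LinearMap.smul_apply, map_sub, map_smul,
    annihilation_creation, smul_add]
  abel

lemma creation_laser (α : ℂ) (φ : TestSpace ℕ) :
    creation mode ((Complex.I • laserHamiltonian α) φ) =
      (Complex.I • laserHamiltonian α) (creation mode φ) + conj α • φ := by
  simp only [I_smul_laserHamiltonian, LinearMap.sub_apply, LinearMap.smul_apply, map_sub, map_smul,
    annihilation_creation, smul_add]
  abel

/-- This is the matrix element of `a D = D (a + α)`; the next lemma is that of `a† D = D (a† + conj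
α)`. -/
lemma displacement_annihilation (α : ℂ) (m n : ℕ) :
    (√(m + 1) : ℂ) * displacement α (ket n) (m + 1) =
      √n * displacement α (ket (n - 1)) m + α * displacement α (ket n) m := by
  have hE := isExpI_displacement α
  have h1 := (hE.hasSum_apply (m + 1) n).mul_left (√(m + 1) : ℂ)
  have h2 := hasSum_of_commutator (annihilation_laser α) (φ := numberState n) (i := m)
    (s := √n * displacement α (ket (n - 1)) m) ?_ (hE.hasSum_apply m n)
  · refine h1.unique (h2.congr_fun fun k => ?_)
    rw [annihilation_amp]
    simp only [mode]
    ring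
  · refine ((hE.hasSum_apply m (n - 1)).mul_left (√n : ℂ)).congr_fun fun k => ?_
    rw [annihilation_numberState, map_smul, TestSpace.amp_smul]
    simp only [mode]
    ring

lemma displacement_creation (α : ℂ) (m n : ℕ) :
    (√m : ℂ) * displacement α (ket n) (m - 1) =
      √(n + 1) * displacement α (ket (n + 1)) m + conj α * displacement α (ket n) m := by
  have hE := isExpI_displacement α
  have h1 := (hE.hasSum_apply (m - 1) n).mul_left (√m : ℂ)
  have h2 := hasSum_of_commutator (creation_laser α) (φ := numberState n) (i := m)
    (s := √(n + 1) * displacement α (ket (n + 1)) m) ?_ (hE.hasSum_apply m n)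
  · refine h1.unique (h2.congr_fun fun k => ?_)
    rw [creation_amp]
    simp only [mode]
    ring
  · refine ((hE.hasSum_apply m (n + 1)).mul_left (√(n + 1) : ℂ)).congr_fun fun k => ?_
    rw [creation_numberState, map_smul, TestSpace.amp_smul]
    simp only [mode]
    ring

/-- With `K` the exponent, `⟨0|K = -conj α ⟨0|a`, while `a` kills the vacuum and so `a K ^ (k + 1)
|0⟩ = (k + 1) α K ^ k |0⟩`. -/
lemma laser_pow_vacuum_amp (α : ℂ) (k : ℕ) :
    (((Complex.I • laserHamiltonian α) ^ (k + 2)) (numberState 0)).amp 0 =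
      -(α * conj α) * (k + 1) * (((Complex.I • laserHamiltonian α) ^ k) (numberState 0)).amp 0 := by
  set K := Complex.I • laserHamiltonian α with hK
  have h1 : ∀ φ, (K φ).amp 0 = -conj α * (annihilation mode φ).amp 0 := fun φ => by
    rw [hK, I_smul_laserHamiltonian]
    simp [creation_amp, mode]
  rw [pow_succ', Module.End.mul_apply, h1, apply_pow_of_commutator (annihilation_laser α),
    annihilation_numberState]
  simp [mode]
  ring

/-- By the two-step recursion the odd terms vanish and the even ones form the exponential series of
`-|α|²/2`. -/
lemma displacement_vacuum (α : ℂ) :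
    displacement α (ket 0) 0 = Complex.exp (-(α * conj α) / 2) := by
  have h := (isExpI_displacement α).hasSum_apply 0 0
  set c : ℕ → ℂ := fun k => (((Complex.I • laserHamiltonian α) ^ k) (numberState 0)).amp 0 with hc
  have h1 : ∀ k, c (k + 2) = -(α * conj α) * (k + 1) * c k := laser_pow_vacuum_amp α
  have h0 : c 0 = 1 := by simp [hc, numberState_amp]
  have hodd : ∀ j, c (2 * j + 1) = 0 := by
    intro j
    induction j with
    | zero =>
      simp only [hc, mul_zero, zero_add, pow_one, I_smul_laserHamiltonian, LinearMap.sub_apply,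
        LinearMap.smul_apply, annihilation_numberState, creation_numberState, TestSpace.amp_sub,
        TestSpace.amp_smul, numberState_amp, mode]
      simp
    | succ j ih => rw [show 2 * (j + 1) + 1 = 2 * j + 1 + 2 by ring, h1, ih, mul_zero]
  have heven : ∀ j : ℕ, ((2 * j).factorial : ℂ)⁻¹ * c (2 * j) =
      (-(α * conj α) / 2) ^ j / (j.factorial : ℂ) := by
    intro j
    induction j with
    | zero => simp [h0]
    | succ j ih =>
      have f1 : ((2 * j).factorial : ℂ) ≠ 0 := by exact_mod_cast Nat.factorial_ne_zero _
      have f2 : (j.factorial : ℂ) ≠ 0 := by exact_mod_cast Nat.factorial_ne_zero _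
      have f3 : (2 * (j : ℂ) + 1) ≠ 0 := by exact_mod_cast Nat.succ_ne_zero (2 * j)
      have f4 : ((j : ℂ) + 1) ≠ 0 := by exact_mod_cast Nat.succ_ne_zero j
      rw [inv_mul_eq_iff_eq_mul₀ f1] at ih
      rw [show 2 * (j + 1) = 2 * j + 2 by ring, h1, ih, Nat.factorial_succ, Nat.factorial_succ,
        Nat.factorial_succ, pow_succ]
      push_cast
      rw [show (2 * (j : ℂ) + 1 + 1) = 2 * (j + 1) by ring]
      field_simp
  have hinj : Function.Injective fun j : ℕ => 2 * j := fun a b h => by simpa using h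
  have hz : ∀ k ∉ Set.range (fun j : ℕ => 2 * j), (k.factorial : ℂ)⁻¹ * c k = 0 := by
    intro k hk
    obtain ⟨j, rfl | rfl⟩ := Nat.even_or_odd' k
    · exact absurd ⟨j, rfl⟩ hk
    · rw [hodd, mul_zero]
  refine ((hinj.hasSum_iff hz).2 h).unique ?_
  rw [Complex.exp_eq_exp_ℂ]
  exact (NormedSpace.expSeries_div_hasSum_exp _).congr_fun heven

/-- The recursions of the matrix elements of `D(α)` determine them. -/
lemma eq_of_displacement_recursion {α : ℂ} {D R : ℕ → ℕ → ℂ} (h0 : D 0 0 = R 0 0)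
    (hD : ∀ m : ℕ, (√(m + 1) : ℂ) * D (m + 1) 0 = α * D m 0)
    (hD' : ∀ m n : ℕ, (√m : ℂ) * D (m - 1) n = √(n + 1) * D m (n + 1) + conj α * D m n)
    (hR : ∀ m : ℕ, (√(m + 1) : ℂ) * R (m + 1) 0 = α * R m 0)
    (hR' : ∀ m n : ℕ, (√m : ℂ) * R (m - 1) n = √(n + 1) * R m (n + 1) + conj α * R m n) :
    D = R := by
  have hne : ∀ n : ℕ, (√((n : ℝ) + 1) : ℂ) ≠ 0 := fun n => by
    have : √((n : ℝ) + 1) ≠ 0 := by positivity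
    exact_mod_cast this
  ext m n
  induction n generalizing m with
  | zero =>
    induction m with
    | zero => exact h0
    | succ m ih => exact mul_left_cancel₀ (hne m) (by rw [hD, hR, ih])
  | succ n ih =>
    refine mul_left_cancel₀ (hne n) ?_
    have e1 := hD' m n
    have e2 := hR' m n
    rw [ih, ih] at e1
    linear_combination e2 - e1

lemma hasSum_inner_tensor_ket (ψ : Hilb ℕ) (n : ℕ) (φ : TestSpace (ℕ × ℕ)) :
    HasSum (fun m => conj (ψ m) * φ.amp (m, n)) (inner ℂ (tensor ψ (ket n)) (incl φ)) := by
  have hinj : Function.Injective fun m : ℕ => (m, n) := fun a b h => by simpa using h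
  have h := lp.hasSum_inner (𝕜 := ℂ) (tensor ψ (ket n)) (incl φ)
  have e : ∀ q : ℕ × ℕ, (inner ℂ (tensor ψ (ket n) q : ℂ) (incl φ q : ℂ) : ℂ) =
      conj (ψ q.1 * if q.2 = n then 1 else 0) * φ.amp q := by
    intro q
    rw [incl_apply, ← numberState_amp, ← incl_apply (numberState n), mul_comm]
    rfl
  simp only [e] at h
  rw [← hinj.hasSum_iff] at h
  · simpa [Function.comp_def] using h
  · rintro ⟨m, k⟩ hq
    have : k ≠ n := by
      rintro rfl
      exact hq ⟨m, rfl⟩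
    simp [this]

/-- The double series over both occupation numbers converges unconditionally, so the first index may
be summed first; the inner sums are the pairings with the single terms of the series. -/
lemma isGenSum_tensor_ket {D : ℕ → Hilb ℕ} {F : GenVec (ℕ × ℕ)}
    (hF : HasAmplitudes F fun q => D q.2 q.1) : IsGenSum (fun n => tensor (D n) (ket n)) F := by
  intro φ
  have h := (Equiv.prodComm ℕ ℕ).hasSum_iff.2 (hF φ)
  exact h.prod_fiberwise fun n => hasSum_inner_tensor_ket (D n) n φ

end

section

variable {ι : Type} [Occupation ι] [DecidableEq ι]

/-! ### Number preserving unitary operators -/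

/-- `U` commutes with the number operator. -/
def NumberPreserving (U : Hilb ι ≃ₗᵢ[ℂ] Hilb ι) : Prop :=
  ∀ i j, Occupation.total i ≠ Occupation.total j → U (ket j) i = 0

lemma symm_ket_apply (U : Hilb ι ≃ₗᵢ[ℂ] Hilb ι) (i j : ι) :
    U.symm (ket j) i = conj (U (ket i) j) := by
  rw [← inner_ket, ← inner_ket, inner_conj_symm, ← U.inner_map_map, U.apply_symm_apply]

lemma NumberPreserving.symm {U : Hilb ι ≃ₗᵢ[ℂ] Hilb ι} (hU : NumberPreserving U) :
    NumberPreserving U.symm := fun i j hij => by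
  rw [symm_ket_apply, hU j i hij.symm, map_zero]

lemma hasSum_unitary_apply (U : Hilb ι ≃ₗᵢ[ℂ] Hilb ι) (ψ : Hilb ι) (i : ι) :
    HasSum (fun j => U (ket j) i * ψ j) (U ψ i) := by
  have h := lp.hasSum_inner (𝕜 := ℂ) (U.symm (ket i)) ψ
  rw [← U.inner_map_map, U.apply_symm_apply, inner_ket] at h
  refine h.congr_fun fun j => ?_
  rw [symm_ket_apply]
  change _ = ψ j * conj (conj _)
  rw [Complex.conj_conj, mul_comm]

omit [DecidableEq ι] in
lemma weighted_apply (r : ℕ) (φ : TestSpace ι) (i : ι) :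
    weighted r φ i = (√(weight r i) : ℂ) * φ.amp i := rfl

lemma NumberPreserving.apply_weighted {U : Hilb ι ≃ₗᵢ[ℂ] Hilb ι} (hU : NumberPreserving U) (r : ℕ)
    (φ : TestSpace ι) (i : ι) :
    U (weighted r φ) i = (√(weight r i) : ℂ) * U (incl φ) i := by
  refine (hasSum_unitary_apply U _ i).unique
    (((hasSum_unitary_apply U (incl φ) i).mul_left _).congr_fun fun j => ?_)
  rw [weighted_apply, incl_apply]
  by_cases h : Occupation.total i = Occupation.total j
  · rw [weight, weight, h]; ring
  · rw [hU i j h]; ring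

/-- An operator that conserves the number of quanta commutes with every power of `1 + N`, hence is
isometric for each of the norms defining the topology of the test space. -/
lemma NumberPreserving.exists_clm {U : Hilb ι ≃ₗᵢ[ℂ] Hilb ι} (hU : NumberPreserving U) :
    ∃ V : TestSpace ι →L[ℂ] TestSpace ι, ∀ φ, incl (V φ) = U (incl φ) := by
  let V : TestSpace ι →ₗ[ℂ] TestSpace ι :=
    { toFun φ := ⟨fun i => U (incl φ) i, fun r => by
        have h := (memℓp_gen_iff (by norm_num)).1 (lp.memℓp (U (weighted r φ)))
        refine h.congr fun i => ?_
        rw [hU.apply_weighted]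
        simp only [ENNReal.toReal_ofNat, Real.rpow_ofNat, norm_mul, mul_pow, Complex.norm_real,
          Real.norm_eq_abs, sq_abs, Real.sq_sqrt (weight_nonneg r i)]⟩
      map_add' φ ψ := TestSpace.ext_amp fun i => by
        change U (incl (φ + ψ)) i = U (incl φ) i + U (incl ψ) i
        rw [map_add, map_add]; rfl
      map_smul' c φ := TestSpace.ext_amp fun i => by
        change U (incl (c • φ)) i = c * U (incl φ) i
        rw [map_smul, map_smul]; rfl }
  have hV : ∀ φ i, (V φ).amp i = U (incl φ) i := fun φ i => rfl
  have hw : ∀ r φ, weighted r (V φ) = U (weighted r φ) := fun r φ => by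
    ext i
    rw [hU.apply_weighted, weighted_apply, hV]
  refine ⟨⟨V, continuous_iInf_rng.2 fun r => continuous_induced_rng.2 ?_⟩, fun φ => ?_⟩
  · refine (U.continuous.comp (continuous_weighted r)).congr fun φ => (hw r φ).symm
  · exact hw 0 φ

/-- The expansion converges in every weighted norm at once. Consequently each generalized vector is
given by its values on number states. -/
lemma hasSum_smul_numberState (φ : TestSpace ι) :
    HasSum (fun i => φ.amp i • numberState i) φ := by
  rw [HasSum, nhds_iInf, Filter.tendsto_iInf]
  intro r
  rw [nhds_induced, Filter.tendsto_comap_iff]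
  have h := lp.hasSum_single (p := 2) (by norm_num) (weighted r φ)
  refine Filter.Tendsto.congr (fun s => ?_) h
  rw [Function.comp, map_sum]
  refine Finset.sum_congr rfl fun i _ => ?_
  ext j
  rw [map_smul]
  change _ = φ.amp i * (weighted r (numberState i) j)
  rw [weighted_apply, numberState_amp]
  by_cases h : j = i
  · subst h; simp [weighted_apply, mul_comm]
  · simp [h]

lemma GenVec.hasAmplitudes (F : GenVec ι) :
    HasAmplitudes F fun i => conj (F (numberState i)) := fun φ => by
  refine ((hasSum_smul_numberState φ).mapL F).congr_fun fun i => ?_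
  rw [map_smul, smul_eq_mul, Complex.conj_conj, mul_comm]

/-! ### The half-beam splitter in the Heisenberg picture -/

lemma numberPreserving_halfBeamSplitter : NumberPreserving halfBeamSplitter := fun i j hij => by
  refine (isExpI_halfBeamSplitter.hasSum_apply i j).unique ?_
  convert hasSum_zero with k
  rw [smul_pow, LinearMap.smul_apply, TestSpace.amp_smul,
    (supportedEq_numberState j).map_hbsHamiltonian_pow k i hij]
  simp

omit [DecidableEq ι] in
/-- The exponential series of `e^K B = e^c B e^K`, for `[K, B] = c B`. -/
lemma hasSum_of_eigenoperator {B K : TestSpace ι →ₗ[ℂ] TestSpace ι} {c : ℂ}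
    (h : ∀ φ, K (B φ) = B (K φ) + c • B φ) {φ : TestSpace ι} {i : ι} {s : ℂ}
    (hs : HasSum (fun k : ℕ => (k.factorial : ℂ)⁻¹ * (B ((K ^ k) φ)).amp i) s) :
    HasSum (fun k : ℕ => (k.factorial : ℂ)⁻¹ * ((K ^ k) (B φ)).amp i) (Complex.exp c * s) := by
  have hc : HasSum (fun k : ℕ => c ^ k / (k.factorial : ℂ)) (Complex.exp c) := by
    rw [Complex.exp_eq_exp_ℂ]
    exact NormedSpace.expSeries_div_hasSum_exp c
  have hsum := summable_mul_of_summable_norm hc.summable.norm hs.summable.norm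
  refine (hasSum_sum_antidiagonal (hc.mul hs hsum)).congr_fun fun k => ?_
  -- The commutation rule reads `B (c + K) = K B`. Powers inherit it, and the binomial theorem for
  -- the commuting `c` and `K` gives the terms of a Cauchy product.
  have hsemi : SemiconjBy B (algebraMap ℂ (Module.End ℂ (TestSpace ι)) c + K) K := by
    refine LinearMap.ext fun ψ => ?_
    simp only [Module.End.mul_apply, LinearMap.add_apply, Module.algebraMap_end_apply, map_add,
      map_smul, h]
    abel
  have e := LinearMap.congr_fun (hsemi.pow_right k) φ
  simp only [Module.End.mul_apply] at e
  rw [← e, Commute.add_pow' (Algebra.commutes c K), LinearMap.sum_apply, map_sum]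
  have hamp : ∀ (t : Finset (ℕ × ℕ)) (f : ℕ × ℕ → TestSpace ι),
      (∑ q ∈ t, f q).amp i = ∑ q ∈ t, (f q).amp i := fun t f => by
    classical
    induction t using Finset.induction_on with
    | empty => simp
    | insert a t ha ih => rw [Finset.sum_insert ha, Finset.sum_insert ha, TestSpace.amp_add, ih]
  rw [hamp, Finset.mul_sum]
  refine Finset.sum_congr rfl fun q hq => ?_
  rw [← Finset.HasAntidiagonal.mem_antidiagonal.1 hq, ← map_pow, LinearMap.smul_apply,
    Module.End.mul_apply, Module.algebraMap_end_apply, ← Nat.cast_smul_eq_nsmul ℂ, map_smul,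
    map_smul, TestSpace.amp_smul, TestSpace.amp_smul, Nat.choose_symm_add, Nat.add_choose,
    Nat.cast_div (Nat.factorial_mul_factorial_dvd_factorial_add _ _)
      (by exact_mod_cast Nat.mul_ne_zero (Nat.factorial_ne_zero _) (Nat.factorial_ne_zero _))]
  have h1 : (q.1.factorial : ℂ) ≠ 0 := by exact_mod_cast Nat.factorial_ne_zero _
  have h2 : (q.2.factorial : ℂ) ≠ 0 := by exact_mod_cast Nat.factorial_ne_zero _
  have h3 : ((q.1 + q.2).factorial : ℂ) ≠ 0 := by exact_mod_cast Nat.factorial_ne_zero _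
  push_cast
  field_simp

lemma I_smul_hbsHamiltonian : Complex.I • hbsHamiltonian = ((Real.pi / 4 : ℝ) : ℂ) •
    (annihilation mode0 ∘ₗ creation mode1 - creation mode0 ∘ₗ annihilation mode1) := by
  rw [hbsHamiltonian, smul_smul, ← mul_assoc, Complex.I_mul_I, ← neg_sub (annihilation mode0 ∘ₗ _),
    smul_neg, neg_one_mul, neg_smul, neg_neg]

lemma mode_commute :
    (∀ φ, annihilation mode0 (annihilation mode1 φ) = annihilation mode1 (annihilation mode0 φ)) ∧
    (∀ φ, annihilation mode0 (creation mode1 φ) = creation mode1 (annihilation mode0 φ)) ∧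
    (∀ φ, creation mode0 (annihilation mode1 φ) = annihilation mode1 (creation mode0 φ)) ∧
    (∀ φ, creation mode0 (creation mode1 φ) = creation mode1 (creation mode0 φ)) := by
  refine ⟨fun φ => ?_, fun φ => ?_, fun φ => ?_, fun φ => ?_⟩ <;>
    refine TestSpace.ext_amp fun i => ?_ <;>
    simp only [creation_amp, annihilation_amp, mode0, mode1] <;> ring

lemma hbs_annihilation0 (φ : TestSpace (ℕ × ℕ)) : (Complex.I • hbsHamiltonian) (annihilation mode0 φ) =
    annihilation mode0 ((Complex.I • hbsHamiltonian) φ) +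
      ((Real.pi / 4 : ℝ) : ℂ) • annihilation mode1 φ := by
  obtain ⟨h1, h2, h3, h4⟩ := mode_commute
  simp only [I_smul_hbsHamiltonian, LinearMap.smul_apply, LinearMap.sub_apply, LinearMap.comp_apply,
    map_smul, map_sub, annihilation_creation, h2, ← h1]
  module

lemma hbs_annihilation1 (φ : TestSpace (ℕ × ℕ)) : (Complex.I • hbsHamiltonian) (annihilation mode1 φ) =
    annihilation mode1 ((Complex.I • hbsHamiltonian) φ) -
      ((Real.pi / 4 : ℝ) : ℂ) • annihilation mode0 φ := by
  obtain ⟨h1, h2, h3, h4⟩ := mode_commute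
  simp only [I_smul_hbsHamiltonian, LinearMap.smul_apply, LinearMap.sub_apply, LinearMap.comp_apply,
    map_smul, map_sub, annihilation_creation, h2, h1, h3]
  module

lemma hbs_creation0 (φ : TestSpace (ℕ × ℕ)) : (Complex.I • hbsHamiltonian) (creation mode0 φ) =
    creation mode0 ((Complex.I • hbsHamiltonian) φ) +
      ((Real.pi / 4 : ℝ) : ℂ) • creation mode1 φ := by
  obtain ⟨h1, h2, h3, h4⟩ := mode_commute
  simp only [I_smul_hbsHamiltonian, LinearMap.smul_apply, LinearMap.sub_apply, LinearMap.comp_apply,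
    map_smul, map_sub, annihilation_creation, h2, h3, h4, map_add]
  module

lemma hbs_creation1 (φ : TestSpace (ℕ × ℕ)) : (Complex.I • hbsHamiltonian) (creation mode1 φ) =
    creation mode1 ((Complex.I • hbsHamiltonian) φ) -
      ((Real.pi / 4 : ℝ) : ℂ) • creation mode0 φ := by
  obtain ⟨h1, h2, h3, h4⟩ := mode_commute
  simp only [I_smul_hbsHamiltonian, LinearMap.smul_apply, LinearMap.sub_apply, LinearMap.comp_apply,
    map_smul, map_sub, annihilation_creation, h2, ← h4, map_add]
  module

/-- The half-beam splitter acting on the test space. -/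
def IsBeamSplitterOnTest (V : TestSpace (ℕ × ℕ) →L[ℂ] TestSpace (ℕ × ℕ)) : Prop :=
  ∀ φ, incl (V φ) = halfBeamSplitter (incl φ)

variable {V : TestSpace (ℕ × ℕ) →L[ℂ] TestSpace (ℕ × ℕ)}

lemma IsBeamSplitterOnTest.hasSum_amp (hV : IsBeamSplitterOnTest V) (i j : ℕ × ℕ) :
    HasSum (fun k : ℕ => (k.factorial : ℂ)⁻¹ *
      (((Complex.I • hbsHamiltonian) ^ k) (numberState j)).amp i) ((V (numberState j)).amp i) := by
  rw [← incl_apply, hV]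
  exact isExpI_halfBeamSplitter.hasSum_apply i j

lemma IsBeamSplitterOnTest.hasSum_annihilation (hV : IsBeamSplitterOnTest V) (M : Mode (ℕ × ℕ))
    (i j : ℕ × ℕ) : HasSum (fun k : ℕ => (k.factorial : ℂ)⁻¹ *
      (((Complex.I • hbsHamiltonian) ^ k) (annihilation M (numberState j))).amp i)
      ((V (annihilation M (numberState j))).amp i) ∧
    HasSum (fun k : ℕ => (k.factorial : ℂ)⁻¹ *
      (annihilation M (((Complex.I • hbsHamiltonian) ^ k) (numberState j))).amp i)
      ((annihilation M (V (numberState j))).amp i) := by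
  constructor
  · simp only [annihilation_numberState, map_smul, TestSpace.amp_smul, mul_left_comm _ (√_ : ℂ)]
    exact (hV.hasSum_amp i _).mul_left _
  · simp only [annihilation_amp, mul_left_comm _ (√_ : ℂ)]
    exact (hV.hasSum_amp _ j).mul_left _

lemma IsBeamSplitterOnTest.hasSum_creation (hV : IsBeamSplitterOnTest V) (M : Mode (ℕ × ℕ))
    (i j : ℕ × ℕ) : HasSum (fun k : ℕ => (k.factorial : ℂ)⁻¹ *
      (((Complex.I • hbsHamiltonian) ^ k) (creation M (numberState j))).amp i)
      ((V (creation M (numberState j))).amp i) ∧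
    HasSum (fun k : ℕ => (k.factorial : ℂ)⁻¹ *
      (creation M (((Complex.I • hbsHamiltonian) ^ k) (numberState j))).amp i)
      ((creation M (V (numberState j))).amp i) := by
  constructor
  · simp only [creation_numberState, map_smul, TestSpace.amp_smul, mul_left_comm _ (√_ : ℂ)]
    exact (hV.hasSum_amp i _).mul_left _
  · simp only [creation_amp, mul_left_comm _ (√_ : ℂ)]
    exact (hV.hasSum_amp _ j).mul_left _

lemma exp_I_mul_pi_div_four (s : ℂ) (hs : s = Complex.I ∨ s = -Complex.I) :
    Complex.exp (-s * ((Real.pi / 4 : ℝ) : ℂ)) = (√2 : ℂ)⁻¹ * (1 - s) := by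
  have h2 : (√2 : ℂ) * √2 = 2 := by
    rw [← Complex.ofReal_mul, Real.mul_self_sqrt (by norm_num)]; simp
  have h0 : (√2 : ℂ) ≠ 0 := by
    have : √(2 : ℝ) ≠ 0 := by positivity
    exact_mod_cast this
  have key : (√2 / 2 : ℂ) = (√2 : ℂ)⁻¹ := by
    field_simp; rw [sq, h2]
  obtain rfl | rfl := hs
  · rw [show -Complex.I * ((Real.pi / 4 : ℝ) : ℂ) = ((-(Real.pi / 4) : ℝ) : ℂ) * Complex.I by
      push_cast; ring, Complex.exp_mul_I, ← Complex.ofReal_cos, ← Complex.ofReal_sin, Real.cos_neg,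
      Real.sin_neg, Real.cos_pi_div_four, Real.sin_pi_div_four, ← key]
    push_cast; ring
  · rw [show - -Complex.I * ((Real.pi / 4 : ℝ) : ℂ) = ((Real.pi / 4 : ℝ) : ℂ) * Complex.I by
      push_cast; ring, Complex.exp_mul_I, ← Complex.ofReal_cos, ← Complex.ofReal_sin,
      Real.cos_pi_div_four, Real.sin_pi_div_four, ← key]
    push_cast; ring

/-- A pair of operators rotated into each other by the Hamiltonian is rotated by the unitary
operator. -/
lemma rotate_of_commutator {B₀ B₁ : TestSpace (ℕ × ℕ) →ₗ[ℂ] TestSpace (ℕ × ℕ)}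
    (h₀ : ∀ φ, (Complex.I • hbsHamiltonian) (B₀ φ) =
      B₀ ((Complex.I • hbsHamiltonian) φ) + ((Real.pi / 4 : ℝ) : ℂ) • B₁ φ)
    (h₁ : ∀ φ, (Complex.I • hbsHamiltonian) (B₁ φ) =
      B₁ ((Complex.I • hbsHamiltonian) φ) - ((Real.pi / 4 : ℝ) : ℂ) • B₀ φ)
    {φ ψ : TestSpace (ℕ × ℕ)}
    (s₀ : ∀ i, HasSum (fun k : ℕ => (k.factorial : ℂ)⁻¹ *
        (((Complex.I • hbsHamiltonian) ^ k) (B₀ φ)).amp i) ((V (B₀ φ)).amp i) ∧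
      HasSum (fun k : ℕ => (k.factorial : ℂ)⁻¹ *
        (B₀ (((Complex.I • hbsHamiltonian) ^ k) φ)).amp i) ((B₀ ψ).amp i))
    (s₁ : ∀ i, HasSum (fun k : ℕ => (k.factorial : ℂ)⁻¹ *
        (((Complex.I • hbsHamiltonian) ^ k) (B₁ φ)).amp i) ((V (B₁ φ)).amp i) ∧
      HasSum (fun k : ℕ => (k.factorial : ℂ)⁻¹ *
        (B₁ (((Complex.I • hbsHamiltonian) ^ k) φ)).amp i) ((B₁ ψ).amp i)) :
    V (B₀ φ) = (√2 : ℂ)⁻¹ • (B₀ ψ + B₁ ψ) ∧ V (B₁ φ) = (√2 : ℂ)⁻¹ • (B₁ ψ - B₀ ψ) := by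
  -- For `s = ±I` the combination `B₀ + s B₁` is an eigenoperator of the commutator, with eigenvalue
  -- `-s π/4`. The two signs together separate `V (B₀ φ)` from `V (B₁ φ)`.
  have key : ∀ s : ℂ, (s = Complex.I ∨ s = -Complex.I) → ∀ i, (V (B₀ φ)).amp i +
      s * (V (B₁ φ)).amp i =
      (√2 : ℂ)⁻¹ * (1 - s) * ((B₀ ψ).amp i + s * (B₁ ψ).amp i) := by
    intro s hs i
    have hss : s * s = -1 := by obtain rfl | rfl := hs <;> simp
    have hB : ∀ χ, (Complex.I • hbsHamiltonian) ((B₀ + s • B₁) χ) =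
        (B₀ + s • B₁) ((Complex.I • hbsHamiltonian) χ) +
          (-s * ((Real.pi / 4 : ℝ) : ℂ)) • (B₀ + s • B₁) χ := by
      intro χ
      have hadd : ∀ χ, (B₀ + s • B₁) χ = B₀ χ + s • B₁ χ := fun χ => rfl
      rw [hadd, hadd, map_add (Complex.I • hbsHamiltonian), map_smul (Complex.I • hbsHamiltonian),
        h₀, h₁]
      have e : (-s * ((Real.pi / 4 : ℝ) : ℂ)) • (B₀ χ + s • B₁ χ) =
          (-s * ((Real.pi / 4 : ℝ) : ℂ)) • B₀ χ + ((Real.pi / 4 : ℝ) : ℂ) • B₁ χ := by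
        rw [smul_add, smul_smul]
        congr 2
        linear_combination (-((Real.pi / 4 : ℝ) : ℂ)) * hss
      rw [e]
      module
    have hsum : HasSum (fun k : ℕ => (k.factorial : ℂ)⁻¹ *
        ((B₀ + s • B₁) (((Complex.I • hbsHamiltonian) ^ k) φ)).amp i)
        ((B₀ ψ).amp i + s * (B₁ ψ).amp i) := by
      refine ((s₀ i).2.add ((s₁ i).2.mul_left s)).congr_fun fun k => ?_
      rw [LinearMap.add_apply, LinearMap.smul_apply, TestSpace.amp_add, TestSpace.amp_smul]
      ring
    have h := hasSum_of_eigenoperator hB hsum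
    rw [exp_I_mul_pi_div_four s hs] at h
    refine HasSum.unique (((s₀ i).1.add ((s₁ i).1.mul_left s)).congr_fun fun k => ?_) h
    rw [LinearMap.add_apply, LinearMap.smul_apply, map_add, map_smul, TestSpace.amp_add,
      TestSpace.amp_smul]
    ring
  have hI := Complex.I_mul_I
  constructor
  · refine TestSpace.ext_amp fun i => ?_
    have k1 := key _ (.inl rfl) i
    have k2 := key _ (.inr rfl) i
    simp only [TestSpace.amp_smul, TestSpace.amp_add]
    linear_combination k1 / 2 + k2 / 2 - (√2 : ℂ)⁻¹ * (B₁ ψ).amp i * hI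
  · refine TestSpace.ext_amp fun i => ?_
    have k1 := key _ (.inl rfl) i
    have k2 := key _ (.inr rfl) i
    simp only [TestSpace.amp_smul, TestSpace.amp_sub]
    linear_combination (-Complex.I / 2) * k1 + Complex.I / 2 * k2 +
      ((V (B₁ φ)).amp i + (√2 : ℂ)⁻¹ * ((B₀ ψ).amp i - (B₁ ψ).amp i)) * hI

lemma IsBeamSplitterOnTest.map_annihilation (hV : IsBeamSplitterOnTest V) (j : ℕ × ℕ) :
    V (annihilation mode0 (numberState j)) = (√2 : ℂ)⁻¹ •
      (annihilation mode0 (V (numberState j)) + annihilation mode1 (V (numberState j))) ∧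
    V (annihilation mode1 (numberState j)) = (√2 : ℂ)⁻¹ •
      (annihilation mode1 (V (numberState j)) - annihilation mode0 (V (numberState j))) :=
  rotate_of_commutator hbs_annihilation0 hbs_annihilation1
    (fun i => hV.hasSum_annihilation mode0 i j) (fun i => hV.hasSum_annihilation mode1 i j)

lemma IsBeamSplitterOnTest.map_creation (hV : IsBeamSplitterOnTest V) (j : ℕ × ℕ) :
    V (creation mode0 (numberState j)) = (√2 : ℂ)⁻¹ •
      (creation mode0 (V (numberState j)) + creation mode1 (V (numberState j))) ∧
    V (creation mode1 (numberState j)) = (√2 : ℂ)⁻¹ •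
      (creation mode1 (V (numberState j)) - creation mode0 (V (numberState j))) :=
  rotate_of_commutator hbs_creation0 hbs_creation1
    (fun i => hV.hasSum_creation mode0 i j) (fun i => hV.hasSum_creation mode1 i j)

lemma IsBeamSplitterOnTest.map_vacuum (hV : IsBeamSplitterOnTest V) :
    V (numberState (0, 0)) = numberState (0, 0) := by
  refine TestSpace.ext_amp fun i => (hV.hasSum_amp i (0, 0)).unique ?_
  have h0 : (Complex.I • hbsHamiltonian) (numberState (0, 0)) = 0 := by
    obtain ⟨-, h2, -, -⟩ := mode_commute
    have a0 : annihilation mode0 (numberState (0, 0)) = 0 := by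
      simp [annihilation_numberState, mode0]
    have a1 : annihilation mode1 (numberState (0, 0)) = 0 := by
      simp [annihilation_numberState, mode1]
    simp [I_smul_hbsHamiltonian, h2, a0, a1]
  convert hasSum_single 0 fun k hk => ?_ using 1
  · simp
  · obtain ⟨k, rfl⟩ := Nat.exists_eq_succ_of_ne_zero hk
    rw [pow_succ, Module.End.mul_apply, h0]
    simp

end

section

variable {ι : Type} [Occupation ι]

/-! ### Quadrature eigenvectors -/

/-- The functional pairs with conjugated amplitudes, whence `conj l`. This is invisible for position
but reverses the sign of the imaginary `l` in the momentum relation. -/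
lemma HasAmplitudes.apply_annihilation_add_creation {F : GenVec ι} {b : ι → ℂ}
    (hF : HasAmplitudes F b) (M : Mode ι) {l : ℂ}
    (h : ∀ i, √(M.occ i) * b (M.lower i) + √(M.occ i + 1) * b (M.raise i) = l * b i)
    (φ : TestSpace ι) : F (annihilation M φ) + F (creation M φ) = conj l * F φ := by
  refine ((hF.hasSum_annihilation M φ).add (hF.hasSum_creation M φ)).unique
    (((hF φ).mul_left (conj l)).congr_fun fun i => ?_)
  rw [← mul_assoc, ← map_mul, ← h, map_add, add_mul]

lemma HasAmplitudes.apply_annihilation_sub_creation {F : GenVec ι} {b : ι → ℂ}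
    (hF : HasAmplitudes F b) (M : Mode ι) {l : ℂ}
    (h : ∀ i, √(M.occ i) * b (M.lower i) - √(M.occ i + 1) * b (M.raise i) = l * b i)
    (φ : TestSpace ι) : F (annihilation M φ) - F (creation M φ) = conj l * F φ := by
  refine ((hF.hasSum_annihilation M φ).sub (hF.hasSum_creation M φ)).unique
    (((hF φ).mul_left (conj l)).congr_fun fun i => ?_)
  rw [← mul_assoc, ← map_mul, ← h, map_sub, sub_mul]

lemma hermiteFun_recursion (n : ℕ) (x : ℝ) :
    (√n : ℂ) * hermiteFun (n - 1) x + √(n + 1) * hermiteFun (n + 1) x =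
      √2 * x * hermiteFun n x := by
  have h := sqrt_succ_mul_hermiteFun_succ n x
  have h' := congrArg (fun x : ℝ => (x : ℂ)) h
  push_cast at h'
  linear_combination h'

lemma I_pow_hermiteFun_recursion (n : ℕ) (p : ℝ) :
    (√n : ℂ) * (Complex.I ^ (n - 1) * hermiteFun (n - 1) p) -
      √(n + 1) * (Complex.I ^ (n + 1) * hermiteFun (n + 1) p) =
      -Complex.I * (√2 * p) * (Complex.I ^ n * hermiteFun n p) := by
  have h := hermiteFun_recursion n p
  cases n with
  | zero =>
    simp only [CharP.cast_eq_zero, Real.sqrt_zero, Complex.ofReal_zero, zero_mul, zero_add, zero_sub,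
      pow_zero, pow_one, one_mul] at h ⊢
    linear_combination -Complex.I * h
  | succ n =>
    simp only [Nat.add_sub_cancel, pow_succ] at h ⊢
    linear_combination (-Complex.I * Complex.I ^ n * Complex.I) * h +
      (√((n + 1 : ℕ) : ℝ) * Complex.I ^ n * hermiteFun n p) * Complex.I_mul_I

lemma norm_I_pow (n : ℕ) : ‖Complex.I ^ n‖ = 1 := by simp

lemma hermiteFun_zero_pos (x : ℝ) : 0 < hermiteFun 0 x := by
  simp only [hermiteFun]
  have := Real.pi_pos
  positivity

lemma exists_position_eigenvector (x : ℝ) : ∃ F : GenVec ℕ,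
    HasAmplitudes F fun n => (1 : ℂ) * hermiteFun n x := by
  refine exists_hasAmplitudes (C := 2) (k := 1) fun n => ?_
  rw [one_mul, Complex.norm_real, Real.norm_eq_abs]
  refine (abs_hermiteFun_le n x).trans ?_
  simp only [weight, Occupation.total, pow_one]
  have : (0 : ℝ) ≤ n := n.cast_nonneg
  linarith

lemma exists_momentum_eigenvector (p : ℝ) : ∃ F : GenVec ℕ,
    HasAmplitudes F fun n => Complex.I ^ n * hermiteFun n p := by
  obtain ⟨C, k, hb⟩ := isHermiteSystem_hermiteFun.bounded
  refine exists_hasAmplitudes (C := C) (k := k) fun n => ?_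
  rw [norm_mul, norm_I_pow, one_mul, Complex.norm_real, Real.norm_eq_abs]
  exact hb n p

lemma isRepresentedBy_positionFun {x : ℝ} {F : GenVec ℕ}
    (hF : HasAmplitudes F fun n => (1 : ℂ) * hermiteFun n x) :
    IsRepresentedBy F (positionFun x) :=
  ⟨_, fun w => by simpa only [one_mul] using hasSum_positionFun x w, hF⟩

lemma isRepresentedBy_momentumFun {p : ℝ} {F : GenVec ℕ}
    (hF : HasAmplitudes F fun n => Complex.I ^ n * hermiteFun n p) :
    IsRepresentedBy F (momentumFun p) :=
  ⟨_, fun w => by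
    rw [momentumFun_eq]
    exact (hasSum_positionFun p (Complex.I * w)).congr_fun fun n => by rw [mul_pow]; ring, hF⟩

lemma ofReal_sqrt_two_ne_zero : (√2 : ℂ) ≠ 0 := by
  have : √(2 : ℝ) ≠ 0 := by positivity
  exact_mod_cast this

lemma isGenEigenvector_position {x : ℝ} {F : GenVec ℕ}
    (hF : HasAmplitudes F fun n => (1 : ℂ) * hermiteFun n x) :
    IsGenEigenvector position x F := by
  constructor
  · rintro rfl
    have := hF.apply_numberState 0
    simp at this
    exact (hermiteFun_zero_pos x).ne (by exact_mod_cast this)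
  · intro φ
    have h := hF.apply_annihilation_add_creation mode (l := √2 * x)
      (fun n => by simpa only [one_mul, mode] using hermiteFun_recursion n x) φ
    rw [position, LinearMap.smul_apply, LinearMap.add_apply, map_smul, map_add, h, smul_eq_mul,
      map_mul, Complex.conj_ofReal, Complex.conj_ofReal]
    have := ofReal_sqrt_two_ne_zero
    field_simp

lemma isGenEigenvector_momentum {p : ℝ} {F : GenVec ℕ}
    (hF : HasAmplitudes F fun n => Complex.I ^ n * hermiteFun n p) :
    IsGenEigenvector momentum p F := by
  constructor
  · rintro rfl
    have := hF.apply_numberState 0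
    simp at this
    exact (hermiteFun_zero_pos p).ne (by exact_mod_cast this)
  · intro φ
    have h := hF.apply_annihilation_sub_creation mode (l := -Complex.I * (√2 * p))
      (fun n => by simpa only [mode] using I_pow_hermiteFun_recursion n p) φ
    rw [momentum, LinearMap.smul_apply, LinearMap.sub_apply, map_smul, map_sub, h, smul_eq_mul,
      map_mul, map_mul, map_neg, Complex.conj_I, neg_neg, Complex.conj_ofReal, Complex.conj_ofReal]
    have := ofReal_sqrt_two_ne_zero
    have := Complex.I_ne_zero
    field_simp

/-! ### Products of quadrature eigenvectors -/

lemma exists_quadrature_product (z : ℂ) : ∃ T : GenVec (ℕ × ℕ),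
    HasAmplitudes T fun q => Complex.I ^ q.2 * hermiteFun₂ q z := by
  refine exists_hasAmplitudes (C := 4) (k := 2) fun q => ?_
  rw [norm_mul, norm_I_pow, one_mul, Complex.norm_real, Real.norm_eq_abs]
  exact abs_hermiteFun₂_le q z

lemma isTensor_of_hasAmplitudes {F G : GenVec ℕ} {T : GenVec (ℕ × ℕ)} {b c : ℕ → ℂ}
    (hF : HasAmplitudes F b) (hG : HasAmplitudes G c)
    (hT : HasAmplitudes T fun q => b q.1 * c q.2) : IsTensor F G T := fun φ χ => by
  have h := HasSum.mul (f := fun n => conj (b n) * φ.amp n) (g := fun n => conj (c n) * χ.amp n)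
    (hF φ) (hG χ) (summable_mul_of_summable_norm (f := fun n => conj (b n) * φ.amp n)
      (g := fun n => conj (c n) * χ.amp n) (hF φ).summable.norm (hG χ).summable.norm)
  refine (hT (tensorTest φ χ)).unique (h.congr_fun fun q => ?_)
  change _ * (φ.amp q.1 * χ.amp q.2) = _
  rw [map_mul]; ring

section QuadratureProduct

variable {z : ℂ} {T : GenVec (ℕ × ℕ)}
  (hT : HasAmplitudes T fun q => Complex.I ^ q.2 * hermiteFun₂ q z)
include hT

lemma quadrature_product_position (φ : TestSpace (ℕ × ℕ)) :
    T (annihilation mode0 φ) + T (creation mode0 φ) = √2 * z.re * T φ := by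
  rw [hT.apply_annihilation_add_creation mode0 (l := √2 * z.re) (fun q => ?_) φ, map_mul,
    Complex.conj_ofReal, Complex.conj_ofReal]
  simp only [mode0, hermiteFun₂]
  push_cast
  linear_combination Complex.I ^ q.2 * hermiteFun q.2 z.im * hermiteFun_recursion q.1 z.re

lemma quadrature_product_momentum (φ : TestSpace (ℕ × ℕ)) :
    T (annihilation mode1 φ) - T (creation mode1 φ) = Complex.I * (√2 * z.im) * T φ := by
  rw [hT.apply_annihilation_sub_creation mode1 (l := -Complex.I * (√2 * z.im)) (fun q => ?_) φ,
    map_mul, map_mul, map_neg, Complex.conj_I, neg_neg, Complex.conj_ofReal, Complex.conj_ofReal]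
  simp only [mode1, hermiteFun₂]
  push_cast
  linear_combination hermiteFun q.1 z.re * I_pow_hermiteFun_recursion q.2 z.im

lemma quadrature_product_vacuum :
    T (numberState (0, 0)) = (√Real.pi : ℂ)⁻¹ * Complex.exp (-(z * conj z) / 2) := by
  rw [hT.apply_numberState]
  have e : hermiteFun₂ (0, 0) z = (√Real.pi)⁻¹ * Real.exp (-(z.re ^ 2 + z.im ^ 2) / 2) := by
    simp only [hermiteFun₂, hermiteFun]
    rw [mul_mul_mul_comm, ← Real.exp_add, ← Real.rpow_add Real.pi_pos, Real.sqrt_eq_rpow,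
      ← Real.rpow_neg Real.pi_pos.le]
    congr 2
    · norm_num
    · ring
  rw [Complex.mul_conj, Complex.normSq_apply, pow_zero, one_mul, Complex.conj_ofReal, e]
  push_cast
  ring_nf

variable {V : TestSpace (ℕ × ℕ) →L[ℂ] TestSpace (ℕ × ℕ)} (hV : IsBeamSplitterOnTest V)
include hV

/-- The rotation turns `a₀ - a₁†` into `((a₀ + a₀†) + (a₁ - a₁†))/√2`, on which `T` takes the
eigenvalue `z.re + I * z.im`. In the next lemma `a₀† - a₁` likewise becomes `((a₀ + a₀†) - (a₁ -
a₁†))/√2`, with eigenvalue `conj z`. -/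
lemma quadrature_product_beamSplitter_zero (j : ℕ × ℕ) :
    T (V (annihilation mode0 (numberState j))) - T (V (creation mode1 (numberState j))) =
      z * T (V (numberState j)) := by
  rw [(hV.map_annihilation j).1, (hV.map_creation j).2]
  have h1 := quadrature_product_position hT (V (numberState j))
  have h2 := quadrature_product_momentum hT (V (numberState j))
  simp only [map_smul, map_add, map_sub, smul_eq_mul]
  have hz := Complex.re_add_im z
  have h3 := inv_mul_cancel₀ ofReal_sqrt_two_ne_zero
  linear_combination (√2 : ℂ)⁻¹ * (h1 + h2) +
    (z.re + Complex.I * z.im) * T (V (numberState j)) * h3 + T (V (numberState j)) * hz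

lemma quadrature_product_beamSplitter_one (j : ℕ × ℕ) :
    T (V (creation mode0 (numberState j))) - T (V (annihilation mode1 (numberState j))) =
      conj z * T (V (numberState j)) := by
  rw [(hV.map_annihilation j).2, (hV.map_creation j).1]
  have h1 := quadrature_product_position hT (V (numberState j))
  have h2 := quadrature_product_momentum hT (V (numberState j))
  simp only [map_smul, map_add, map_sub, smul_eq_mul]
  have hz := congrArg conj (Complex.re_add_im z)
  simp only [map_add, map_mul, Complex.conj_ofReal, Complex.conj_I] at hz
  have h3 := inv_mul_cancel₀ ofReal_sqrt_two_ne_zero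
  linear_combination (√2 : ℂ)⁻¹ * (h1 - h2) +
    (z.re - Complex.I * z.im) * T (V (numberState j)) * h3 + T (V (numberState j)) * hz

/-- The matrix elements of the displacement operator, by means of the beam splitter. -/
lemma displacement_apply_eq (m n : ℕ) : displacement z (ket n) m =
    conj (√Real.pi * T (V (numberState (m, n)))) := by
  set R : ℕ → ℕ → ℂ := fun m n => conj (√Real.pi * T (V (numberState (m, n)))) with hR
  refine congrFun (congrFun (eq_of_displacement_recursion (α := z)
    (D := fun m n => displacement z (ket n) m) (R := R) ?_ ?_ ?_ ?_ ?_) m) n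
  · have hpi : (√Real.pi : ℂ) ≠ 0 := by
      have : √Real.pi ≠ 0 := by have := Real.pi_pos; positivity
      exact_mod_cast this
    simp only [hR]
    rw [hV.map_vacuum, quadrature_product_vacuum hT, displacement_vacuum, mul_inv_cancel_left₀ hpi,
      ← Complex.exp_conj]
    congr 1
    simp only [map_div₀, map_neg, map_mul, Complex.conj_conj]
    rw [show conj (2 : ℂ) = 2 from Complex.conj_ofNat 2]
    ring
  · intro m
    simpa using displacement_annihilation z m 0
  · exact displacement_creation z
  -- On `(m, 0)` the annihilation operator of mode 1 contributes nothing, which leaves a recursion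
  -- in `m` alone.
  · intro m
    have h := congrArg conj (quadrature_product_beamSplitter_one hT hV (m, 0))
    rw [creation_numberState, annihilation_numberState] at h
    simp only [mode0, mode1, map_smul, smul_eq_mul, map_mul, Complex.conj_ofReal,
      Complex.conj_conj, CharP.cast_eq_zero, Real.sqrt_zero, Complex.ofReal_zero, zero_mul,
      sub_zero] at h
    simp only [hR, map_mul, Complex.conj_ofReal]
    linear_combination (√Real.pi : ℂ) * h
  · intro m n
    have h := congrArg conj (quadrature_product_beamSplitter_zero hT hV (m, n))
    rw [creation_numberState, annihilation_numberState] at h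
    simp only [mode0, mode1, map_smul, smul_eq_mul, map_sub, map_mul, Complex.conj_ofReal] at h
    simp only [hR, map_mul, Complex.conj_ofReal]
    linear_combination (√Real.pi : ℂ) * h

end QuadratureProduct

/-! ### Invariance under unitary operators -/

variable {U : Hilb ι ≃ₗᵢ[ℂ] Hilb ι} {V : TestSpace ι →L[ℂ] TestSpace ι}

lemma IsGenComplete.comp_unitary {E : Type} [MeasureTheory.MeasureSpace E] {F : E → GenVec ι}
    (hF : IsGenComplete F) (hV : ∀ φ, incl (V φ) = U (incl φ)) :
    IsGenComplete fun e => (F e).comp V := by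
  refine ⟨fun φ h => ?_, fun φ ψ => ?_⟩
  · have h0 := hF.1 (V φ) h
    have h1 := hV φ
    rw [h0, map_zero, eq_comm, map_eq_zero_iff U U.injective] at h1
    exact incl_injective (by rw [h1, map_zero])
  · have h := hF.2 (V φ) (V ψ)
    rw [hV, hV, U.inner_map_map] at h
    exact h

/-- Surjectivity on the test space is essential here: the smeared vector has to be pulled back
without leaving the test space. -/
lemma IsDeltaOrthonormal.comp_unitary {E : Type} [NormedAddCommGroup E] [NormedSpace ℝ E]
    [MeasureTheory.MeasureSpace E] {F : E → GenVec ι}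
    (hF : IsDeltaOrthonormal F) (hV : ∀ φ, incl (V φ) = U (incl φ))
    (hV' : ∀ φ, ∃ ψ, V ψ = φ) :
    IsDeltaOrthonormal fun e => (F e).comp V := by
  intro f
  obtain ⟨ψ, h1, h2⟩ := hF f
  obtain ⟨χ, rfl⟩ := hV' ψ
  refine ⟨χ, fun φ => ?_, h2⟩
  have h := h1 (V φ)
  rw [hV, hV, U.inner_map_map] at h
  exact h

end

end CVTeleport

end

/-! ### The Bell basis as preimage of the quadrature basis -/

theorem mainTheorem5 :
    (∀ α : ℂ, CVTeleport.IsExpI (CVTeleport.laserHamiltonian α) (CVTeleport.displacement α)) ∧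
    CVTeleport.IsExpI CVTeleport.hbsHamiltonian CVTeleport.halfBeamSplitter ∧
    ∃ (S : ℂ → CVTeleport.GenVec (ℕ × ℕ)) (X P : ℝ → CVTeleport.GenVec ℕ),
      -- `S α = ∑ (D(α)|n⟩) ⊗ |n⟩`
      (∀ α : ℂ, CVTeleport.IsGenSum
        (fun n : ℕ => CVTeleport.tensor (CVTeleport.displacement α (CVTeleport.ket n))
          (CVTeleport.ket n)) (S α)) ∧
      -- `X x = |x⟩` and `P p = |p⟩`
      (∀ x : ℝ, CVTeleport.IsRepresentedBy (X x) (CVTeleport.positionFun x) ∧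
        CVTeleport.IsGenEigenvector CVTeleport.position x (X x)) ∧
      (∀ p : ℝ, CVTeleport.IsRepresentedBy (P p) (CVTeleport.momentumFun p) ∧
        CVTeleport.IsGenEigenvector CVTeleport.momentum p (P p)) ∧
      -- the generalized Bell basis is a complete orthonormal system
      CVTeleport.IsGenComplete (fun α : ℂ => ((Real.sqrt Real.pi : ℂ)⁻¹) • S α) ∧
      CVTeleport.IsDeltaOrthonormal (fun α : ℂ => ((Real.sqrt Real.pi : ℂ)⁻¹) • S α) ∧
      -- `e^{i H_hbs} ∑ (D(α)|n⟩) ⊗ |n⟩ = π^{1/2} |x⟩ ⊗ |p⟩` for `α = x + i p`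
      (∀ x p : ℝ, ∃ T : CVTeleport.GenVec (ℕ × ℕ), CVTeleport.IsTensor (X x) (P p) T ∧
        CVTeleport.IsImage CVTeleport.halfBeamSplitter (S ((x : ℂ) + Complex.I * (p : ℂ)))
          ((Real.sqrt Real.pi : ℂ) • T)) ∧
      -- `⟨x'|x⟩ = δ(x' - x)` and `⟨p'|p⟩ = δ(p' - p)`
      CVTeleport.IsDeltaOrthonormal X ∧ CVTeleport.IsDeltaOrthonormal P := by
  open CVTeleport in
  obtain ⟨V, hV⟩ := numberPreserving_halfBeamSplitter.exists_clm
  obtain ⟨V', hV'⟩ := numberPreserving_halfBeamSplitter.symm.exists_clm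
  have hVV' : ∀ φ, V (V' φ) = φ := fun φ => incl_injective (by
    rw [hV, hV', LinearIsometryEquiv.apply_symm_apply])
  choose X hX using exists_position_eigenvector
  choose P hP using exists_momentum_eigenvector
  choose T hT using exists_quadrature_product
  have hpi : (√Real.pi : ℂ) ≠ 0 := by
    have : √Real.pi ≠ 0 := by have := Real.pi_pos; positivity
    exact_mod_cast this
  have hS : (fun α : ℂ => ((√Real.pi : ℂ)⁻¹) • ((√Real.pi : ℂ) • (T α).comp V)) =
      fun α => (T α).comp V := funext fun α => inv_smul_smul₀ hpi _
  -- The beam splitter acts on generalized vectors through its inverse `V'`, so composing with `V`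
  -- makes `S α` the preimage of `√π T α`. Its expansion in the displaced number states then follows
  -- from the amplitudes.
  refine ⟨isExpI_displacement, isExpI_halfBeamSplitter, fun α => (√Real.pi : ℂ) • (T α).comp V, X,
    P, fun α => ?_, fun x => ⟨isRepresentedBy_positionFun (hX x), isGenEigenvector_position (hX x)⟩,
    fun p => ⟨isRepresentedBy_momentumFun (hP p), isGenEigenvector_momentum (hP p)⟩, ?_, ?_,
    fun x p => ⟨T ((x : ℂ) + Complex.I * (p : ℂ)), ?_, fun φ => ⟨V' φ, hV' φ, ?_⟩⟩, ?_, ?_⟩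
  · refine isGenSum_tensor_ket ?_
    convert GenVec.hasAmplitudes ((√Real.pi : ℂ) • (T α).comp V) using 2 with q
    exact displacement_apply_eq (hT α) hV q.1 q.2
  · rw [hS]
    exact (isHermiteSystem_hermiteFun₂.isGenComplete (fun q => norm_I_pow q.2) hT).comp_unitary hV
  · rw [hS]
    exact (isHermiteSystem_hermiteFun₂.isDeltaOrthonormal (fun q => norm_I_pow q.2)
      hT).comp_unitary hV fun φ => ⟨V' φ, hVV' φ⟩
  · refine isTensor_of_hasAmplitudes (hX x) (hP p) ?_
    convert hT ((x : ℂ) + Complex.I * (p : ℂ)) using 2 with q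
    simp [hermiteFun₂]
    ring
  · simp [hVV']
  · exact isHermiteSystem_hermiteFun.isDeltaOrthonormal (fun _ => norm_one) hX
  · exact isHermiteSystem_hermiteFun.isDeltaOrthonormal norm_I_pow hP
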